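/- **Corollary 4.2.** Let $\Omega\subset\mathbb C$ be a bounded domain (non-empty, open, connected) with real-algebraic boundary, i.e. $\partial\Omega$ is contained in the zero set of a non-zero real polynomial in $x=\operatorname{Re}z$, $y=\operatorname{Im}z$. Let $C$ be the unbounded connected component of $\mathbb C\setminus\overline\Omega$. For $E\subset\mathbb C$ put $\Omega'_E=(\overline C\cup\Omega)\setminus E$, and call $E$ a *system of cuts* for $\Omega$ if - $E\subset\overline\Omega$ is a finite union of continuous curves $[0,1]\to\mathbb C$ and has empty interior; - $\Omega'_E$ is open and connected; - $\overline z$ extends analytically from $\partial C\setminus E$ to $\Omega\setminus E$, i.e. there is a function $S$, analytic in a neighbourhood of $(\Omega\cup\partial C)\setminus E$, with $S(z)=\overline z$ on $\partial C\setminus E$. Call $a\in\partial\Omega$ regular if $\partial\Omega$ is a single smooth real-analytic arc near $a$; the local Schwarz function at a regular point $a$ is the germ of analytic function at $a$ that equals $\overline z$ on $\partial\Omega$. Let $A\subset\overline\Omega$ consist of the non-regular points of $\partial\Omega$ and of the points of $\overline\Omega$ that are singular for some local Schwarz function (end points of paths along which that germ can be continued analytically up to, but not including, the end point; since the Schwarz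 functions are algebraic, these are ramification points and poles). For a compact $K\subset\mathbb C$ let $\mathcal O(K)$ be the space of germs of functions analytic in a neighbourhood of $K$, with its inductive limit topology. An analytic functional on $\mathcal O(K)$ is a continuous linear functional; it is carried by a compact $K'\subset K$ if it factors through the restriction $\mathcal O(K)\to\mathcal O(K')$ as a continuous linear functional on $\mathcal O(K')$. Then: 1. There is a system of cuts $E$ for $\Omega$ with $A\subset E$. 2. For every system of cuts $E$ for $\Omega$, $\partial\Omega'_E=E\cup(\partial\Omega\setminus\overline C)$ (the cuts together with the interior boundaries), and there is an analytic functional $u$ on $\mathcal O(\overline\Omega)$, carried by $\partial\Omega'_E$, such that $$\int_\Omega f\,dA=u(f)\qquad\text{for all } f\in\mathcal O(\overline\Omega).$$ -/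

import Mathlib

open Filter Topology MeasureTheory
open scoped ComplexConjugate

/-- `Ω` has real algebraic boundary: its boundary lies on the zero set of a nonzero real polynomial
in `x = Re z`, `y = Im z`. -/
def HasRealAlgebraicBoundary (Ω : Set ℂ) : Prop :=
  ∃ p : MvPolynomial (Fin 2) ℝ, p ≠ 0 ∧ ∀ z ∈ frontier Ω, MvPolynomial.eval ![z.re, z.im] p = 0

/-- The unbounded connected component of the complement of the closure of `Ω` (for bounded `Ω`
there is exactly one). -/
def unboundedComponent (Ω : Set ℂ) : Set ℂ :=
  {z | z ∈ (closure Ω)ᶜ ∧ ¬ Bornology.IsBounded (connectedComponentIn (closure Ω)ᶜ z)}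

/-- The set `Ω'`: the closed unbounded component together with `Ω`, minus the cuts `E`. -/
def cutDomain (Ω E : Set ℂ) : Set ℂ :=
  (closure (unboundedComponent Ω) ∪ Ω) \ E

/-- `E` is (the union of) a finite system of cuts for `Ω`. -/
structure IsCutSystem (Ω E : Set ℂ) : Prop where
  /-- `E` is the union of finitely many continuous curves. -/
  curves : ∃ (n : ℕ) (γ : Fin n → C(unitInterval, ℂ)), E = ⋃ i, Set.range (γ i)
  /-- The curves are not space-filling. -/
  thin : interior E = ∅
  subset_closure : E ⊆ closure Ω
  isOpen_cutDomain : IsOpen (cutDomain Ω E)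
  isConnected_cutDomain : IsConnected (cutDomain Ω E)
  /-- `conj z` extends analytically from the exterior boundary off `E` to `Ω \ E`; as always for a
  Schwarz function, the extension is analytic in a neighbourhood of the boundary arcs too. -/
  extends_conj : ∃ S : ℂ → ℂ,
    AnalyticOnNhd ℂ S ((Ω ∪ frontier (unboundedComponent Ω)) \ E) ∧
    ∀ z ∈ frontier (unboundedComponent Ω) \ E, S z = conj z

/-- Near `a` the boundary of `Ω` is one smooth real analytic arc: a conformal chart centred at `a`
straightens it to the real axis. -/
def IsRegularBoundaryPoint (Ω : Set ℂ) (a : ℂ) : Prop :=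
  ∃ (r : ℝ) (φ : ℂ → ℂ), 0 < r ∧ AnalyticOnNhd ℂ φ (Metric.ball 0 r) ∧
    Set.InjOn φ (Metric.ball 0 r) ∧ φ 0 = a ∧
    ∀ z ∈ Metric.ball (0 : ℂ) r, φ z ∈ frontier Ω ↔ z.im = 0

/-- `S` represents the local Schwarz function of the boundary of `Ω` at the regular boundary
point `a`. -/
def IsLocalSchwarzFunction (Ω : Set ℂ) (a : ℂ) (S : ℂ → ℂ) : Prop :=
  IsRegularBoundaryPoint Ω a ∧ AnalyticAt ℂ S a ∧ ∀ᶠ z in 𝓝[frontier Ω] a, S z = conj z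

/-- `g` is an analytic continuation of the function `S` along `γ`, over the parameter interval `I`
(which contains `0`): `g t` represents a germ at `γ t`, and neighbouring germs are compatible. -/
def IsContinuationAlong (S : ℂ → ℂ) (γ : ℝ → ℂ) (I : Set ℝ) (g : ℝ → ℂ → ℂ) : Prop :=
  g 0 =ᶠ[𝓝 (γ 0)] S ∧
  ∀ t ∈ I, AnalyticAt ℂ (g t) (γ t) ∧ ∀ᶠ s in 𝓝[I] t, g s =ᶠ[𝓝 (γ s)] g t

/-- `b` is a singular point of the (multivalued) analytic function generated by the germ of `S`
at `a`: some path from `a` to `b` admits a continuation up to, but not including, its end point.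
For an algebraic function these are the ramification points and the poles. -/
def IsSingularPointOf (S : ℂ → ℂ) (a b : ℂ) : Prop :=
  ∃ γ : ℝ → ℂ, ContinuousOn γ (Set.Icc 0 1) ∧ γ 0 = a ∧ γ 1 = b ∧
    (∃ g, IsContinuationAlong S γ (Set.Ico 0 1) g) ∧
    ¬ ∃ g, IsContinuationAlong S γ (Set.Icc 0 1) g

/-- The points of `closure Ω` through which cuts are drawn: the singular points of all local Schwarz
functions of the boundary, and the singular or multiple points of the boundary itself. -/
def branchSet (Ω : Set ℂ) : Set ℂ :=
  {b | b ∈ closure Ω ∧ ∃ (a : ℂ) (S : ℂ → ℂ),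
      IsLocalSchwarzFunction Ω a S ∧ IsSingularPointOf S a b} ∪
  {b | b ∈ frontier Ω ∧ ¬ IsRegularBoundaryPoint Ω b}

/-- The space `𝒪(K)` of germs along `K` of functions analytic in a neighbourhood of `K`. -/
noncomputable def analyticGerms (K : Set ℂ) : Submodule ℂ (Germ (𝓝ˢ K) ℂ) where
  carrier := {φ | ∃ f : ℂ → ℂ, AnalyticOnNhd ℂ f K ∧ φ = (f : Germ (𝓝ˢ K) ℂ)}
  add_mem' := by
    rintro _ _ ⟨f, hf, rfl⟩ ⟨g, hg, rfl⟩
    exact ⟨f + g, hf.add hg, rfl⟩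
  zero_mem' := ⟨0, analyticOnNhd_const, rfl⟩
  smul_mem' := by
    rintro c _ ⟨f, hf, rfl⟩
    exact ⟨c • f, fun z hz => analyticAt_const.smul (hf z hz), rfl⟩

/-- The germ along `K` of a function analytic near `K`. -/
noncomputable def analyticGerm {K : Set ℂ} (f : ℂ → ℂ) (hf : AnalyticOnNhd ℂ f K) : analyticGerms K :=
  ⟨(f : Germ (𝓝ˢ K) ℂ), f, hf, rfl⟩

/-- A continuous linear functional on `𝒪(K)`. The topology of `𝒪(K)` is the locally convex inductive
limit of the spaces `𝒪(V)`, `V ⊇ K` open, each with uniform convergence on compact sets; so a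
linear functional is continuous iff on each `𝒪(V)` it is bounded by a multiple of the supremum
over some compact subset of `V`. -/
structure AnalyticFunctional (K : Set ℂ) where
  toLinearMap : analyticGerms K →ₗ[ℂ] ℂ
  continuous_on : ∀ (V : Set ℂ), IsOpen V → ∀ hKV : K ⊆ V,
    ∃ L : Set ℂ, IsCompact L ∧ L ⊆ V ∧ ∃ c : ℝ,
      ∀ (f : ℂ → ℂ) (hf : AnalyticOnNhd ℂ f V) (M : ℝ), 0 ≤ M → (∀ z ∈ L, ‖f z‖ ≤ M) →
        ‖toLinearMap (analyticGerm f (hf.mono hKV))‖ ≤ c * M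

/-- `u ∈ 𝒪(K)'` is carried by `K' ⊆ K`: it extends to a continuous linear functional on `𝒪(K')`,
that is, it factors through the restriction `𝒪(K) → 𝒪(K')`. -/
def AnalyticFunctional.CarriedBy {K : Set ℂ} (u : AnalyticFunctional K) (K' : Set ℂ) : Prop :=
  ∃ (h : K' ⊆ K) (v : AnalyticFunctional K'), ∀ (f : ℂ → ℂ) (hf : AnalyticOnNhd ℂ f K),
    u.toLinearMap (analyticGerm f hf) = v.toLinearMap (analyticGerm f (hf.mono h))

/-! Existence of cuts. Put `P(z, w) = p((z + w)/2, (z - w)/(2i))`, so that `P(z, conj z) = p(x, y)`.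
By the identity theorem every local Schwarz function solves `P(z, S z) = 0`. Off a finite set `B`
the solutions are locally finitely many analytic branches with disjoint graphs
(`exists_finite_isLocallyBranched`), so Schwarz functions are singular only in `B`
(`mem_of_isSingularPointOf`), and over a convex open set avoiding `B` every branch is global because
the solution set is a covering (`exists_analyticOnNhd`).

Let `X` be a finite set of abscissas containing those of `B` and of the critical points of the
curve, and let the skeleton `T` be the curve together with the vertical lines over `X`. Then `T ∩
closure Ω` is a finite union of arcs, and finitely many connected cells cover the part of `Ω` off
`T`. Cut along all of `T ∩ closure Ω`, then reopen small windows, called gates: one from the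
unbounded component `C` into `Ω`, across a smooth boundary point, where `S` is the branch of `P`
equal to `conj z` on the curve; and then, as long as part of `Ω \ T` is unreached, one across `T`
inside `Ω`, away from `B`, into a new component of `Ω \ T`. That component lies over an interval
free of `X`, so the branch extends to it. Each gate reaches a component disjoint from what was
reached before, so no compatibility condition arises, and the finiteness of the cells ends the
process. The rest of `T ∩ closure Ω` is `E`. It contains the whole of `∂Ω` except one small arc.

The functional. Let `K = ∂Ω'_E`. Then `S` is analytic on `closure Ω \ K` and equals `conj z` on `∂Ω
\ K`. For `g` of class `C¹` consider the integral over `Ω` of `g + (conj z - S) ∂g/∂z̄`, which off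
`K` is `∂/∂z̄` of `(conj z - S) g`. If `g = 0` near `K`, then `(conj z - S) g` extended by zero
outside `Ω` is Lipschitz with compact support, as the first factor vanishes on `∂Ω \ K`; hence the
integral is zero (`IsSchwarzOff.integral_eq_zero`). So for `g` holomorphic near `K` the integral
depends only on the germ of `g` along `K`, and it defines a functional on `𝒪(K)`. If `g = f` near
`closure Ω` with `f` analytic there, the second term disappears and the integral is that of `f`.
This replaces the contour integral of `f · (conj z - S)` and needs no regularity of the cuts. -/

/-! ### Separable models of bivariate polynomials -/

open Polynomial in
theorem Polynomial.exists_map_eq_C_mul {R : Type*} [CommRing R] [IsDomain R]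
    (h : (FractionRing R)[X]) : ∃ (b : R) (H : R[X]), b ≠ 0 ∧
      H.map (algebraMap R (FractionRing R)) = C (algebraMap R (FractionRing R) b) * h := by
  obtain ⟨b, hb0, hb⟩ := IsLocalization.integerNormalization_spec (nonZeroDivisors R) h
  refine ⟨b, IsLocalization.integerNormalization (nonZeroDivisors R) h,
    nonZeroDivisors.ne_zero hb0, ?_⟩
  rw [hb, ← Polynomial.smul_eq_C_mul]
  ext n
  simp [Algebra.smul_def]

open Polynomial in
/-- Away from finitely many `z`, the fibre of a bivariate polynomial over `z` is the root set of a
separable polynomial of constant degree. -/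
theorem Polynomial.exists_separable_model (F : ℂ[X][X]) (hF : F ≠ 0) :
    ∃ (G : ℂ[X][X]) (d : ℂ[X]), d ≠ 0 ∧ ∀ z, d.eval z ≠ 0 →
      (∀ w, F.evalEval z w = 0 ↔ G.evalEval z w = 0) ∧
      (∀ w, G.evalEval z w = 0 → G.derivative.evalEval z w ≠ 0) ∧ G.leadingCoeff.eval z ≠ 0 := by
  classical
  let K := FractionRing ℂ[X]
  let φ : ℂ[X] →+* K := algebraMap ℂ[X] K
  have hφ : Function.Injective φ := IsFractionRing.injective ℂ[X] K
  have hmap : Function.Injective (Polynomial.map φ) := Polynomial.map_injective φ hφ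
  set f : K[X] := F.map φ with hf
  have hf0 : f ≠ 0 := (Polynomial.map_ne_zero_iff hφ).2 hF
  have : CharZero K := charZero_of_injective_algebraMap (R := ℂ[X]) hφ
  set r : K[X] := UniqueFactorizationMonoid.radical f with hr
  have hr0 : r ≠ 0 := UniqueFactorizationMonoid.radical_ne_zero
  have hsep : r.Separable :=
    PerfectField.separable_iff_squarefree.2 UniqueFactorizationMonoid.squarefree_radical
  obtain ⟨a, ha⟩ : r ∣ f := UniqueFactorizationMonoid.radical_dvd_self
  obtain ⟨n, e, he⟩ := UniqueFactorizationMonoid.exists_dvd_radical_self_pow hf0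
  obtain ⟨u, v, huv⟩ := hsep
  obtain ⟨b₁, G, hb₁, hG⟩ := exists_map_eq_C_mul r
  obtain ⟨b₂, A, hb₂, hA⟩ := exists_map_eq_C_mul a
  obtain ⟨b₃, E, hb₃, hE⟩ := exists_map_eq_C_mul e
  obtain ⟨b₄, U, hb₄, hU⟩ := exists_map_eq_C_mul u
  obtain ⟨b₅, V, hb₅, hV⟩ := exists_map_eq_C_mul v
  change G.map φ = C (φ b₁) * r at hG
  change A.map φ = C (φ b₂) * a at hA
  change E.map φ = C (φ b₃) * e at hE
  change U.map φ = C (φ b₄) * u at hU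
  change V.map φ = C (φ b₅) * v at hV
  have hG0 : G ≠ 0 := by
    rintro rfl
    have : C (φ b₁) * r ≠ 0 := mul_ne_zero (by simpa using fun h => hb₁ (hφ (by simpa using h))) hr0
    exact this (by rw [← hG]; simp)
  -- The three identities `h1`, `h2`, `h3` are `r ∣ f`, `f ∣ r ^ n` and the Bézout relation of `r`
  -- and its derivative, with denominators cleared. They specialise to every `z` at which none of
  -- the denominators vanishes.
  have h1 : G * A = C (b₁ * b₂) * F := by
    apply hmap
    rw [Polynomial.map_mul, Polynomial.map_mul, hG, hA, ← hf, ha, Polynomial.map_C, map_mul, C_mul]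
    ring
  have h2 : C (b₁ ^ n) * (F * E) = C b₃ * G ^ n := by
    apply hmap
    simp only [Polynomial.map_mul, Polynomial.map_pow, Polynomial.map_C]
    rw [← hf, hG, hE, mul_pow, he, map_pow, C_pow]
    ring
  have h3 : U * G * C b₅ + V * G.derivative * C b₄ = C (b₁ * b₄ * b₅) := by
    apply hmap
    have hd : G.derivative.map φ = C (φ b₁) * r.derivative := by
      rw [← Polynomial.derivative_map, hG, Polynomial.derivative_C_mul]
    simp only [Polynomial.map_add, Polynomial.map_mul, Polynomial.map_C, hd, hG, hU, hV, map_mul]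
    calc _ = C (φ b₁) * C (φ b₄) * C (φ b₅) * (u * r + v * derivative r) := by ring
      _ = _ := by rw [huv, mul_one]
  refine ⟨G, b₁ * b₂ * b₃ * b₄ * b₅ * G.leadingCoeff, ?_, ?_⟩
  · simp [hb₁, hb₂, hb₃, hb₄, hb₅, hG0]
  intro z hz
  simp only [eval_mul, mul_ne_zero_iff] at hz
  obtain ⟨⟨⟨⟨⟨z₁, z₂⟩, z₃⟩, z₄⟩, z₅⟩, z₆⟩ := hz
  refine ⟨fun w => ⟨fun h => ?_, fun h => ?_⟩, fun w h h' => ?_, z₆⟩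
  · have := congrArg (evalEval z w) h2
    simp only [evalEval_mul, evalEval_C, evalEval_pow, h, zero_mul, mul_zero] at this
    exact eq_zero_of_pow_eq_zero ((mul_eq_zero.1 this.symm).resolve_left z₃)
  · have := congrArg (evalEval z w) h1
    simp only [evalEval_mul, evalEval_C, h, zero_mul, eval_mul] at this
    exact (mul_eq_zero.1 this.symm).resolve_left (mul_ne_zero z₁ z₂)
  · have := congrArg (evalEval z w) h3
    simp [evalEval_mul, evalEval_add, evalEval_C, h, h', z₁, z₄, z₅] at this

/-! ### Local analytic branches of the roots -/

/-- Near `z₀` the fibres of the relation `R` are the values of finitely many analytic functions with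
pairwise disjoint graphs. -/
def IsLocallyBranched (R : ℂ → ℂ → Prop) (z₀ : ℂ) : Prop :=
  ∃ (n : ℕ) (s : Fin n → ℂ → ℂ) (r : ℝ), 0 < r ∧
    (∀ k, AnalyticOnNhd ℂ (s k) (Metric.ball z₀ r)) ∧
    ∀ z ∈ Metric.ball z₀ r, Function.Injective (fun k => s k z) ∧ ∀ w, R z w ↔ ∃ k, s k z = w

namespace Polynomial

theorem evalEval_eq_eval_map (G : ℂ[X][X]) (z w : ℂ) :
    G.evalEval z w = (G.map (evalRingHom z)).eval w := by
  rw [map_evalRingHom_eval]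

theorem contDiff_evalEval (G : ℂ[X][X]) {n : WithTop ℕ∞} :
    ContDiff ℂ n (fun v : ℂ × ℂ => G.evalEval v.1 v.2) := by
  have : (fun v : ℂ × ℂ => G.evalEval v.1 v.2) =
      fun v => ∑ i ∈ Finset.range (G.natDegree + 1), (G.coeff i).eval v.1 * v.2 ^ i := by
    ext v
    rw [evalEval, eval_eq_sum_range (p := G), eval_finsetSum]
    simp
  rw [this]
  refine ContDiff.sum fun i _ => ContDiff.mul ?_ (contDiff_snd.pow i)
  exact (Polynomial.contDiff_aeval (G.coeff i) n).comp contDiff_fst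

theorem hasDerivAt_evalEval (G : ℂ[X][X]) (z w : ℂ) :
    HasDerivAt (fun w => G.evalEval z w) (G.derivative.evalEval z w) w := by
  simp only [evalEval_eq_eval_map]
  rw [← derivative_map]
  exact Polynomial.hasDerivAt _ _

theorem exists_local_branch (G : ℂ[X][X]) (z₀ w₀ : ℂ) (h0 : G.evalEval z₀ w₀ = 0)
    (h1 : G.derivative.evalEval z₀ w₀ ≠ 0) :
    ∃ ψ : ℂ → ℂ, AnalyticAt ℂ ψ z₀ ∧ ψ z₀ = w₀ ∧ ∀ᶠ z in 𝓝 z₀, G.evalEval z (ψ z) = 0 := by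
  set f : ℂ × ℂ → ℂ := fun v => G.evalEval v.1 v.2
  have cdf : ContDiffAt ℂ ⊤ f (z₀, w₀) := (contDiff_evalEval G).contDiffAt
  have hd : (fderiv ℂ f (z₀, w₀) ∘L .inr ℂ ℂ ℂ) 1 = G.derivative.evalEval z₀ w₀ := by
    have h2 : HasDerivAt (fun w => (z₀, w)) ((0, 1) : ℂ × ℂ) w₀ :=
      (hasDerivAt_const w₀ z₀).prodMk (hasDerivAt_id w₀)
    have h3 := (cdf.differentiableAt (by simp)).hasFDerivAt.comp_hasDerivAt w₀ h2
    simpa using h3.unique (hasDerivAt_evalEval G z₀ w₀)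
  have hinv : (fderiv ℂ f (z₀, w₀) ∘L .inr ℂ ℂ ℂ).IsInvertible := by
    refine ⟨ContinuousLinearEquiv.unitsEquivAut ℂ (Units.mk0 _ h1), ?_⟩
    ext
    simp [← hd]
  refine ⟨cdf.implicitFunction (by simp) hinv,
    (cdf.contDiffAt_implicitFunction (by simp) hinv).analyticAt,
    cdf.implicitFunction_apply_self (by simp) hinv, ?_⟩
  filter_upwards [cdf.eventually_apply_implicitFunction (by simp) hinv] with z hz
  exact hz.trans h0

/-- The implicit function theorem gives one branch through each of the `natDegree` distinct roots
over `z₀`. Nearby the branches stay distinct, and a fibre has at most `natDegree` points, so they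
exhaust it. -/
theorem isLocallyBranched_of_separable (G : ℂ[X][X]) (z₀ : ℂ)
    (h1 : ∀ w, G.evalEval z₀ w = 0 → G.derivative.evalEval z₀ w ≠ 0)
    (h2 : G.leadingCoeff.eval z₀ ≠ 0) :
    IsLocallyBranched (fun z w => G.evalEval z w = 0) z₀ := by
  classical
  set g := G.map (evalRingHom z₀)
  have hdeg : g.natDegree = G.natDegree := natDegree_map_of_leadingCoeff_ne_zero _ h2
  have hg0 : g ≠ 0 := by
    intro h
    have := congrArg (fun q => coeff q G.natDegree) h
    simp [g, h2] at this
  have hsep : g.Separable := by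
    refine (isCoprime_iff_aeval_ne_zero_of_isAlgClosed ℂ ℂ g (derivative g)).2 fun w => ?_
    by_cases h : aeval w g = 0
    · right
      simp only [g, coe_aeval_eq_eval, derivative_map, ← evalEval_eq_eval_map] at h ⊢
      exact h1 w h
    · exact Or.inl h
  set rs := g.roots.toFinset
  have hcard : rs.card = G.natDegree := by
    rw [Multiset.toFinset_card_of_nodup (nodup_roots hsep), ← hdeg]
    exact (IsAlgClosed.splits g).natDegree_eq_card_roots.symm
  have hroot : ∀ w ∈ rs, G.evalEval z₀ w = 0 := fun w hw => by
    rw [evalEval_eq_eval_map]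
    exact isRoot_of_mem_roots (Multiset.mem_toFinset.1 hw)
  let e := rs.equivFin
  choose ψ hψa hψ0 hψ using fun k : Fin rs.card =>
    exists_local_branch G z₀ (e.symm k) (hroot _ (e.symm k).2) (h1 _ (hroot _ (e.symm k).2))
  have hinj : ∀ᶠ z in 𝓝 z₀, Function.Injective fun k => ψ k z := by
    have : ∀ k l, ∀ᶠ z in 𝓝 z₀, ψ k z = ψ l z → k = l := fun k l => by
      by_cases hkl : k = l
      · simp [hkl]
      · have hne : ψ k z₀ ≠ ψ l z₀ := by
          rw [hψ0, hψ0]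
          exact fun h => hkl (e.symm.injective (Subtype.ext h))
        filter_upwards [((hψa k).continuousAt.sub (hψa l).continuousAt).eventually_ne
          (sub_ne_zero.2 hne)] with z hz h
        exact absurd (sub_eq_zero.2 h) hz
    filter_upwards [eventually_all.2 fun k => eventually_all.2 (this k)] with z hz k l h
    exact hz k l h
  have hlc : ∀ᶠ z in 𝓝 z₀, G.leadingCoeff.eval z ≠ 0 :=
    G.leadingCoeff.continuous.continuousAt.eventually_ne h2
  obtain ⟨r, hr, hball⟩ := Metric.eventually_nhds_iff_ball.1
    ((eventually_all.2 hψ).and ((eventually_all.2 fun k => (hψa k).eventually_analyticAt).and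
      (hinj.and hlc)))
  refine ⟨rs.card, ψ, r, hr, fun k z hz => (hball z hz).2.1 k, fun z hz => ?_⟩
  obtain ⟨hz1, -, hz2, hz3⟩ := hball z hz
  refine ⟨hz2, fun w => ⟨fun hw => ?_, ?_⟩⟩
  · set gz := G.map (evalRingHom z)
    have hgz0 : gz ≠ 0 := by
      intro h
      have := congrArg (fun q => coeff q G.natDegree) h
      simp [gz, hz3] at this
    have hsub : Finset.univ.image (fun k => ψ k z) ⊆ gz.roots.toFinset := by
      intro w hw
      obtain ⟨k, -, rfl⟩ := Finset.mem_image.1 hw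
      rw [Multiset.mem_toFinset, mem_roots hgz0, IsRoot, ← evalEval_eq_eval_map]
      exact hz1 k
    have heq := Finset.eq_of_subset_of_card_le hsub (by
      rw [Finset.card_image_of_injective _ hz2, Finset.card_univ, Fintype.card_fin, hcard]
      exact (Multiset.toFinset_card_le _).trans ((card_roots' _).trans natDegree_map_le))
    have : w ∈ gz.roots.toFinset := by
      rw [Multiset.mem_toFinset, mem_roots hgz0, IsRoot, ← evalEval_eq_eval_map]
      exact hw
    rw [← heq] at this
    obtain ⟨k, -, hk⟩ := Finset.mem_image.1 this
    exact ⟨k, hk⟩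
  · rintro ⟨k, rfl⟩
    exact hz1 k

/-- Away from finitely many points, the roots of a bivariate polynomial are locally given by
analytic branches. -/
theorem exists_finite_isLocallyBranched (F : ℂ[X][X]) (hF : F ≠ 0) :
    ∃ B : Set ℂ, B.Finite ∧ ∀ z ∉ B, IsLocallyBranched (fun z w => F.evalEval z w = 0) z := by
  obtain ⟨G, d, hd, h⟩ := exists_separable_model F hF
  refine ⟨{z | d.eval z = 0}, ?_, fun z₀ hz₀ => ?_⟩
  · exact (d.roots.toFinset.finite_toSet).subset fun z hz => by simpa [hd] using hz
  · obtain ⟨n, s, r, hr, hs, hz⟩ := isLocallyBranched_of_separable G z₀ (h z₀ hz₀).2.1 (h z₀ hz₀).2.2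
    obtain ⟨r', hr', hball⟩ := Metric.eventually_nhds_iff_ball.1
      (d.continuous.continuousAt.eventually_ne hz₀ : ∀ᶠ z in 𝓝 z₀, d.eval z ≠ 0)
    refine ⟨n, s, min r r', lt_min hr hr',
      fun k => (hs k).mono (Metric.ball_subset_ball (min_le_left _ _)), fun z hz' => ?_⟩
    have h1 := hz z (Metric.ball_subset_ball (min_le_left _ _) hz')
    have h2 := h z (hball z (Metric.ball_subset_ball (min_le_right _ _) hz'))
    exact ⟨h1.1, fun w => (h2.1 w).trans (h1.2 w)⟩

end Polynomial

/-! ### Uniqueness and continuation of branches -/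

/-- The continuity argument used throughout: germ identities, strict inequalities and membership in
`closure Ω` are propagated along intervals by checking that they are locally constant. -/
theorem IsPreconnected.iff_of_eventually {α : Type*} [TopologicalSpace α] {s : Set α}
    (hs : IsPreconnected s) {p : α → Prop} (h : ∀ x ∈ s, ∀ᶠ y in 𝓝[s] x, (p y ↔ p x))
    {x y : α} (hx : x ∈ s) (hy : y ∈ s) : p x ↔ p y := by
  have : PreconnectedSpace s := Subtype.preconnectedSpace hs
  have hloc : IsLocallyConstant (fun z : s => p z) := by
    rw [IsLocallyConstant.iff_eventually_eq]
    intro z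
    rw [nhds_subtype_eq_comap_nhdsWithin]
    filter_upwards [preimage_mem_comap (h z z.2)] with w hw
    exact propext hw
  exact iff_of_eq (hloc.apply_eq_of_isPreconnected isPreconnected_univ
    (Set.mem_univ (⟨x, hx⟩ : s)) (Set.mem_univ (⟨y, hy⟩ : s)))

namespace IsLocallyBranched

variable {R : ℂ → ℂ → Prop}

/-- The last clause says that near `(z₀, w₀)` the relation is a single graph, since the other
branches stay away from `w₀`. The uniqueness statements for branches rest on it. -/
theorem exists_branch {z₀ w₀ : ℂ} (h : IsLocallyBranched R z₀) (h0 : R z₀ w₀) :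
    ∃ ψ : ℂ → ℂ, AnalyticAt ℂ ψ z₀ ∧ ψ z₀ = w₀ ∧ (∀ᶠ z in 𝓝 z₀, R z (ψ z)) ∧
      ∀ᶠ v in 𝓝 (z₀, w₀), R v.1 v.2 → v.2 = ψ v.1 := by
  obtain ⟨n, s, r, hr, hs, hz⟩ := h
  have hz₀ := hz z₀ (Metric.mem_ball_self hr)
  obtain ⟨k, hk⟩ := (hz₀.2 w₀).1 h0
  have hball := Metric.ball_mem_nhds z₀ hr
  refine ⟨s k, hs k z₀ (Metric.mem_ball_self hr), hk, ?_, ?_⟩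
  · filter_upwards [hball] with z hz'
    exact ((hz z hz').2 _).2 ⟨k, rfl⟩
  · have hne : ∀ l, ∀ᶠ v : ℂ × ℂ in 𝓝 (z₀, w₀), s l v.1 = v.2 → l = k := fun l => by
      by_cases hl : l = k
      · simp [hl]
      · have hne : s l z₀ - w₀ ≠ 0 := by
          rw [← hk, sub_ne_zero]
          exact fun h => hl (hz₀.1 h)
        have hc : ContinuousAt (fun v : ℂ × ℂ => s l v.1 - v.2) (z₀, w₀) :=
          (ContinuousAt.comp (f := Prod.fst) (x := (z₀, w₀))
            (hs l z₀ (Metric.mem_ball_self hr)).continuousAt continuousAt_fst).sub continuousAt_snd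
        filter_upwards [hc.eventually_ne hne] with v hv h
        exact absurd (sub_eq_zero.2 h) hv
    have hfst : ∀ᶠ v : ℂ × ℂ in 𝓝 (z₀, w₀), v.1 ∈ Metric.ball z₀ r :=
      continuousAt_fst.eventually hball
    filter_upwards [eventually_all.2 hne, hfst] with v hv hv' hR
    obtain ⟨l, hl⟩ := ((hz _ hv').2 _).1 hR
    rw [← hv l hl, hl]

/-- Two continuous sections of a locally branched relation over a preconnected set which agree at
one point agree everywhere. -/
theorem eqOn_of_isPreconnected {T : Set ℂ} (hT : IsPreconnected T)
    (hR : ∀ z ∈ T, IsLocallyBranched R z) {s t : ℂ → ℂ} (hs : ContinuousOn s T)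
    (ht : ContinuousOn t T) (hsR : ∀ z ∈ T, R z (s z)) (htR : ∀ z ∈ T, R z (t z))
    {z₀ : ℂ} (hz₀ : z₀ ∈ T) (h0 : s z₀ = t z₀) : Set.EqOn s t T := by
  have : PreconnectedSpace T := Subtype.preconnectedSpace hT
  have hs' := continuousOn_iff_continuous_domRestrict.1 hs
  have ht' := continuousOn_iff_continuous_domRestrict.1 ht
  have hclopen : IsClopen {x : T | T.domRestrict s x = T.domRestrict t x} := by
    refine ⟨isClosed_eq hs' ht', isOpen_iff_mem_nhds.2 fun x hx => ?_⟩
    obtain ⟨ψ, -, -, -, hψ⟩ := (hR x x.2).exists_branch (hsR x x.2)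
    have h1 : Tendsto (fun y : T => ((y : ℂ), s y)) (𝓝 x) (𝓝 ((x : ℂ), s x)) :=
      (continuous_subtype_val.prodMk hs').continuousAt
    have h2 : Tendsto (fun y : T => ((y : ℂ), t y)) (𝓝 x) (𝓝 ((x : ℂ), s x)) := by
      have hx' : s x = t x := hx
      rw [hx']
      exact (continuous_subtype_val.prodMk ht').continuousAt
    filter_upwards [h1.eventually hψ, h2.eventually hψ] with y hy1 hy2
    exact (hy1 (hsR y y.2)).trans (hy2 (htR y y.2)).symm
  have huniv := hclopen.eq_univ ⟨⟨z₀, hz₀⟩, h0⟩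
  intro z hz
  have : (⟨z, hz⟩ : T) ∈ {x : T | T.domRestrict s x = T.domRestrict t x} := huniv ▸ Set.mem_univ _
  exact this

theorem analyticAt_of_continuousAt {s : ℂ → ℂ} {z₀ : ℂ} (h : IsLocallyBranched R z₀)
    (hs : ContinuousAt s z₀) (hR : ∀ᶠ z in 𝓝 z₀, R z (s z)) : AnalyticAt ℂ s z₀ := by
  obtain ⟨ψ, hψ, -, -, huniq⟩ := h.exists_branch hR.self_of_nhds
  have h1 : Tendsto (fun z => (z, s z)) (𝓝 z₀) (𝓝 (z₀, s z₀)) := continuousAt_id.prodMk hs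
  refine hψ.congr ?_
  filter_upwards [h1.eventually huniq, hR] with z hz hz'
  exact (hz hz').symm

theorem eventuallyEq {s t : ℂ → ℂ} {z₀ : ℂ} (h : IsLocallyBranched R z₀)
    (hs : ContinuousAt s z₀) (ht : ContinuousAt t z₀) (hsR : ∀ᶠ z in 𝓝 z₀, R z (s z))
    (htR : ∀ᶠ z in 𝓝 z₀, R z (t z)) (h0 : s z₀ = t z₀) : s =ᶠ[𝓝 z₀] t := by
  obtain ⟨ψ, hψ, -, -, huniq⟩ := h.exists_branch hsR.self_of_nhds
  have h1 : Tendsto (fun z => (z, s z)) (𝓝 z₀) (𝓝 (z₀, s z₀)) := continuousAt_id.prodMk hs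
  have h2 : Tendsto (fun z => (z, t z)) (𝓝 z₀) (𝓝 (z₀, s z₀)) := by
    rw [h0]
    exact continuousAt_id.prodMk ht
  filter_upwards [h1.eventually huniq, h2.eventually huniq, hsR, htR] with z hz1 hz2 hz3 hz4
  exact (hz1 hz3).trans (hz2 hz4).symm

theorem eventually_isLocallyBranched {z₀ : ℂ} (h : IsLocallyBranched R z₀) :
    ∀ᶠ z in 𝓝 z₀, IsLocallyBranched R z := by
  obtain ⟨n, s, r, hr, hs, hz⟩ := h
  filter_upwards [Metric.ball_mem_nhds z₀ hr] with z hz'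
  obtain ⟨ε, hε, hsub⟩ := Metric.isOpen_iff.1 Metric.isOpen_ball z hz'
  exact ⟨n, s, ε, hε, fun k => (hs k).mono hsub, fun y hy => hz y (hsub hy)⟩

/-- Over the ball of the definition the sheets are indexed by `k`; this label is locally constant
because the graphs are disjoint. -/
theorem isCoveringMap {U : Set ℂ} (hR : ∀ z ∈ U, IsLocallyBranched R z) :
    IsCoveringMap (fun e : {v : U × ℂ // R v.1 v.2} => e.1.1) := by
  intro x
  obtain ⟨n, s, r, hr, hs, hz⟩ := hR x x.2
  have hV : IsOpen {z : U | (z : ℂ) ∈ Metric.ball (x : ℂ) r} :=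
    Metric.isOpen_ball.preimage continuous_subtype_val
  set V := {z : U | (z : ℂ) ∈ Metric.ball (x : ℂ) r}
  set p : {v : U × ℂ // R v.1 v.2} → U := fun e => e.1.1
  have hp : Continuous p := continuous_fst.comp continuous_subtype_val
  have hk : ∀ e : p ⁻¹' V, ∃ k, s k e.1.1.1 = e.1.1.2 := fun e => ((hz _ e.2).2 _).1 e.1.2
  choose κ hκ using hk
  refine IsEvenlyCovered.to_isEvenlyCovered_preimage (I := Fin n)
    ⟨inferInstance, V, Metric.mem_ball_self hr, hV, hV.preimage hp, ?_⟩
  refine ⟨{ toFun := fun e => (⟨p e.1, e.2⟩, κ e)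
            invFun := fun zk => ⟨⟨(zk.1.1, s zk.2 zk.1.1), ((hz _ zk.1.2).2 _).2 ⟨zk.2, rfl⟩⟩,
              zk.1.2⟩
            left_inv := ?_
            right_inv := ?_
            continuous_toFun := ?_
            continuous_invFun := ?_ }, fun _ => rfl⟩
  · intro e
    exact Subtype.ext (Subtype.ext (Prod.ext rfl (hκ e)))
  · rintro ⟨z, k⟩
    refine Prod.ext rfl ((hz _ z.2).1 ?_)
    exact hκ ⟨⟨(z.1, s k z.1), ((hz _ z.2).2 _).2 ⟨k, rfl⟩⟩, z.2⟩
  · refine Continuous.prodMk ((hp.comp continuous_subtype_val).subtype_mk _) ?_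
    refine continuous_iff_continuousAt.2 fun e => ?_
    rw [ContinuousAt, nhds_discrete (Fin n), tendsto_pure]
    have hne : ∀ l, ∀ᶠ e' : p ⁻¹' V in 𝓝 e, s l e'.1.1.1 = e'.1.1.2 → l = κ e := fun l => by
      by_cases hl : l = κ e
      · simp [hl]
      · have hne : s l e.1.1.1 - e.1.1.2 ≠ 0 := by
          rw [← hκ e, sub_ne_zero]
          exact fun h => hl ((hz _ e.2).1 h)
        have hc1 : ContinuousAt (fun e' : p ⁻¹' V => ((e'.1.1.1 : U) : ℂ)) e :=
          (by fun_prop : Continuous fun e' : p ⁻¹' V => ((e'.1.1.1 : U) : ℂ)).continuousAt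
        have hc : ContinuousAt (fun e' : p ⁻¹' V => s l e'.1.1.1 - e'.1.1.2) e :=
          (ContinuousAt.comp (f := fun e' : p ⁻¹' V => ((e'.1.1.1 : U) : ℂ))
            (hs l _ e.2).continuousAt hc1).sub (by fun_prop)
        filter_upwards [hc.eventually_ne hne] with v hv h
        exact absurd (sub_eq_zero.2 h) hv
    filter_upwards [eventually_all.2 hne] with e' he'
    exact he' _ (hκ e')
  · refine Continuous.subtype_mk (Continuous.subtype_mk (Continuous.prodMk (by fun_prop) ?_) _) _
    refine continuous_iff_continuousAt.2 fun ⟨z, k⟩ => ?_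
    have h1 : ∀ᶠ zk : V × Fin n in 𝓝 (z, k), zk.2 = k := by
      have : Tendsto (Prod.snd : V × Fin n → Fin n) (𝓝 (z, k)) (pure k) := by
        rw [← nhds_discrete (Fin n)]
        exact continuousAt_snd
      exact tendsto_pure.1 this
    have h2 : ContinuousAt (fun zk : V × Fin n => s k zk.1.1) (z, k) :=
      ContinuousAt.comp (f := fun zk : V × Fin n => ((zk.1.1 : U) : ℂ)) (hs k _ z.2).continuousAt
        (by fun_prop)
    refine h2.congr ?_
    filter_upwards [h1] with zk hzk
    rw [hzk]

/-- Over a convex open set, a locally branched relation has a global analytic branch through every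
point. -/
theorem exists_analyticOnNhd {U : Set ℂ} (hU : IsOpen U) (hconv : Convex ℝ U)
    (hR : ∀ z ∈ U, IsLocallyBranched R z) {z₀ w₀ : ℂ} (hz₀ : z₀ ∈ U) (h0 : R z₀ w₀) :
    ∃ s : ℂ → ℂ, AnalyticOnNhd ℂ s U ∧ s z₀ = w₀ ∧ ∀ z ∈ U, R z (s z) := by
  classical
  have cov := isCoveringMap hR
  let x₀ : U := ⟨z₀, hz₀⟩
  let e₀ : {v : U × ℂ // R v.1 v.2} := ⟨(x₀, w₀), h0⟩
  -- The radial homotopy from the constant map `z₀` to the identity of `U`. It is lifted to the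
  -- covering, and the lift at time `1` is a section.
  let H : C(unitInterval × U, U) :=
    { toFun := fun tz => ⟨z₀ + (tz.1 : ℝ) • (tz.2 - z₀),
        hconv.add_smul_sub_mem hz₀ tz.2.2 tz.1.2⟩
      continuous_toFun := by fun_prop }
  have hH0 : ∀ z, H (0, z) = (ContinuousMap.const U e₀ z).1.1 := fun z => by
    refine Subtype.ext ?_
    simp [H, e₀, x₀]
  let Φ := cov.liftHomotopy H (ContinuousMap.const U e₀) hH0
  have hΦ : ∀ t z, (Φ (t, z)).1.1 = H (t, z) := fun t z =>
    congrFun (cov.liftHomotopy_lifts H (ContinuousMap.const U e₀) hH0) (t, z)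
  have hH1 : ∀ z, H (1, z) = z := fun z => Subtype.ext (by simp [H])
  let s : ℂ → ℂ := fun z => if h : z ∈ U then (Φ (1, ⟨z, h⟩)).1.2 else 0
  have hsU : ∀ z : U, s z = (Φ (1, z)).1.2 := fun z => by simp [s]
  have hsR : ∀ z ∈ U, R z (s z) := fun z hz => by
    have := (Φ (1, ⟨z, hz⟩)).2
    rw [hΦ, hH1] at this
    rw [hsU ⟨z, hz⟩]
    exact this
  have hsc : ContinuousOn s U := by
    rw [continuousOn_iff_continuous_domRestrict]
    have : U.domRestrict s = fun z => (Φ (1, z)).1.2 := funext hsU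
    rw [this]
    fun_prop
  refine ⟨s, fun z hz => ?_, ?_, hsR⟩
  · refine (hR z hz).analyticAt_of_continuousAt (hsc.continuousAt (hU.mem_nhds hz)) ?_
    filter_upwards [hU.mem_nhds hz] with z' hz' using hsR z' hz'
  -- The homotopy is stationary at `z₀`, so its lift there is the constant path at `w₀`.
  · have hconst : (ContinuousMap.const (unitInterval) e₀ : unitInterval → _) =
        cov.liftPath (H.comp ((ContinuousMap.id _).prodMk (.const _ x₀))) e₀ (hH0 x₀) := by
      refine (cov.eq_liftPath_iff _).2 ⟨by fun_prop, ?_, rfl⟩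
      ext t
      simp [H, e₀, x₀]
    have h1 := congrFun hconst 1
    rw [hsU x₀]
    have h2 : Φ (1, x₀) = e₀ := h1.symm
    rw [h2]

end IsLocallyBranched

/-! ### The algebraic data of the boundary curve -/

/-- The data extracted from a real algebraic curve: the relation `Q x y` cuts out its points
`x + iy`, while `P z w` is the equation satisfied by its Schwarz functions `w = S z`. Both are
algebraic, and well behaved off the finitely many vertical lines over `X`, resp. the finite
set `B`. -/
structure IsCurveData (Q P : ℂ → ℂ → Prop) (X : Set ℝ) (B : Set ℂ) : Prop where
  finite_X : X.Finite
  finite_B : B.Finite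
  re_mem : ∀ b ∈ B, b.re ∈ X
  branched_Q : ∀ z : ℂ, z.re ∉ X → IsLocallyBranched Q z
  branched_P : ∀ z ∉ B, IsLocallyBranched P z
  isClosed_Q : IsClosed {v : ℂ × ℂ | Q v.1 v.2}
  finite_Q : ∀ x : ℝ, {y : ℝ | Q x y}.Finite
  conj_Q : ∀ x : ℝ, x ∉ X → ∀ w, Q x w → Q x (conj w)
  schwarz : ∀ z : ℂ, z.re ∉ X → Q z.re z.im → P z (conj z)

open Polynomial in
theorem MvPolynomial.evalEval_aeval (p : MvPolynomial (Fin 2) ℝ) (f : Fin 2 → ℂ[X][X]) (z w : ℂ) :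
    (MvPolynomial.aeval f p).evalEval z w =
      MvPolynomial.aeval (fun i => (f i).evalEval z w) p := by
  rw [← Polynomial.coe_evalEvalRingHom, MvPolynomial.aeval_def, MvPolynomial.aeval_def,
    MvPolynomial.eval₂_comp_left]
  congr 1
  ext r
  simp [Polynomial.algebraMap_apply]

theorem MvPolynomial.aeval_ofReal (p : MvPolynomial (Fin 2) ℝ) (x y : ℝ) :
    MvPolynomial.aeval ![(x : ℂ), (y : ℂ)] p = ((MvPolynomial.eval ![x, y] p : ℝ) : ℂ) := by
  have h := MvPolynomial.eval₂_comp_left (algebraMap ℝ ℂ) (RingHom.id ℝ) ![x, y] p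
  have h' : (algebraMap ℝ ℂ) ∘ ![x, y] = ![(x : ℂ), (y : ℂ)] := by
    ext i; fin_cases i <;> rfl
  rw [h', RingHom.comp_id] at h
  rw [MvPolynomial.aeval_def, ← h]
  rfl

theorem MvPolynomial.aeval_conj (p : MvPolynomial (Fin 2) ℝ) (z w : ℂ) :
    MvPolynomial.aeval ![conj z, conj w] p = conj (MvPolynomial.aeval ![z, w] p) := by
  rw [MvPolynomial.aeval_def, MvPolynomial.aeval_def, MvPolynomial.eval₂_comp_left]
  congr 1
  · ext r; simp
  · ext i; fin_cases i <;> rfl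

-- Dividing by the content removes the vertical lines contained in the zero set, so every fibre of
-- `G` is finite.
open Polynomial in
theorem Polynomial.exists_eq_C_mul_map_ne_zero (F : ℂ[X][X]) (hF : F ≠ 0) :
    ∃ (c : ℂ[X]) (G : ℂ[X][X]), c ≠ 0 ∧ F = C c * G ∧ ∀ z, G.map (evalRingHom z) ≠ 0 := by
  let _ : NormalizedGCDMonoid ℂ[X] := Classical.choice inferInstance
  refine ⟨F.content, F.primPart, mt content_eq_zero_iff.1 hF, F.eq_C_content_mul_primPart,
    fun z hz => ?_⟩
  have hdvd : C (X - C z) ∣ F.primPart := by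
    rw [C_dvd_iff_dvd_coeff]
    intro i
    rw [dvd_iff_isRoot]
    have := congrArg (fun q => coeff q i) hz
    simpa using this
  exact (irreducible_X_sub_C z).not_isUnit (F.isPrimitive_primPart _ hdvd)

-- The real polynomial is complexified twice: in the coordinates `(x, y)`, which gives the curve
-- relation `Q` after removal of the content, and in the coordinates `z = x + iy`, `w = x - iy`,
-- which gives the Schwarz equation `P`.
open Polynomial in
theorem HasRealAlgebraicBoundary.exists_isCurveData {Ω : Set ℂ} (h : HasRealAlgebraicBoundary Ω) :
    ∃ (Q : ℂ → ℂ → Prop) (P : ℂ[X][X]) (X : Set ℝ) (B : Set ℂ),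
      IsCurveData Q (fun z w => P.evalEval z w = 0) X B ∧
      (∀ z ∈ frontier Ω, P.evalEval z (conj z) = 0) ∧
      ∀ z ∈ frontier Ω, z.re ∉ X → Q z.re z.im := by
  obtain ⟨p, hp, hpΩ⟩ := h
  let F : ℂ[X][X] := MvPolynomial.aeval ![C X, X] p
  let P : ℂ[X][X] := MvPolynomial.aeval
    ![C (C (1 / 2)) * (C X + X), C (C (1 / (2 * Complex.I))) * (C X - X)] p
  have hF : ∀ z w, F.evalEval z w = MvPolynomial.aeval ![z, w] p := fun z w => by
    rw [MvPolynomial.evalEval_aeval]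
    congr 2
    ext i; fin_cases i <;> simp [evalEval_C]
  have hP : ∀ z w, P.evalEval z w =
      MvPolynomial.aeval ![(z + w) / 2, (z - w) / (2 * Complex.I)] p := fun z w => by
    rw [MvPolynomial.evalEval_aeval]
    congr 2
    ext i; fin_cases i <;> simp [evalEval_C, evalEval_mul, evalEval_add, evalEval_sub] <;>
      field_simp
    rw [Complex.I_sq]; ring
  have hPc : ∀ z, P.evalEval z (conj z) = ((MvPolynomial.eval ![z.re, z.im] p : ℝ) : ℂ) := by
    intro z
    rw [hP, ← MvPolynomial.aeval_ofReal, Complex.re_eq_add_conj, Complex.im_eq_sub_conj]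
  obtain ⟨v, hv⟩ : ∃ v : Fin 2 → ℝ, MvPolynomial.eval v p ≠ 0 := by
    by_contra! hcon
    exact hp (MvPolynomial.funext fun v => by simpa using hcon v)
  have hv' : v = ![v 0, v 1] := by ext i; fin_cases i <;> rfl
  rw [hv'] at hv
  have hF0 : F ≠ 0 := by
    intro h0
    have := hF (v 0) (v 1)
    rw [h0, MvPolynomial.aeval_ofReal, evalEval_zero] at this
    exact hv (by exact_mod_cast this.symm)
  have hP0 : P ≠ 0 := by
    intro h0
    have := hPc (⟨v 0, v 1⟩)
    rw [h0, evalEval_zero] at this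
    exact hv (by exact_mod_cast this.symm)
  obtain ⟨c, G, hc, hFG, hG⟩ := exists_eq_C_mul_map_ne_zero F hF0
  have hG0 : G ≠ 0 := by
    rintro rfl
    simp at hFG
    exact hF0 hFG
  obtain ⟨BG, hBG, hbG⟩ := exists_finite_isLocallyBranched G hG0
  obtain ⟨BP, hBP, hbP⟩ := exists_finite_isLocallyBranched P hP0
  have hFe : ∀ z w, F.evalEval z w = c.eval z * G.evalEval z w := fun z w => by
    rw [hFG, evalEval_mul, evalEval_C]
  have hcz : {z : ℂ | c.eval z = 0}.Finite :=
    (c.roots.toFinset.finite_toSet).subset fun z hz => by simpa [hc] using hz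
  have hFG' : ∀ x : ℝ, x ∉ Complex.re '' (BG ∪ BP ∪ {z : ℂ | c.eval z = 0}) → ∀ w,
      (F.evalEval (x : ℂ) w = 0 ↔ G.evalEval (x : ℂ) w = 0) := fun x hx w => by
    have : c.eval (x : ℂ) ≠ 0 := fun h0 => hx ⟨x, Or.inr h0, by simp⟩
    rw [hFe, mul_eq_zero, or_iff_right this]
  -- `X` also absorbs the zeros of the content `c`; off these abscissas `F` and `G` have the same
  -- roots.
  refine ⟨fun z w => G.evalEval z w = 0, P, Complex.re '' (BG ∪ BP ∪ {z | c.eval z = 0}), BP,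
    ?_, ?_, ?_⟩
  · constructor
    · exact ((hBG.union hBP).union hcz).image _
    · exact hBP
    · exact fun b hb => ⟨b, Or.inl (Or.inr hb), rfl⟩
    · exact fun z hz => hbG z fun h => hz ⟨z, Or.inl (Or.inl h), rfl⟩
    · exact hbP
    · exact isClosed_eq (contDiff_evalEval G (n := 0)).continuous continuous_const
    · intro x
      refine (((G.map (evalRingHom (x : ℂ))).roots.toFinset.finite_toSet).preimage
        (Complex.ofReal_injective.injOn)).subset fun y hy => ?_
      simpa [hG, ← evalEval_eq_eval_map] using hy
    · intro x hx w hw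
      simp only [← hFG' x hx, hF] at hw ⊢
      have := MvPolynomial.aeval_conj p x w
      rw [Complex.conj_ofReal, hw, map_zero] at this
      exact this
    · intro z hz hQ
      simp only [← hFG' z.re hz, hF, MvPolynomial.aeval_ofReal] at hQ
      simp only [hPc, hQ]
  · intro z hz
    rw [hPc, hpΩ z hz, Complex.ofReal_zero]
  · intro z hz hX
    rw [← hFG' z.re hX, hF, MvPolynomial.aeval_ofReal, hpΩ z hz, Complex.ofReal_zero]

/-! ### Singular points of the local Schwarz functions -/

/-- The singular points of the Schwarz functions lie in the exceptional set of the equation they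
satisfy. -/
theorem mem_of_isSingularPointOf {Ω : Set ℂ} {P : Polynomial (Polynomial ℂ)} {B : Set ℂ}
    (hP : ∀ z ∉ B, IsLocallyBranched (fun z w => P.evalEval z w = 0) z)
    (hΩ : ∀ z ∈ frontier Ω, P.evalEval z (conj z) = 0) {a b : ℂ} {S : ℂ → ℂ}
    (hS : IsLocalSchwarzFunction Ω a S) (hb : IsSingularPointOf S a b) : b ∈ B := by
  have han : ∀ {T : ℂ → ℂ} {z : ℂ}, AnalyticAt ℂ T z →
      AnalyticAt ℂ (fun z => P.evalEval z (T z)) z := fun {T z} hT => by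
    have h1 : AnalyticAt ℂ (fun v : ℂ × ℂ => P.evalEval v.1 v.2) (z, T z) :=
      ((Polynomial.contDiff_evalEval P (n := ⊤)).contDiffAt).analyticAt
    exact h1.comp₂ analyticAt_id hT
  obtain ⟨⟨r, φ, hr, hφa, hφi, hφ0, hφ⟩, hSa, hSc⟩ := hS
  -- The analytic function `P(z, S z)` vanishes on a boundary arc accumulating at `a`, hence near
  -- `a`.
  have hroot : ∀ᶠ z in 𝓝 a, P.evalEval z (S z) = 0 := by
    refine (han hSa).frequently_zero_iff_eventually_zero.1 ?_
    have h1 : Tendsto (fun t : ℝ => φ t) (𝓝[≠] 0) (𝓝[≠] a) := by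
      refine tendsto_nhdsWithin_iff.2 ⟨?_, ?_⟩
      · have : ContinuousAt (fun t : ℝ => φ t) 0 := by
          refine ContinuousAt.comp (f := fun t : ℝ => (t : ℂ)) ?_ (by fun_prop)
          exact (hφa _ (by simpa using hr)).continuousAt
        have h2 : Tendsto (fun t : ℝ => φ t) (𝓝 0) (𝓝 a) := by
          simpa [ContinuousAt, hφ0] using this
        exact h2.mono_left nhdsWithin_le_nhds
      · have h3 : ∀ᶠ t : ℝ in 𝓝[≠] 0, (t : ℂ) ∈ Metric.ball (0 : ℂ) r := by
          refine nhdsWithin_le_nhds ?_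
          exact (Complex.continuous_ofReal.continuousAt (x := 0)).eventually
            (Metric.isOpen_ball.mem_nhds (by simpa using hr))
        filter_upwards [h3, self_mem_nhdsWithin] with t ht ht0 h
        have := hφi ht (Metric.mem_ball_self hr) (by rw [hφ0]; exact h)
        exact ht0 (by exact_mod_cast this)
    have h3 : ∀ᶠ t : ℝ in 𝓝[≠] 0, P.evalEval (φ t) (S (φ t)) = 0 := by
      have h4 : ∀ᶠ t : ℝ in 𝓝[≠] 0, (t : ℂ) ∈ Metric.ball (0 : ℂ) r := by
        refine nhdsWithin_le_nhds ?_
        exact (Complex.continuous_ofReal.continuousAt (x := 0)).eventually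
          (Metric.isOpen_ball.mem_nhds (by simpa using hr))
      have h5 := (h1.mono_right nhdsWithin_le_nhds).eventually (eventually_nhdsWithin_iff.1 hSc)
      filter_upwards [h4, h5] with t ht ht5
      have hfr : φ t ∈ frontier Ω := (hφ t ht).2 (by simp)
      rw [ht5 hfr]
      exact hΩ _ hfr
    exact h1.frequently h3.frequently
  obtain ⟨γ, hγ, hγ0, hγ1, ⟨g, hg0, hg⟩, hno⟩ := hb
  by_contra hbB
  -- Permanence of the functional equation under continuation, by the identity theorem on small
  -- discs.
  have hgroot : ∀ t ∈ Set.Ico (0 : ℝ) 1, ∀ᶠ z in 𝓝 (γ t), P.evalEval z (g t z) = 0 := by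
    intro t ht
    refine (isPreconnected_Ico.iff_of_eventually
      (p := fun t => ∀ᶠ z in 𝓝 (γ t), P.evalEval z (g t z) = 0) ?_
      (Set.left_mem_Ico.2 one_pos) ht).1 ?_
    · intro t ht
      obtain ⟨hta, htg⟩ := hg t ht
      have hγt : Tendsto γ (𝓝[Set.Ico 0 1] t) (𝓝 (γ t)) :=
        (hγ t (Set.Ico_subset_Icc_self ht)).mono_left (nhdsWithin_mono _ Set.Ico_subset_Icc_self)
      obtain ⟨ε, hε, hball⟩ := Metric.eventually_nhds_iff_ball.1 hta.eventually_analyticAt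
      have hball' : AnalyticOnNhd ℂ (fun z => P.evalEval z (g t z)) (Metric.ball (γ t) ε) :=
        fun z hz => han (hball z hz)
      filter_upwards [htg, hγt.eventually (Metric.ball_mem_nhds _ hε)] with s hs hsball
      have hiff : (∀ᶠ z in 𝓝 (γ s), P.evalEval z (g s z) = 0) ↔
          ∀ᶠ z in 𝓝 (γ s), P.evalEval z (g t z) = 0 :=
        eventually_congr (hs.mono fun z hz => by rw [hz])
      rw [hiff]
      have hext : ∀ {z : ℂ}, z ∈ Metric.ball (γ t) ε →
          (∀ᶠ y in 𝓝 z, P.evalEval y (g t y) = 0) →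
          Set.EqOn (fun z => P.evalEval z (g t z)) 0 (Metric.ball (γ t) ε) := fun hz h =>
        hball'.eqOn_zero_of_preconnected_of_eventuallyEq_zero
          (convex_ball _ _).isPreconnected hz h
      constructor
      · intro h
        filter_upwards [Metric.ball_mem_nhds (γ t) hε] with z hz
        exact hext hsball h hz
      · intro h
        filter_upwards [Metric.isOpen_ball.mem_nhds hsball] with z hz
        exact hext (Metric.mem_ball_self hε) h hz
    · rw [hγ0] at hg0 ⊢
      filter_upwards [hg0, hroot] with z hz1 hz2
      rw [hz1, hz2]
  obtain ⟨n, s, r', hr', hs, hz⟩ := hP b hbB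
  have hγ1' : Tendsto γ (𝓝[Set.Icc 0 1] 1) (𝓝 b) := by
    rw [← hγ1]
    exact hγ 1 (Set.right_mem_Icc.2 zero_le_one)
  obtain ⟨t₀, ht₀, ht₀1, ht₀γ⟩ : ∃ t₀ : ℝ, 0 ≤ t₀ ∧ t₀ < 1 ∧ ∀ t ∈ Set.Icc t₀ 1,
      γ t ∈ Metric.ball b r' ∧ IsLocallyBranched (fun z w => P.evalEval z w = 0) (γ t) := by
    have h1 := hγ1'.eventually (Filter.Eventually.and (Metric.ball_mem_nhds b hr')
      (hP b hbB).eventually_isLocallyBranched)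
    obtain ⟨δ, hδ, hsub⟩ := Metric.eventually_nhds_iff.1 (eventually_nhdsWithin_iff.1 h1)
    refine ⟨max 0 (1 - δ / 2), le_max_left _ _, max_lt one_pos (by linarith), fun t ht => ?_⟩
    have h2 := (max_le_iff.1 ht.1)
    refine hsub ?_ ⟨h2.1, ht.2⟩
    rw [Real.dist_eq, abs_lt]
    constructor <;> linarith [ht.2, h2.2]
  have hIco : ∀ t ∈ Set.Ico t₀ 1, t ∈ Set.Ico (0 : ℝ) 1 := fun t ht => ⟨ht₀.trans ht.1, ht.2⟩
  have hsR : ∀ k, ∀ t ∈ Set.Ico t₀ 1, ∀ᶠ z in 𝓝 (γ t), P.evalEval z (s k z) = 0 :=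
    fun k t ht => by
    filter_upwards [Metric.isOpen_ball.mem_nhds (ht₀γ t ⟨ht.1, ht.2.le⟩).1] with z hz'
    exact ((hz z hz').2 _).2 ⟨k, rfl⟩
  have hgerm : ∀ t ∈ Set.Ico t₀ 1, ∀ k, s k (γ t) = g t (γ t) → g t =ᶠ[𝓝 (γ t)] s k :=
    fun t ht k hk => (ht₀γ t ⟨ht.1, ht.2.le⟩).2.eventuallyEq (hg t (hIco t ht)).1.continuousAt
      (hs k _ (ht₀γ t ⟨ht.1, ht.2.le⟩).1).continuousAt (hgroot t (hIco t ht)) (hsR k t ht) hk.symm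
  have hex : ∀ t ∈ Set.Ico t₀ 1, ∃ k, s k (γ t) = g t (γ t) := fun t ht =>
    ((hz _ (ht₀γ t ⟨ht.1, ht.2.le⟩).1).2 _).1 (hgroot t (hIco t ht)).self_of_nhds
  obtain ⟨k, hk⟩ := hex t₀ ⟨le_rfl, ht₀1⟩
  -- Close to `b` each germ is one of finitely many branches defined on a full disc about `b`; the
  -- index is locally constant in `t`, so a single branch serves up to the end.
  have hall : ∀ t ∈ Set.Ico t₀ 1, g t =ᶠ[𝓝 (γ t)] s k := by
    intro t ht
    refine hgerm t ht k ?_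
    refine (isPreconnected_Ico.iff_of_eventually (p := fun t => s k (γ t) = g t (γ t)) ?_
      ⟨le_rfl, ht₀1⟩ ht).1 hk
    intro t ht
    obtain ⟨l, hl⟩ := hex t ht
    have hγt : Tendsto γ (𝓝[Set.Ico t₀ 1] t) (𝓝 (γ t)) :=
      (hγ t ⟨ht₀.trans ht.1, ht.2.le⟩).mono_left
        (nhdsWithin_mono _ fun x hx => Set.Ico_subset_Icc_self (hIco x hx))
    have h1 := (hg t (hIco t ht)).2.filter_mono (nhdsWithin_mono t fun x hx => hIco x hx)
    filter_upwards [h1, hγt.eventually (hgerm t ht l hl).eventually_nhds,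
      self_mem_nhdsWithin] with x hx hx2 hxI
    have h3 : g x (γ x) = s l (γ x) := hx.self_of_nhds.trans hx2.self_of_nhds
    rw [h3, ← hl]
    exact ((hz _ (ht₀γ x ⟨hxI.1, hxI.2.le⟩).1).1.eq_iff).trans
      ((hz _ (ht₀γ t ⟨ht.1, ht.2.le⟩).1).1.eq_iff).symm
  -- That branch is analytic at `b` itself, so it supplies the missing final germ and `b` is not
  -- singular.
  refine hno ⟨fun t => if t < 1 then g t else s k, ?_, fun t ht => ?_⟩
  · simpa using hg0
  · rcases ht.2.lt_or_eq with ht1 | rfl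
    · have htI : t ∈ Set.Ico (0 : ℝ) 1 := ⟨ht.1, ht1⟩
      simp only [ht1, if_true]
      refine ⟨(hg t htI).1, ?_⟩
      have h1 : 𝓝[Set.Icc 0 1] t = 𝓝[Set.Ico 0 1] t := by
        rw [← Set.Icc_sdiff_right]
        refine (nhdsWithin_inter_of_mem' ?_).symm
        exact nhdsWithin_le_nhds (isOpen_ne.mem_nhds ht1.ne)
      rw [h1]
      filter_upwards [(hg t htI).2, self_mem_nhdsWithin] with x hx hxI
      simpa [hxI.2] using hx
    · simp only [lt_irrefl, if_false, hγ1]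
      refine ⟨hs k b (Metric.mem_ball_self hr'), ?_⟩
      filter_upwards [self_mem_nhdsWithin, nhdsWithin_le_nhds (Ioi_mem_nhds ht₀1)] with x hx hx0
      split_ifs with hx1
      · exact hall x ⟨le_of_lt hx0, hx1⟩
      · exact EventuallyEq.rfl

/-! ### The skeleton and finite unions of arcs -/

/-- The real points `x + iy` of the relation `Q`. -/
def curveSet (Q : ℂ → ℂ → Prop) : Set ℂ := {z | Q z.re z.im}

/-- The real points of `Q` together with the vertical lines over `X`. -/
def skeleton (Q : ℂ → ℂ → Prop) (X : Set ℝ) : Set ℂ := curveSet Q ∪ {z | z.re ∈ X}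

/-- Finite unions of compact vertical segments and of compact graphs contained in `Z`. -/
inductive IsArcUnion (Z : Set ℂ) : Set ℂ → Prop
  | empty : IsArcUnion Z ∅
  | graph (a b : ℝ) (h : ℝ → ℝ) (hh : ContinuousOn h (Set.Icc a b))
      (hZ : ∀ x ∈ Set.Icc a b, (⟨x, h x⟩ : ℂ) ∈ Z) :
      IsArcUnion Z ((fun x => (⟨x, h x⟩ : ℂ)) '' Set.Icc a b)
  | vertical (x a b : ℝ) : IsArcUnion Z ((fun y => (⟨x, y⟩ : ℂ)) '' Set.Icc a b)
  | union {s t : Set ℂ} (hs : IsArcUnion Z s) (ht : IsArcUnion Z t) : IsArcUnion Z (s ∪ t)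

theorem continuousOn_complex_mk {α : Type*} [TopologicalSpace α] {f g : α → ℝ} {s : Set α}
    (hf : ContinuousOn f s) (hg : ContinuousOn g s) :
    ContinuousOn (fun x => (⟨f x, g x⟩ : ℂ)) s := by
  have : (fun x => (⟨f x, g x⟩ : ℂ)) = fun x => (f x : ℂ) + (g x : ℂ) * Complex.I := by
    ext x
    exact Complex.mk_eq_add_mul_I _ _
  rw [this]
  exact (Complex.continuous_ofReal.comp_continuousOn hf).add
    ((Complex.continuous_ofReal.comp_continuousOn hg).mul continuousOn_const)

theorem exists_curve_range_eq {f : ℝ → ℂ} {a b : ℝ} (hab : a ≤ b)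
    (hf : ContinuousOn f (Set.Icc a b)) :
    ∃ γ : C(unitInterval, ℂ), Set.range γ = f '' Set.Icc a b := by
  have himg : (AffineMap.lineMap a b : ℝ → ℝ) '' Set.Icc 0 1 = Set.Icc a b := by
    rw [← segment_eq_image_lineMap, segment_eq_Icc hab]
  refine ⟨⟨fun t => f (AffineMap.lineMap a b (t : ℝ)), ?_⟩, ?_⟩
  · refine hf.comp_continuous (by fun_prop) fun t => ?_
    rw [← himg]
    exact ⟨t, t.2, rfl⟩
  · change Set.range (fun t : unitInterval => f (AffineMap.lineMap a b (t : ℝ))) = _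
    rw [← himg, Set.image_image]
    ext z
    simp

namespace IsArcUnion

variable {Z : Set ℂ}

theorem exists_curves {E : Set ℂ} (h : IsArcUnion Z E) :
    ∃ (n : ℕ) (γ : Fin n → C(unitInterval, ℂ)), E = ⋃ i, Set.range (γ i) := by
  suffices ∃ (ι : Type) (_ : Finite ι) (γ : ι → C(unitInterval, ℂ)), E = ⋃ i, Set.range (γ i) by
    obtain ⟨ι, _, γ, hγ⟩ := this
    obtain ⟨n, ⟨e⟩⟩ := Finite.exists_equiv_fin ι
    refine ⟨n, fun i => γ (e.symm i), ?_⟩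
    rw [hγ]
    exact (e.symm.iSup_comp (g := fun i => Set.range (γ i))).symm
  have hone : ∀ {f : ℝ → ℂ} {a b : ℝ}, ContinuousOn f (Set.Icc a b) →
      ∃ (ι : Type) (_ : Finite ι) (γ : ι → C(unitInterval, ℂ)),
        f '' Set.Icc a b = ⋃ i, Set.range (γ i) := fun {f a b} hf => by
    rcases le_or_gt a b with hab | hab
    · obtain ⟨γ, hγ⟩ := exists_curve_range_eq hab hf
      exact ⟨Unit, inferInstance, fun _ => γ, hγ.symm.trans (Set.iUnion_const _).symm⟩
    · exact ⟨Empty, inferInstance, fun i => i.elim, by simp [Set.Icc_eq_empty_of_lt hab]⟩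
  induction h with
  | empty => exact ⟨Empty, inferInstance, fun i => i.elim, by simp⟩
  | graph a b h hh _ => exact hone (continuousOn_complex_mk continuousOn_id hh)
  | vertical x a b => exact hone (continuousOn_complex_mk continuousOn_const continuousOn_id)
  | union _ _ ihs iht =>
    obtain ⟨ι, _, γ, rfl⟩ := ihs
    obtain ⟨κ, _, δ, rfl⟩ := iht
    exact ⟨ι ⊕ κ, inferInstance, Sum.elim γ δ, by simp [Set.iUnion_sum]⟩

theorem singleton (z : ℂ) : IsArcUnion Z {z} := by
  have := vertical (Z := Z) z.re z.im z.im
  simpa using this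

theorem biUnion {ι : Type*} {t : Set ι} (ht : t.Finite) {s : ι → Set ℂ}
    (hs : ∀ i ∈ t, IsArcUnion Z (s i)) : IsArcUnion Z (⋃ i ∈ t, s i) := by
  induction t, ht using Set.Finite.induction_on with
  | empty => simpa using empty
  | insert _ _ ih =>
    rw [Set.biUnion_insert]
    exact (hs _ (Set.mem_insert _ _)).union (ih fun i hi => hs i (Set.mem_insert_of_mem _ hi))

theorem of_finite {s : Set ℂ} (hs : s.Finite) : IsArcUnion Z s := by
  have := biUnion hs fun z _ => singleton (Z := Z) z
  simpa using this

/-- An open box whose horizontal sides avoid `Z` can be removed from a finite union of arcs. -/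
theorem sdiff_box {E : Set ℂ} (hE : IsArcUnion Z E) {x₀ y₀ δ ε : ℝ}
    (hZ : ∀ z ∈ Z, |z.re - x₀| < δ → |z.im - y₀| ≠ ε) :
    IsArcUnion Z (E \ {z | |z.re - x₀| < δ ∧ |z.im - y₀| < ε}) := by
  induction hE with
  | empty => simpa using empty
  | union _ _ ihs iht =>
    rw [Set.union_sdiff_distrib]
    exact ihs.union iht
  | vertical x a b =>
    by_cases hx : |x - x₀| < δ
    · have := (vertical (Z := Z) x a (min b (y₀ - ε))).union (vertical x (max a (y₀ + ε)) b)
      convert this using 1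
      ext z
      simp only [Set.mem_sdiff, Set.mem_image, Set.mem_Icc, Set.mem_ofPred_eq, Set.mem_union]
      constructor
      · rintro ⟨⟨y, hy, rfl⟩, hz⟩
        have : ε ≤ |y - y₀| := not_lt.1 fun h => hz ⟨hx, h⟩
        rcases le_abs.1 this with h | h
        · exact Or.inr ⟨y, ⟨max_le hy.1 (by linarith), hy.2⟩, rfl⟩
        · exact Or.inl ⟨y, ⟨hy.1, le_min hy.2 (by linarith)⟩, rfl⟩
      · rintro (⟨y, hy, rfl⟩ | ⟨y, hy, rfl⟩)
        · refine ⟨⟨y, ⟨hy.1, hy.2.trans (min_le_left _ _)⟩, rfl⟩, fun h => ?_⟩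
          have h2 := hy.2.trans (min_le_right _ _)
          linarith [(abs_lt.1 h.2).1]
        · refine ⟨⟨y, ⟨(le_max_left _ _).trans hy.1, hy.2⟩, rfl⟩, fun h => ?_⟩
          have h2 := (le_max_right _ _).trans hy.1
          linarith [(abs_lt.1 h.2).2]
    · have := vertical (Z := Z) x a b
      convert this using 1
      refine sdiff_eq_left.2 (Set.disjoint_left.2 ?_)
      rintro _ ⟨y, -, rfl⟩ h
      exact hx h.1
  | graph a b h hh hgZ =>
    have hJ : IsPreconnected (Set.Icc a b ∩ Set.Ioo (x₀ - δ) (x₀ + δ)) :=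
      (Set.ordConnected_Icc.inter Set.ordConnected_Ioo).isPreconnected
    have hJδ : ∀ x, x ∈ Set.Ioo (x₀ - δ) (x₀ + δ) ↔ |x - x₀| < δ := fun x => by
      rw [abs_lt, Set.mem_Ioo]
      constructor <;> rintro ⟨h1, h2⟩ <;> constructor <;> linarith
    -- Over the window the graph, lying in `Z`, never meets the horizontal sides of the box, so it
    -- is entirely inside or entirely outside. If inside, what remains are the two end pieces of the
    -- graph.
    have hiff : ∀ x ∈ Set.Icc a b ∩ Set.Ioo (x₀ - δ) (x₀ + δ),
        ∀ᶠ x' in 𝓝[Set.Icc a b ∩ Set.Ioo (x₀ - δ) (x₀ + δ)] x,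
          (|h x' - y₀| < ε ↔ |h x - y₀| < ε) := fun x hx => by
      have hc : Tendsto (fun x' => |h x' - y₀|)
          (𝓝[Set.Icc a b ∩ Set.Ioo (x₀ - δ) (x₀ + δ)] x) (𝓝 |h x - y₀|) :=
        (((hh x hx.1).mono Set.inter_subset_left).sub continuousWithinAt_const).abs
      have hne : |h x - y₀| ≠ ε := hZ _ (hgZ x hx.1) ((hJδ x).1 hx.2)
      rcases lt_or_gt_of_ne hne with hlt | hgt
      · filter_upwards [hc.eventually_lt_const hlt] with x' hx'
        exact iff_of_true hx' hlt
      · filter_upwards [hc.eventually_const_lt hgt] with x' hx'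
        exact iff_of_false (not_lt.2 hx'.le) (not_lt.2 hgt.le)
    by_cases hex : ∃ x ∈ Set.Icc a b ∩ Set.Ioo (x₀ - δ) (x₀ + δ), |h x - y₀| < ε
    · obtain ⟨x₁, hx₁, hx₁'⟩ := hex
      have hall : ∀ x ∈ Set.Icc a b ∩ Set.Ioo (x₀ - δ) (x₀ + δ), |h x - y₀| < ε := fun x hx =>
        (hJ.iff_of_eventually (p := fun x => |h x - y₀| < ε) hiff hx₁ hx).1 hx₁'
      have hs1 : Set.Icc a (min b (x₀ - δ)) ⊆ Set.Icc a b :=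
        Set.Icc_subset_Icc le_rfl (min_le_left _ _)
      have hs2 : Set.Icc (max a (x₀ + δ)) b ⊆ Set.Icc a b :=
        Set.Icc_subset_Icc (le_max_left _ _) le_rfl
      have := (graph (Z := Z) a (min b (x₀ - δ)) h (hh.mono hs1) fun x hx => hgZ x (hs1 hx)).union
        (graph (max a (x₀ + δ)) b h (hh.mono hs2) fun x hx => hgZ x (hs2 hx))
      convert this using 1
      ext z
      simp only [Set.mem_sdiff, Set.mem_image, Set.mem_ofPred_eq, Set.mem_union]
      constructor
      · rintro ⟨⟨x, hx, rfl⟩, hz⟩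
        have : δ ≤ |x - x₀| := not_lt.1 fun h => hz ⟨h, hall x ⟨hx, (hJδ x).2 h⟩⟩
        rcases le_abs.1 this with h | h
        · exact Or.inr ⟨x, ⟨max_le hx.1 (by linarith), hx.2⟩, rfl⟩
        · exact Or.inl ⟨x, ⟨hx.1, le_min hx.2 (by linarith)⟩, rfl⟩
      · rintro (⟨x, hx, rfl⟩ | ⟨x, hx, rfl⟩)
        · refine ⟨⟨x, hs1 hx, rfl⟩, fun h => ?_⟩
          have h2 := hx.2.trans (min_le_right _ _)
          linarith [(abs_lt.1 h.1).1]
        · refine ⟨⟨x, hs2 hx, rfl⟩, fun h => ?_⟩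
          have h2 := (le_max_right _ _).trans hx.1
          linarith [(abs_lt.1 h.1).2]
    · have := graph (Z := Z) a b h hh hgZ
      convert this using 1
      refine sdiff_eq_left.2 (Set.disjoint_left.2 ?_)
      rintro _ ⟨x, hx, rfl⟩ hz
      exact hex ⟨x, ⟨hx, (hJδ x).2 hz.1⟩, hz.2⟩

end IsArcUnion

/-! ### Gates: windows through the skeleton -/

/-- A partition of unity gives a continuous selection `g` of the convex fibres; any two points are
joined along their fibres and the graph of `g`. -/
theorem isPreconnected_region {I : Set ℝ} (hI : I.OrdConnected) {Y : ℝ → Set ℝ}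
    (hY : ∀ x ∈ I, Convex ℝ (Y x)) (hloc : ∀ x ∈ I, ∃ c, ∀ᶠ x' in 𝓝[I] x, c ∈ Y x') :
    IsPreconnected {z : ℂ | z.re ∈ I ∧ z.im ∈ Y z.re} := by
  obtain ⟨g, hg⟩ := exists_continuous_forall_mem_convex_of_local_const (X := I)
    (t := fun x => Y x) (fun x => hY x x.2) fun x => by
      obtain ⟨c, hc⟩ := hloc x x.2
      refine ⟨c, ?_⟩
      rw [nhds_subtype_eq_comap_nhdsWithin]
      exact preimage_mem_comap hc
  have : PreconnectedSpace I := Subtype.preconnectedSpace hI.isPreconnected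
  have hmid : IsPreconnected (Set.range fun x : I => (⟨x, g x⟩ : ℂ)) := by
    refine isPreconnected_range ?_
    rw [← continuousOn_univ]
    exact continuousOn_complex_mk (by fun_prop) (by fun_prop)
  have hfib : ∀ x : I, IsPreconnected ((fun y => (⟨x, y⟩ : ℂ)) '' Y x) := fun x =>
    (hY x x.2).isPreconnected.image _ (continuousOn_complex_mk continuousOn_const continuousOn_id)
  refine isPreconnected_of_forall_pair fun z hz w hw => ?_
  refine ⟨(fun y => (⟨z.re, y⟩ : ℂ)) '' Y z.re ∪ (Set.range fun x : I => (⟨x, g x⟩ : ℂ)) ∪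
    (fun y => (⟨w.re, y⟩ : ℂ)) '' Y w.re, ?_, ?_, ?_, ?_⟩
  · rintro _ ((⟨y, hy, rfl⟩ | ⟨x, rfl⟩) | ⟨y, hy, rfl⟩)
    · exact ⟨hz.1, hy⟩
    · exact ⟨x.2, hg x⟩
    · exact ⟨hw.1, hy⟩
  · exact Or.inl (Or.inl ⟨z.im, hz.2, rfl⟩)
  · exact Or.inr ⟨w.im, hw.2, rfl⟩
  · refine IsPreconnected.union (⟨w.re, g ⟨w.re, hw.1⟩⟩ : ℂ) (Or.inr ⟨⟨w.re, hw.1⟩, rfl⟩)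
      ⟨_, hg ⟨w.re, hw.1⟩, rfl⟩ ?_ (hfib ⟨w.re, hw.1⟩)
    exact IsPreconnected.union (⟨z.re, g ⟨z.re, hz.1⟩⟩ : ℂ) ⟨_, hg ⟨z.re, hz.1⟩, rfl⟩
      ⟨⟨z.re, hz.1⟩, rfl⟩ (hfib ⟨z.re, hz.1⟩) hmid

/-- `N` is a convex window which `T` cuts into two sides `N₁` and `N₂`, and whose removal keeps
finite unions of arcs. -/
structure IsGate (Z T N N₁ N₂ : Set ℂ) : Prop where
  isOpen : IsOpen N
  convex : Convex ℝ N
  sdiff_eq : N \ T = N₁ ∪ N₂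
  isPreconnected_left : IsPreconnected N₁
  isPreconnected_right : IsPreconnected N₂
  subset_closure_left : N ∩ T ⊆ closure N₁
  subset_closure_right : N ∩ T ⊆ closure N₂
  isArcUnion_sdiff : ∀ E, IsArcUnion Z E → IsArcUnion Z (E \ N)

theorem IsGate.symm {Z T N N₁ N₂ : Set ℂ} (h : IsGate Z T N N₁ N₂) : IsGate Z T N N₂ N₁ :=
  ⟨h.isOpen, h.convex, h.sdiff_eq.trans (Set.union_comm _ _), h.isPreconnected_right,
    h.isPreconnected_left, h.subset_closure_right, h.subset_closure_left, h.isArcUnion_sdiff⟩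

theorem isOpen_box (x₀ y₀ δ ε : ℝ) : IsOpen {z : ℂ | |z.re - x₀| < δ ∧ |z.im - y₀| < ε} :=
  (isOpen_lt (by fun_prop : Continuous fun z : ℂ => |z.re - x₀|) continuous_const).and
    (isOpen_lt (by fun_prop : Continuous fun z : ℂ => |z.im - y₀|) continuous_const)

theorem abs_sub_lt_iff_mem_Ioo {x x₀ δ : ℝ} : |x - x₀| < δ ↔ x ∈ Set.Ioo (x₀ - δ) (x₀ + δ) := by
  rw [abs_lt, Set.mem_Ioo]
  constructor <;> rintro ⟨h1, h2⟩ <;> constructor <;> linarith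

theorem convex_box (x₀ y₀ δ ε : ℝ) : Convex ℝ {z : ℂ | |z.re - x₀| < δ ∧ |z.im - y₀| < ε} := by
  simp only [abs_sub_lt_iff_mem_Ioo]
  exact ((convex_Ioo _ _).is_linear_preimage Complex.reLm.isLinear).inter
    ((convex_Ioo _ _).is_linear_preimage Complex.imLm.isLinear)

theorem exists_box_subset {q : ℂ} {V : Set ℂ} (hV : V ∈ 𝓝 q) :
    ∃ ε > 0, ∀ z : ℂ, |z.re - q.re| ≤ ε → |z.im - q.im| ≤ ε → z ∈ V := by
  obtain ⟨r, hr, hsub⟩ := Metric.mem_nhds_iff.1 hV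
  refine ⟨r / 3, by positivity, fun z h1 h2 => hsub ?_⟩
  rw [Metric.mem_ball, dist_eq_norm]
  calc ‖z - q‖ ≤ |(z - q).re| + |(z - q).im| := Complex.norm_le_abs_re_add_abs_im _
    _ ≤ r / 3 + r / 3 := add_le_add (by simpa using h1) (by simpa using h2)
    _ < r := by linarith

theorem mem_closure_of_forall_eps {z v : ℂ} {s : Set ℂ}
    (h : ∀ᶠ t : ℝ in 𝓝[>] 0, z + (t : ℂ) * v ∈ s) : z ∈ closure s := by
  have h1 : Tendsto (fun t : ℝ => z + (t : ℂ) * v) (𝓝[>] 0) (𝓝 z) := by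
    have : ContinuousAt (fun t : ℝ => z + (t : ℂ) * v) 0 := by fun_prop
    have h2 := this.tendsto
    simp only [Complex.ofReal_zero, zero_mul, add_zero] at h2
    exact h2.mono_left nhdsWithin_le_nhds
  exact mem_closure_of_tendsto h1 h

namespace IsCurveData

variable {Q P : ℂ → ℂ → Prop} {X : Set ℝ} {B : Set ℂ}

theorem isClosed_curveSet (D : IsCurveData Q P X B) : IsClosed (curveSet Q) :=
  D.isClosed_Q.preimage (f := fun z : ℂ => ((z.re : ℂ), (z.im : ℂ))) (by fun_prop)

theorem isClosed_skeleton (D : IsCurveData Q P X B) : IsClosed (skeleton Q X) :=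
  D.isClosed_curveSet.union (D.finite_X.isClosed.preimage Complex.continuous_re)

/-- Near a point off the exceptional vertical lines, the curve is an analytic graph. -/
theorem exists_graph_box (D : IsCurveData Q P X B) {q : ℂ} (hq : q ∈ curveSet Q) (hqX : q.re ∉ X)
    {V : Set ℂ} (hV : V ∈ 𝓝 q) :
    ∃ (δ ε : ℝ) (ψ : ℂ → ℂ), 0 < δ ∧ 0 < ε ∧ AnalyticOnNhd ℂ ψ (Metric.ball (q.re : ℂ) δ) ∧
      {z : ℂ | |z.re - q.re| < δ ∧ |z.im - q.im| < ε} ⊆ V ∧ ψ q.re = q.im ∧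
      ∀ x : ℝ, |x - q.re| < δ → x ∉ X ∧ (ψ x).im = 0 ∧ |(ψ x).re - q.im| < ε ∧
        ∀ y : ℝ, |y - q.im| ≤ ε → (Q x y ↔ y = (ψ x).re) := by
  obtain ⟨ψ, hψa, hψ0, hψR, hψu⟩ := (D.branched_Q q.re (by simpa using hqX)).exists_branch hq
  obtain ⟨ε₁, hε₁, hbox⟩ := exists_box_subset hV
  rw [nhds_prod_eq] at hψu
  obtain ⟨pa, hpa, pb, hpb, hab⟩ := eventually_prod_iff.1 hψu
  obtain ⟨ε₂, hε₂, hpb'⟩ := Metric.eventually_nhds_iff_ball.1 hpb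
  -- Halving `ε₂` makes uniqueness of the branch valid up to `|y - q.im| = ε`, so that the
  -- horizontal sides of the box can be shown to miss the curve.
  set ε := min ε₁ (ε₂ / 2) with hε
  have hε0 : 0 < ε := lt_min hε₁ (by linarith)
  have hεε₂ : ε < ε₂ := (min_le_right _ _).trans_lt (by linarith)
  have hnear : ∀ᶠ z in 𝓝 (q.re : ℂ), pa z ∧ Q z (ψ z) ∧ AnalyticAt ℂ ψ z ∧
      ψ z ∈ Metric.ball (q.im : ℂ) ε ∧ z.re ∉ X := by
    have h1 : ∀ᶠ z in 𝓝 (q.re : ℂ), ψ z ∈ Metric.ball (q.im : ℂ) ε :=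
      hψa.continuousAt.eventually (by rw [hψ0]; exact Metric.ball_mem_nhds _ hε0)
    have h2 : ∀ᶠ z in 𝓝 (q.re : ℂ), z.re ∉ X :=
      Complex.continuous_re.continuousAt.eventually
        (D.finite_X.isClosed.isOpen_compl.mem_nhds (by simpa using hqX))
    filter_upwards [hpa, hψR, hψa.eventually_analyticAt, h1, h2] with z a b c d e
    exact ⟨a, b, c, d, e⟩
  obtain ⟨δ₁, hδ₁, hball⟩ := Metric.eventually_nhds_iff_ball.1 hnear
  set δ := min δ₁ ε₁
  have hδ0 : 0 < δ := lt_min hδ₁ hε₁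
  have hsub : Metric.ball (q.re : ℂ) δ ⊆ Metric.ball (q.re : ℂ) δ₁ :=
    Metric.ball_subset_ball (min_le_left _ _)
  refine ⟨δ, ε, ψ, hδ0, hε0, fun z hz => (hball z (hsub hz)).2.2.1, fun z hz => ?_, hψ0,
    fun x hx => ?_⟩
  · exact hbox z (hz.1.le.trans (min_le_right _ _)) (hz.2.le.trans (min_le_left _ _))
  · have hxb : (x : ℂ) ∈ Metric.ball (q.re : ℂ) δ := by
      rw [Metric.mem_ball, Complex.dist_eq, ← Complex.ofReal_sub, Complex.norm_real]
      exact hx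
    obtain ⟨h1, h2, -, h4, h5⟩ := hball x (hsub hxb)
    have hX : x ∉ X := by simpa using h5
    -- The conjugate is again a root over `x`, close to `q.im`; uniqueness of the branch forces the
    -- two to coincide.
    have hreal : conj (ψ x) = ψ x := by
      refine hab h1 (hpb' _ ?_) (D.conj_Q x hX _ h2)
      rw [Metric.mem_ball, Complex.dist_eq] at h4 ⊢
      rw [← Complex.conj_ofReal q.im, ← map_sub, Complex.norm_conj]
      exact h4.trans hεε₂
    have him : (ψ x).im = 0 := Complex.conj_eq_iff_im.1 hreal
    have hψx : ψ x = ((ψ x).re : ℂ) := Complex.ext rfl (by simpa using him)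
    refine ⟨hX, him, ?_, fun y hy => ⟨fun hQ => ?_, ?_⟩⟩
    · rw [Metric.mem_ball, Complex.dist_eq, hψx, ← Complex.ofReal_sub, Complex.norm_real] at h4
      exact h4
    · have := hab h1 (hpb' y ?_) hQ
      · rw [← show ((y : ℂ)).re = y from rfl, show (y : ℂ) = ψ x from this]
      · rw [Metric.mem_ball, Complex.dist_eq, ← Complex.ofReal_sub, Complex.norm_real]
        exact hy.trans_lt hεε₂
    · rintro rfl
      rw [← hψx]
      exact h2

/-- The box of `exists_graph_box` is split into the parts above and below the graph. The graph stays
strictly between the horizontal sides, which is the condition of `IsArcUnion.sdiff_box`. -/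
theorem exists_gate_of_graph (D : IsCurveData Q P X B) {q : ℂ} (hq : q ∈ curveSet Q)
    (hqX : q.re ∉ X) {V : Set ℂ} (hV : V ∈ 𝓝 q) :
    ∃ N N₁ N₂, q ∈ N ∧ N ⊆ V ∧ IsGate (curveSet Q) (skeleton Q X) N N₁ N₂ := by
  obtain ⟨δ, ε, ψ, hδ, hε, hψ, hsub, hψ0, hx⟩ := D.exists_graph_box hq hqX hV
  set h : ℝ → ℝ := fun x => (ψ x).re with hh
  have hc : ∀ x, |x - q.re| < δ → ContinuousAt h x := fun x hx => by
    have : ContinuousAt ψ x := (hψ x (by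
      rw [Metric.mem_ball, Complex.dist_eq, ← Complex.ofReal_sub, Complex.norm_real]
      exact hx)).continuousAt
    exact Complex.continuous_re.continuousAt.comp
      (ContinuousAt.comp (f := fun x : ℝ => (x : ℂ)) this (by fun_prop))
  have hsk : ∀ z : ℂ, |z.re - q.re| < δ → |z.im - q.im| < ε →
      (z ∈ skeleton Q X ↔ z.im = h z.re) := fun z h1 h2 => by
    constructor
    · rintro (hz | hz)
      · exact ((hx _ h1).2.2.2 _ h2.le).1 hz
      · exact absurd hz (hx _ h1).1
    · intro hz
      exact Or.inl (((hx _ h1).2.2.2 _ h2.le).2 hz)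
  have hI : (Set.Ioo (q.re - δ) (q.re + δ)).OrdConnected := Set.ordConnected_Ioo
  refine ⟨{z | |z.re - q.re| < δ ∧ |z.im - q.im| < ε},
    {z | z.re ∈ Set.Ioo (q.re - δ) (q.re + δ) ∧ z.im ∈ Set.Ioo (h z.re) (q.im + ε)},
    {z | z.re ∈ Set.Ioo (q.re - δ) (q.re + δ) ∧ z.im ∈ Set.Ioo (q.im - ε) (h z.re)},
    by simp [hδ, hε], hsub, ?_⟩
  refine ⟨isOpen_box _ _ _ _, convex_box _ _ _ _, ?_, ?_, ?_, ?_, ?_, ?_⟩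
  · ext z
    constructor
    · rintro ⟨⟨h1, h2⟩, h3⟩
      rw [hsk z h1 h2] at h3
      rcases lt_or_gt_of_ne h3 with h4 | h4
      · exact Or.inr ⟨abs_sub_lt_iff_mem_Ioo.1 h1, (abs_sub_lt_iff_mem_Ioo.1 h2).1, h4⟩
      · exact Or.inl ⟨abs_sub_lt_iff_mem_Ioo.1 h1, h4, (abs_sub_lt_iff_mem_Ioo.1 h2).2⟩
    · rintro (⟨h1, h2⟩ | ⟨h1, h2⟩)
      · have h1' := abs_sub_lt_iff_mem_Ioo.2 h1
        have h3 := abs_lt.1 (hx _ h1').2.2.1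
        have h4 : |z.im - q.im| < ε :=
          abs_sub_lt_iff_mem_Ioo.2 ⟨by linarith [h2.1], h2.2⟩
        exact ⟨⟨h1', h4⟩, fun h5 => h2.1.ne' ((hsk z h1' h4).1 h5)⟩
      · have h1' := abs_sub_lt_iff_mem_Ioo.2 h1
        have h3 := abs_lt.1 (hx _ h1').2.2.1
        have h4 : |z.im - q.im| < ε :=
          abs_sub_lt_iff_mem_Ioo.2 ⟨h2.1, by linarith [h2.2]⟩
        exact ⟨⟨h1', h4⟩, fun h5 => h2.2.ne ((hsk z h1' h4).1 h5)⟩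
  · refine isPreconnected_region hI (fun x _ => convex_Ioo _ _) fun x hxI => ?_
    have hx' := abs_sub_lt_iff_mem_Ioo.2 hxI
    have h3 := abs_lt.1 (hx _ hx').2.2.1
    obtain ⟨c, hc1, hc2⟩ := exists_between (show h x < q.im + ε by linarith [h3.2])
    refine ⟨c, nhdsWithin_le_nhds ?_⟩
    filter_upwards [(hc x hx').eventually_lt_const hc1] with x' hx'' using ⟨hx'', hc2⟩
  · refine isPreconnected_region hI (fun x _ => convex_Ioo _ _) fun x hxI => ?_
    have hx' := abs_sub_lt_iff_mem_Ioo.2 hxI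
    have h3 := abs_lt.1 (hx _ hx').2.2.1
    obtain ⟨c, hc1, hc2⟩ := exists_between (show q.im - ε < h x by linarith [h3.1])
    refine ⟨c, nhdsWithin_le_nhds ?_⟩
    filter_upwards [(hc x hx').eventually_const_lt hc2] with x' hx'' using ⟨hc1, hx''⟩
  · rintro z ⟨⟨h1, h2⟩, h3⟩
    rw [hsk z h1 h2] at h3
    refine mem_closure_of_forall_eps (v := Complex.I) ?_
    have h4 := abs_sub_lt_iff_mem_Ioo.1 h2
    have h5 : 0 < q.im + ε - z.im := by linarith [h4.2]
    filter_upwards [Ioo_mem_nhdsGT h5] with t ht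
    simp only [Complex.add_re, Complex.mul_re, Complex.ofReal_re, Complex.I_re,
      Complex.ofReal_im, Complex.I_im, Complex.add_im, Complex.mul_im, mul_zero, mul_one,
      sub_zero, add_zero]
    exact ⟨abs_sub_lt_iff_mem_Ioo.1 h1, by linarith [ht.1], by linarith [ht.2]⟩
  · rintro z ⟨⟨h1, h2⟩, h3⟩
    rw [hsk z h1 h2] at h3
    refine mem_closure_of_forall_eps (v := -Complex.I) ?_
    have h4 := abs_sub_lt_iff_mem_Ioo.1 h2
    have h5 : 0 < z.im - (q.im - ε) := by linarith [h4.1]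
    filter_upwards [Ioo_mem_nhdsGT h5] with t ht
    simp only [Complex.add_re, Complex.mul_re, Complex.ofReal_re, Complex.I_re,
      Complex.ofReal_im, Complex.I_im, Complex.add_im, Complex.mul_im, mul_zero, mul_one,
      sub_zero, add_zero, Complex.neg_re, Complex.neg_im, neg_zero, mul_neg]
    exact ⟨abs_sub_lt_iff_mem_Ioo.1 h1, by linarith [ht.2], by linarith [ht.1]⟩
  · intro E hE
    refine hE.sdiff_box fun z hz h1 h2 => ?_
    have h3 := ((hx _ h1).2.2.2 _ h2.le).1 hz
    have h4 := (hx _ h1).2.2.1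
    rw [← h3, h2] at h4
    exact lt_irrefl _ h4

/-- A small box misses the curve and the other vertical lines, so the line splits it into a left and
a right half. -/
theorem exists_gate_of_vertical (D : IsCurveData Q P X B) {q : ℂ} (hq : q ∉ curveSet Q)
    (hqX : q.re ∈ X) {V : Set ℂ} (hV : V ∈ 𝓝 q) :
    ∃ N N₁ N₂, q ∈ N ∧ N ⊆ V ∧ IsGate (curveSet Q) (skeleton Q X) N N₁ N₂ := by
  have h1 : (curveSet Q)ᶜ ∈ 𝓝 q := D.isClosed_curveSet.isOpen_compl.mem_nhds hq
  have h2 : {z : ℂ | z.re ∉ X \ {q.re}} ∈ 𝓝 q :=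
    Complex.continuous_re.continuousAt.eventually
      ((D.finite_X.subset Set.sdiff_subset).isClosed.isOpen_compl.mem_nhds (by simp))
  obtain ⟨ε, hε, hbox⟩ := exists_box_subset (inter_mem hV (inter_mem h1 h2))
  have hsk : ∀ z : ℂ, |z.re - q.re| < ε → |z.im - q.im| < ε →
      (z ∈ skeleton Q X ↔ z.re = q.re) := fun z h1 h2 => by
    obtain ⟨-, h3, h4⟩ := hbox z h1.le h2.le
    constructor
    · rintro (hz | hz)
      · exact absurd hz h3
      · by_contra hne
        exact h4 ⟨hz, hne⟩
    · intro hz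
      exact Or.inr (show z.re ∈ X from hz ▸ hqX)
  have hconv := convex_box q.re q.im ε ε
  refine ⟨{z | |z.re - q.re| < ε ∧ |z.im - q.im| < ε},
    {z | |z.re - q.re| < ε ∧ |z.im - q.im| < ε} ∩ {z | z.re < q.re},
    {z | |z.re - q.re| < ε ∧ |z.im - q.im| < ε} ∩ {z | q.re < z.re},
    by simp [hε], fun z hz => (hbox z hz.1.le hz.2.le).1, ?_⟩
  refine ⟨isOpen_box _ _ _ _, hconv, ?_, ?_, ?_, ?_, ?_, ?_⟩
  · ext z
    constructor
    · rintro ⟨hz, h3⟩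
      rw [hsk z hz.1 hz.2] at h3
      rcases lt_or_gt_of_ne h3 with h4 | h4
      · exact Or.inl ⟨hz, h4⟩
      · exact Or.inr ⟨hz, h4⟩
    · rintro (⟨hz, h3⟩ | ⟨hz, h3⟩)
      · exact ⟨hz, fun h4 => (ne_of_lt h3) ((hsk z hz.1 hz.2).1 h4)⟩
      · exact ⟨hz, fun h4 => (ne_of_gt h3) ((hsk z hz.1 hz.2).1 h4)⟩
  · exact (hconv.inter ((convex_Iio _).is_linear_preimage Complex.reLm.isLinear)).isPreconnected
  · exact (hconv.inter ((convex_Ioi _).is_linear_preimage Complex.reLm.isLinear)).isPreconnected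
  · rintro z ⟨hz, h3⟩
    rw [hsk z hz.1 hz.2] at h3
    refine mem_closure_of_forall_eps (v := -1) ?_
    filter_upwards [Ioo_mem_nhdsGT hε] with t ht
    simp only [Set.mem_inter_iff, Set.mem_ofPred_eq, mul_neg, mul_one, Complex.add_re,
      Complex.neg_re, Complex.ofReal_re, Complex.add_im, Complex.neg_im, Complex.ofReal_im,
      neg_zero, add_zero, h3]
    refine ⟨⟨?_, hz.2⟩, by linarith [ht.1]⟩
    rw [abs_lt]
    constructor <;> linarith [ht.1, ht.2]
  · rintro z ⟨hz, h3⟩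
    rw [hsk z hz.1 hz.2] at h3
    refine mem_closure_of_forall_eps (v := 1) ?_
    filter_upwards [Ioo_mem_nhdsGT hε] with t ht
    simp only [Set.mem_inter_iff, Set.mem_ofPred_eq, mul_one, Complex.add_re,
      Complex.ofReal_re, Complex.add_im, Complex.ofReal_im, add_zero, h3]
    refine ⟨⟨?_, hz.2⟩, by linarith [ht.1]⟩
    rw [abs_lt]
    constructor <;> linarith [ht.1, ht.2]
  · intro E hE
    refine hE.sdiff_box fun z hz h1 h2 => ?_
    exact (hbox z h1.le h2.le).2.1 hz

theorem exists_gate (D : IsCurveData Q P X B) {q : ℂ} (hq : q ∈ skeleton Q X)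
    (hq' : ¬ (q ∈ curveSet Q ∧ q.re ∈ X)) {V : Set ℂ} (hV : V ∈ 𝓝 q) :
    ∃ N N₁ N₂, q ∈ N ∧ N ⊆ V ∧ IsGate (curveSet Q) (skeleton Q X) N N₁ N₂ := by
  rcases hq with hq | hq
  · exact D.exists_gate_of_graph hq (fun h => hq' ⟨hq, h⟩) hV
  · exact D.exists_gate_of_vertical (fun h => hq' ⟨h, hq⟩) hq hV

end IsCurveData

/-! ### Decomposition into arcs and cells -/

/-- Subdividing at the finitely many points of `F`; it reduces statements about strips to strips
free of exceptional abscissas. -/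
theorem Set.Finite.interval_induction {F : Set ℝ} (hF : F.Finite) {p : ℝ → ℝ → Prop}
    (base : ∀ a b, a < b → (∀ x ∈ Set.Ioo a b, x ∉ F) → p a b)
    (glue : ∀ a c b, a < c → c < b → c ∈ F → p a c → p c b → p a b) {a b : ℝ} (hab : a < b) :
    p a b := by
  suffices ∀ F' : Set ℝ, F'.Finite → ∀ a b, a < b → Set.Ioo a b ∩ F ⊆ F' → p a b from
    this F hF a b hab Set.inter_subset_right
  intro F' hF'
  induction F', hF' using Set.Finite.induction_on with
  | empty =>
    intro a b hab h
    exact base a b hab fun x hx hxF => h ⟨hx, hxF⟩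
  | @insert f s _ _ ih =>
    intro a b hab h
    by_cases hf : f ∈ Set.Ioo a b ∩ F
    · refine glue a f b hf.1.1 hf.1.2 hf.2 (ih _ _ hf.1.1 ?_) (ih _ _ hf.1.2 ?_)
      · rintro x ⟨hx, hxF⟩
        refine (h ⟨⟨hx.1, hx.2.trans hf.1.2⟩, hxF⟩).resolve_left hx.2.ne
      · rintro x ⟨hx, hxF⟩
        refine (h ⟨⟨hf.1.1.trans hx.1, hx.2⟩, hxF⟩).resolve_left hx.1.ne'
    · refine ih a b hab fun x hx => (h hx).resolve_left ?_
      rintro rfl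
      exact hf hx

theorem IsPreconnected.subset_or_subset_compl_closure {α : Type*} [TopologicalSpace α]
    {s Ω : Set α} (hs : IsPreconnected s) (hΩ : IsOpen Ω) (h : Disjoint s (frontier Ω)) :
    s ⊆ Ω ∨ s ⊆ (closure Ω)ᶜ := by
  refine hs.subset_or_subset hΩ isClosed_closure.isOpen_compl
    (Set.disjoint_left.2 fun x hx hx' => hx' (subset_closure hx)) fun x hx => ?_
  by_cases hxc : x ∈ closure Ω
  · left
    by_contra hxΩ
    exact Set.disjoint_left.1 h hx ⟨hxc, by rwa [hΩ.interior_eq]⟩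
  · exact Or.inr hxc

/-- A continuous bounded function with finitely many frequent values converges. -/
theorem exists_tendsto_of_finite_frequently {l : Filter ℝ} {h : ℝ → ℝ}
    (hl : ∀ s ∈ l, ∃ t ∈ l, t ⊆ s ∧ IsPreconnected t ∧ ContinuousOn h t) {r : ℝ}
    (hr : ∀ᶠ x in l, |h x| ≤ r) {F : Set ℝ} (hF : F.Finite)
    (hfreq : ∀ e, (∃ᶠ x in l, h x = e) → e ∈ F) : ∃ c, Tendsto h l (𝓝 c) := by
  refine tendsto_of_no_upcrossings dense_univ ?_ ?_ ?_
  -- Oscillation across `(c, d)` would make each of these infinitely many values frequent, by the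
  -- intermediate value theorem.
  · rintro c - d - hcd ⟨h1, h2⟩
    refine (Set.Ioo_infinite hcd) (hF.subset fun e he => hfreq e ?_)
    rw [Filter.frequently_iff]
    intro s hs
    obtain ⟨t, ht, hts, htc, hth⟩ := hl s hs
    obtain ⟨x₁, hx₁, hx₁'⟩ := Filter.frequently_iff.1 h1 ht
    obtain ⟨x₂, hx₂, hx₂'⟩ := Filter.frequently_iff.1 h2 ht
    obtain ⟨x, hx, hxe⟩ := htc.intermediate_value hx₁ hx₂ hth
      ⟨(hx₁'.trans he.1).le, (he.2.trans hx₂').le⟩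
    exact ⟨x, hts hx, hxe⟩
  · exact ⟨r, eventually_map.2 (hr.mono fun x hx => (abs_le.1 hx).2)⟩
  · exact ⟨-r, eventually_map.2 (hr.mono fun x hx => (abs_le.1 hx).1)⟩

/-- Between consecutive frontier points `K` contains the whole interval or none of it. -/
theorem IsArcUnion.vertical_of_frontier_finite {Z : Set ℂ} {K : Set ℝ} (hK : IsClosed K)
    (hfin : (frontier K).Finite) (x : ℝ) {a b : ℝ} (hab : a < b) :
    IsArcUnion Z ((fun y => (⟨x, y⟩ : ℂ)) '' (K ∩ Set.Icc a b)) := by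
  refine hfin.interval_induction
    (p := fun a b => IsArcUnion Z ((fun y => (⟨x, y⟩ : ℂ)) '' (K ∩ Set.Icc a b))) ?_ ?_ hab
  · intro a b hab h
    have h1 : Set.Ioo a b ⊆ K ∨ Set.Ioo a b ⊆ Kᶜ := by
      rcases isPreconnected_Ioo.subset_or_subset_compl_closure (isOpen_interior (s := K))
        (s := Set.Ioo a b) (Set.disjoint_left.2 fun y hy hy' =>
          h y hy (frontier_interior_subset hy')) with h1 | h1
      · exact Or.inl (h1.trans interior_subset)
      · refine Or.inr fun y hy hyK => h1 hy ?_
        by_contra hcon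
        refine h y hy ⟨subset_closure hyK, fun hyi => hcon (subset_closure hyi)⟩
    rcases h1 with h1 | h1
    · have h2 : Set.Icc a b ⊆ K := by
        rw [← closure_Ioo hab.ne]
        exact hK.closure_subset_iff.2 h1
      rw [Set.inter_eq_right.2 h2]
      exact vertical x a b
    · refine of_finite (Set.Finite.image _ ((Set.toFinite {a, b}).subset ?_))
      rintro y ⟨hyK, hy⟩
      by_contra hne
      simp only [Set.mem_insert_iff, Set.mem_singleton_iff, not_or] at hne
      exact h1 ⟨lt_of_le_of_ne hy.1 (Ne.symm hne.1), lt_of_le_of_ne hy.2 hne.2⟩ hyK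
  · intro a c b hac hcb _ h1 h2
    rw [← Set.Icc_union_Icc_eq_Icc hac.le hcb.le, Set.inter_union_distrib_left, Set.image_union]
    exact h1.union h2

namespace IsCurveData

variable {Q P : ℂ → ℂ → Prop} {X : Set ℝ} {B : Set ℂ}

theorem exists_mem_notMem_skeleton (D : IsCurveData Q P X B) {U : Set ℂ} (hU : IsOpen U)
    (hne : U.Nonempty) : ∃ z ∈ U, z ∉ skeleton Q X := by
  obtain ⟨q, hq⟩ := hne
  obtain ⟨ε, hε, hbox⟩ := exists_box_subset (hU.mem_nhds hq)
  obtain ⟨x, hx, hxX⟩ := ((Set.Icc_infinite (show q.re - ε < q.re + ε by linarith)).sdiff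
    D.finite_X).nonempty
  obtain ⟨y, hy, hyQ⟩ := ((Set.Icc_infinite (show q.im - ε < q.im + ε by linarith)).sdiff
    (D.finite_Q x)).nonempty
  refine ⟨⟨x, y⟩, hbox _ ?_ ?_, ?_⟩
  · exact abs_le.2 ⟨by linarith [hx.1], by linarith [hx.2]⟩
  · exact abs_le.2 ⟨by linarith [hy.1], by linarith [hy.2]⟩
  · rintro (h | h)
    · exact hyQ h
    · exact hxX h

theorem finite_fiber (D : IsCurveData Q P X B) (x : ℝ) :
    {z : ℂ | z ∈ curveSet Q ∧ z.re = x}.Finite := by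
  refine ((D.finite_Q x).image fun y => (⟨x, y⟩ : ℂ)).subset ?_
  rintro z ⟨hz, rfl⟩
  exact ⟨z.im, hz, rfl⟩

/-- One side of the gate meets `Ω`; being connected and disjoint from `∂Ω` it lies in `Ω`, and the
whole wall is in its closure. Consequently membership in `closure Ω` is locally constant along the
skeleton, away from the points of the curve on the exceptional lines. -/
theorem inter_skeleton_subset_closure (D : IsCurveData Q P X B) {Ω N N₁ N₂ : Set ℂ}
    (hΩ : IsOpen Ω) (hfr : frontier Ω ⊆ skeleton Q X)
    (hN : IsGate (curveSet Q) (skeleton Q X) N N₁ N₂) (hne : (N ∩ closure Ω).Nonempty) :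
    N ∩ skeleton Q X ⊆ closure Ω := by
  obtain ⟨q, hqN, hqΩ⟩ := hne
  have hne' : (N ∩ Ω).Nonempty := mem_closure_iff.1 hqΩ N hN.isOpen hqN
  obtain ⟨z, hz, hzT⟩ := D.exists_mem_notMem_skeleton (hN.isOpen.inter hΩ) hne'
  have key : ∀ {M : Set ℂ}, IsPreconnected M → M ⊆ N \ skeleton Q X → z ∈ M → M ⊆ Ω :=
    fun {M} hM hMN hzM => by
    refine (hM.subset_or_subset_compl_closure hΩ (Set.disjoint_left.2 fun w hw hw' =>
      (hMN hw).2 (hfr hw'))).resolve_right fun h => h hzM (subset_closure hz.2)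
  have hsub := hN.sdiff_eq
  rcases (hsub ▸ ⟨hz.1, hzT⟩ : z ∈ N₁ ∪ N₂) with h | h
  · exact hN.subset_closure_left.trans
      (closure_mono (key hN.isPreconnected_left (hsub ▸ Set.subset_union_left) h))
  · exact hN.subset_closure_right.trans
      (closure_mono (key hN.isPreconnected_right (hsub ▸ Set.subset_union_right) h))

/-- Over an interval free of exceptional abscissas the curve consists of finitely many disjoint
continuous graphs. -/
theorem exists_graphs (D : IsCurveData Q P X B) {a b : ℝ} (hX : ∀ x ∈ Set.Ioo a b, x ∉ X) :
    ∃ (n : ℕ) (h : Fin n → ℝ → ℝ), (∀ k, ContinuousOn (h k) (Set.Ioo a b)) ∧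
      ∀ x ∈ Set.Ioo a b, Function.Injective (fun k => h k x) ∧
        ∀ y : ℝ, Q x y ↔ ∃ k, h k x = y := by
  rcases (Set.Ioo a b).eq_empty_or_nonempty with he | ⟨x₀, hx₀⟩
  · exact ⟨0, fun k => k.elim0, fun k => k.elim0, by simp [he]⟩
  set U : Set ℂ := {z | z.re ∈ Set.Ioo a b}
  have hU : IsOpen U := isOpen_Ioo.preimage Complex.continuous_re
  have hUc : Convex ℝ U := (convex_Ioo a b).is_linear_preimage Complex.reLm.isLinear
  have hUb : ∀ z ∈ U, IsLocallyBranched Q z := fun z hz => D.branched_Q z (hX _ hz)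
  set T : Set ℂ := (fun x : ℝ => (x : ℂ)) '' Set.Ioo a b
  have hT : IsPreconnected T := isPreconnected_Ioo.image _ Complex.continuous_ofReal.continuousOn
  have hTU : T ⊆ U := by
    rintro _ ⟨x, hx, rfl⟩
    exact hx
  have hreal : ∀ s : ℂ → ℂ, AnalyticOnNhd ℂ s U → (∀ z ∈ U, Q z (s z)) →
      ∀ x₁ ∈ Set.Ioo a b, (s x₁).im = 0 → ∀ x ∈ Set.Ioo a b, s x = ((s x).re : ℂ) := by
    intro s hs hsQ x₁ hx₁ h1 x hx
    have hsT : ContinuousOn s T := hs.continuousOn.mono hTU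
    have heq := IsLocallyBranched.eqOn_of_isPreconnected hT (fun z hz => hUb z (hTU hz))
      (Complex.continuous_conj.comp_continuousOn hsT) hsT (by
        rintro _ ⟨y, hy, rfl⟩
        exact D.conj_Q y (hX y hy) _ (hsQ _ hy)) (fun z hz => hsQ z (hTU hz))
      (Set.mem_image_of_mem _ hx₁) (Complex.conj_eq_iff_im.2 h1)
    have := heq (Set.mem_image_of_mem _ hx)
    exact (Complex.conj_eq_iff_re.1 this).symm
  have hagree : ∀ s t : ℂ → ℂ, AnalyticOnNhd ℂ s U → AnalyticOnNhd ℂ t U → (∀ z ∈ U, Q z (s z)) →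
      (∀ z ∈ U, Q z (t z)) → ∀ x₁ ∈ Set.Ioo a b, s x₁ = t x₁ → ∀ x ∈ Set.Ioo a b, s x = t x := by
    intro s t hs ht hsQ htQ x₁ hx₁ h1 x hx
    exact IsLocallyBranched.eqOn_of_isPreconnected hUc.isPreconnected hUb hs.continuousOn
      ht.continuousOn hsQ htQ (hTU (Set.mem_image_of_mem _ hx₁)) h1 (hTU (Set.mem_image_of_mem _ hx))
  have : Finite {y : ℝ | Q x₀ y} := D.finite_Q x₀
  obtain ⟨n, ⟨e⟩⟩ := Finite.exists_equiv_fin {y : ℝ | Q x₀ y}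
  choose s hs hs0 hsQ using fun y : {y : ℝ | Q x₀ y} =>
    IsLocallyBranched.exists_analyticOnNhd hU hUc hUb (show (x₀ : ℂ) ∈ U from hx₀) y.2
  have hsre : ∀ y, ∀ x ∈ Set.Ioo a b, s y x = ((s y x).re : ℂ) := fun y =>
    hreal (s y) (hs y) (hsQ y) x₀ hx₀ (by rw [hs0]; simp)
  refine ⟨n, fun k x => (s (e.symm k) x).re, fun k => ?_, fun x hx => ⟨fun k l hkl => ?_, fun y =>
    ⟨fun hy => ?_, ?_⟩⟩⟩
  · refine Complex.continuous_re.comp_continuousOn ((hs _).continuousOn.comp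
      Complex.continuous_ofReal.continuousOn fun x hx => hx)
  · have h1 : s (e.symm k) x = s (e.symm l) x := by
      exact (hsre _ x hx).trans ((congrArg Complex.ofReal hkl).trans (hsre _ x hx).symm)
    have h2 := hagree _ _ (hs _) (hs _) (hsQ _) (hsQ _) x hx h1 x₀ hx₀
    rw [hs0, hs0] at h2
    exact e.symm.injective (Subtype.ext (by exact_mod_cast h2))
  -- A real root over `x` is continued back to `x₀`, where it is still real and so is one of the
  -- chosen initial values.
  · obtain ⟨t, ht, ht0, htQ⟩ :=
      IsLocallyBranched.exists_analyticOnNhd hU hUc hUb (show (x : ℂ) ∈ U from hx) hy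
    have htre := hreal t ht htQ x hx (by rw [ht0]; simp) x₀ hx₀
    have hQ0 : Q x₀ ((t x₀).re : ℝ) := by
      rw [← htre]
      exact htQ _ hx₀
    refine ⟨e ⟨(t x₀).re, hQ0⟩, ?_⟩
    have h1 := hagree (s ⟨(t x₀).re, hQ0⟩) t (hs _) ht (hsQ _) htQ x₀ hx₀ (by
      rw [hs0]; exact htre.symm) x hx
    simp [h1, ht0]
  · rintro ⟨k, rfl⟩
    rw [← hsre _ x hx]
    exact hsQ _ _ hx

end IsCurveData

namespace IsCurveData

variable {Q P : ℂ → ℂ → Prop} {X : Set ℝ} {B : Set ℂ}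

/-- At a point off the curve a gate makes membership in `closure Ω` locally constant along the line,
so relative frontier points lie in the finite set of curve points on it. -/
theorem isArcUnion_vertical_line (D : IsCurveData Q P X B) {Ω : Set ℂ} (hΩ : IsOpen Ω)
    (hbdd : Bornology.IsBounded Ω) (hfr : frontier Ω ⊆ skeleton Q X) {x : ℝ} (hx : x ∈ X) :
    IsArcUnion (curveSet Q) ({z | z.re = x} ∩ closure Ω) := by
  have hmk : Continuous fun y : ℝ => (⟨x, y⟩ : ℂ) := by
    rw [← continuousOn_univ]
    exact continuousOn_complex_mk continuousOn_const continuousOn_id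
  set K : Set ℝ := (fun y => (⟨x, y⟩ : ℂ)) ⁻¹' closure Ω
  have hK : IsClosed K := isClosed_closure.preimage hmk
  have hfin : (frontier K).Finite := by
    refine (D.finite_Q x).subset fun y hy => ?_
    by_contra hQ
    have hyK : (⟨x, y⟩ : ℂ) ∈ closure Ω := hK.frontier_subset hy
    obtain ⟨N, N₁, N₂, hyN, -, hN⟩ := D.exists_gate (q := ⟨x, y⟩) (Or.inr hx)
      (fun h => hQ h.1) univ_mem
    have hsub := D.inter_skeleton_subset_closure hΩ hfr hN ⟨_, hyN, hyK⟩
    refine hy.2 (mem_interior_iff_mem_nhds.2 ?_)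
    filter_upwards [hmk.continuousAt.eventually (hN.isOpen.mem_nhds hyN)] with y' hy'
    exact hsub ⟨hy', Or.inr hx⟩
  obtain ⟨r, hr⟩ := hbdd.closure.subset_closedBall 0
  have h1 := IsArcUnion.vertical_of_frontier_finite (Z := curveSet Q) hK hfin x
    (show -(|r| + 1) < |r| + 1 by linarith [abs_nonneg r])
  convert h1 using 1
  ext z
  constructor
  · rintro ⟨rfl, hz⟩
    have h2 := mem_closedBall_zero_iff.1 (hr hz)
    have h3 := abs_le.1 ((Complex.abs_im_le_norm z).trans (h2.trans (le_abs_self r)))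
    exact ⟨z.im, ⟨hz, by linarith [h3.1], by linarith [h3.2]⟩, rfl⟩
  · rintro ⟨y, ⟨hy, -⟩, rfl⟩
    exact ⟨rfl, hy⟩

/-- The gates show that the open graph lies in `closure Ω` entirely or not at all. In the first case
it is bounded and has limits at both ends, so it extends to a compact graph. -/
theorem isArcUnion_graph (D : IsCurveData Q P X B) {Ω : Set ℂ} (hΩ : IsOpen Ω)
    (hbdd : Bornology.IsBounded Ω) (hfr : frontier Ω ⊆ skeleton Q X) {a b : ℝ} (hab : a < b)
    (hX : ∀ x ∈ Set.Ioo a b, x ∉ X) {h : ℝ → ℝ} (hh : ContinuousOn h (Set.Ioo a b))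
    (hQ : ∀ x ∈ Set.Ioo a b, Q x (h x)) :
    ∃ A, IsArcUnion (curveSet Q) A ∧ A ⊆ curveSet Q ∩ closure Ω ∩ {z | z.re ∈ Set.Icc a b} ∧
      ∀ x ∈ Set.Ioo a b, (⟨x, h x⟩ : ℂ) ∈ closure Ω → (⟨x, h x⟩ : ℂ) ∈ A := by
  have hmk : ContinuousOn (fun x => (⟨x, h x⟩ : ℂ)) (Set.Ioo a b) :=
    continuousOn_complex_mk continuousOn_id hh
  have hiff : ∀ x ∈ Set.Ioo a b, ∀ᶠ x' in 𝓝[Set.Ioo a b] x,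
      ((⟨x', h x'⟩ : ℂ) ∈ closure Ω ↔ (⟨x, h x⟩ : ℂ) ∈ closure Ω) := fun x hx => by
    obtain ⟨N, N₁, N₂, hyN, -, hN⟩ := D.exists_gate (q := ⟨x, h x⟩) (Or.inl (hQ x hx))
      (fun h => hX x hx h.2) univ_mem
    filter_upwards [(hmk x hx).eventually (hN.isOpen.mem_nhds hyN), self_mem_nhdsWithin]
      with x' hx' hx'I
    constructor
    · intro h1
      exact D.inter_skeleton_subset_closure hΩ hfr hN ⟨_, hx', h1⟩ ⟨hyN, Or.inl (hQ x hx)⟩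
    · intro h1
      exact D.inter_skeleton_subset_closure hΩ hfr hN ⟨_, hyN, h1⟩ ⟨hx', Or.inl (hQ x' hx'I)⟩
  by_cases hex : ∃ x ∈ Set.Ioo a b, (⟨x, h x⟩ : ℂ) ∈ closure Ω
  · obtain ⟨x₁, hx₁, hx₁Ω⟩ := hex
    have hall : ∀ x ∈ Set.Ioo a b, (⟨x, h x⟩ : ℂ) ∈ closure Ω := fun x hx =>
      (isPreconnected_Ioo.iff_of_eventually (p := fun x => (⟨x, h x⟩ : ℂ) ∈ closure Ω)
        hiff hx₁ hx).1 hx₁Ω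
    obtain ⟨r, hr⟩ := hbdd.closure.subset_closedBall 0
    have hbd : ∀ x ∈ Set.Ioo a b, |h x| ≤ r := fun x hx =>
      (Complex.abs_im_le_norm ⟨x, h x⟩).trans (mem_closedBall_zero_iff.1 (hr (hall x hx)))
    -- Since `Q` is closed, a value taken frequently near an end `c` is a root over `c`, and these
    -- are finite in number.
    have hfreq : ∀ {l : Filter ℝ} {c : ℝ}, Tendsto id l (𝓝 c) → (∀ᶠ x in l, x ∈ Set.Ioo a b) →
        ∀ e, (∃ᶠ x in l, h x = e) → e ∈ {y : ℝ | Q c y} := fun {l c} hl hlI e he => by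
      have h1 : Tendsto (fun x : ℝ => ((x : ℂ), (e : ℂ))) l (𝓝 ((c : ℂ), (e : ℂ))) :=
        ((Complex.continuous_ofReal.tendsto c).comp hl).prodMk_nhds tendsto_const_nhds
      refine D.isClosed_Q.mem_of_frequently_of_tendsto ?_ h1
      refine (he.and_eventually hlI).mono fun x hx => ?_
      have := hQ x hx.2
      rw [hx.1] at this
      exact this
    have hIa : Set.Ioo a b ∈ 𝓝[>] a := Ioo_mem_nhdsGT hab
    have hIb : Set.Ioo a b ∈ 𝓝[<] b := Ioo_mem_nhdsLT hab
    obtain ⟨la, hla⟩ := exists_tendsto_of_finite_frequently (l := 𝓝[>] a) (h := h)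
      (fun s hs => by
        obtain ⟨u, hu, hus⟩ := (mem_nhdsGT_iff_exists_Ioo_subset).1 (inter_mem hs hIa)
        exact ⟨Set.Ioo a u, Ioo_mem_nhdsGT hu, fun x hx => (hus hx).1, isPreconnected_Ioo,
          hh.mono fun x hx => (hus hx).2⟩)
      (mem_of_superset hIa hbd) (D.finite_Q a) (hfreq (tendsto_id.mono_left nhdsWithin_le_nhds) hIa)
    obtain ⟨lb, hlb⟩ := exists_tendsto_of_finite_frequently (l := 𝓝[<] b) (h := h)
      (fun s hs => by
        obtain ⟨u, hu, hus⟩ := (mem_nhdsLT_iff_exists_Ioo_subset).1 (inter_mem hs hIb)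
        exact ⟨Set.Ioo u b, Ioo_mem_nhdsLT hu, fun x hx => (hus hx).1, isPreconnected_Ioo,
          hh.mono fun x hx => (hus hx).2⟩)
      (mem_of_superset hIb hbd) (D.finite_Q b) (hfreq (tendsto_id.mono_left nhdsWithin_le_nhds) hIb)
    set H := extendFrom (Set.Ioo a b) h
    have hH : ContinuousOn H (Set.Icc a b) := continuousOn_Icc_extendFrom_Ioo hh hla hlb
    have hHh : ∀ x ∈ Set.Ioo a b, H x = h x := fun x hx =>
      extendFrom_eq (subset_closure hx) (hh x hx)
    have hmem : ∀ x ∈ Set.Icc a b, (⟨x, H x⟩ : ℂ) ∈ curveSet Q ∩ closure Ω := by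
      have hcl : IsClosed (curveSet Q ∩ closure Ω) := D.isClosed_curveSet.inter isClosed_closure
      have hc : ContinuousOn (fun x => (⟨x, H x⟩ : ℂ)) (closure (Set.Ioo a b)) := by
        rw [closure_Ioo hab.ne]
        exact continuousOn_complex_mk continuousOn_id hH
      intro x hx
      rw [← closure_Ioo hab.ne] at hx
      refine closure_minimal ?_ hcl (hc.image_closure (Set.mem_image_of_mem _ hx))
      rintro _ ⟨y, hy, rfl⟩
      simp only [hHh y hy]
      exact ⟨hQ y hy, hall y hy⟩
    refine ⟨_, IsArcUnion.graph a b H hH fun x hx => (hmem x hx).1, ?_, fun x hx _ => ?_⟩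
    · rintro _ ⟨x, hx, rfl⟩
      exact ⟨hmem x hx, hx⟩
    · exact ⟨x, Set.Ioo_subset_Icc_self hx, by simp only [hHh x hx]⟩
  · exact ⟨∅, IsArcUnion.empty, Set.empty_subset _, fun x hx hxΩ => absurd ⟨x, hx, hxΩ⟩ hex⟩

theorem isArcUnion_skeleton_inter_closure (D : IsCurveData Q P X B) {Ω : Set ℂ} (hΩ : IsOpen Ω)
    (hbdd : Bornology.IsBounded Ω) (hfr : frontier Ω ⊆ skeleton Q X) :
    IsArcUnion (curveSet Q) (skeleton Q X ∩ closure Ω) := by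
  have hcurve : ∀ a b : ℝ, a < b →
      IsArcUnion (curveSet Q) (curveSet Q ∩ closure Ω ∩ {z | z.re ∈ Set.Icc a b}) := by
    intro a b hab
    refine D.finite_X.interval_induction (p := fun a b =>
      IsArcUnion (curveSet Q) (curveSet Q ∩ closure Ω ∩ {z | z.re ∈ Set.Icc a b})) ?_ ?_ hab
    · intro a b hab hX
      obtain ⟨n, h, hc, hh⟩ := D.exists_graphs hX
      choose A hA hAsub hAmem using fun k => D.isArcUnion_graph hΩ hbdd hfr hab hX (hc k)
        fun x hx => ((hh x hx).2 _).2 ⟨k, rfl⟩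
      have h1 : IsArcUnion (curveSet Q)
          (({z : ℂ | z ∈ curveSet Q ∧ z.re = a} ∩ closure Ω) ∪
            ({z : ℂ | z ∈ curveSet Q ∧ z.re = b} ∩ closure Ω) ∪ ⋃ k ∈ Set.univ, A k) :=
        ((IsArcUnion.of_finite ((D.finite_fiber a).subset Set.inter_subset_left)).union
          (IsArcUnion.of_finite ((D.finite_fiber b).subset Set.inter_subset_left))).union
          (IsArcUnion.biUnion Set.finite_univ fun k _ => hA k)
      convert h1 using 1
      ext z
      constructor
      · rintro ⟨⟨hzQ, hzΩ⟩, hz⟩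
        rcases hz.1.eq_or_lt with h2 | h2
        · exact Or.inl (Or.inl ⟨⟨hzQ, h2.symm⟩, hzΩ⟩)
        rcases hz.2.eq_or_lt with h3 | h3
        · exact Or.inl (Or.inr ⟨⟨hzQ, h3⟩, hzΩ⟩)
        obtain ⟨k, hk⟩ := ((hh z.re ⟨h2, h3⟩).2 z.im).1 hzQ
        refine Or.inr (Set.mem_iUnion₂.2 ⟨k, Set.mem_univ _, ?_⟩)
        have hz' : z = ⟨z.re, h k z.re⟩ := Complex.ext rfl hk.symm
        rw [hz']
        exact hAmem k z.re ⟨h2, h3⟩ (hz' ▸ hzΩ)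
      · rintro ((⟨⟨hzQ, rfl⟩, hzΩ⟩ | ⟨⟨hzQ, rfl⟩, hzΩ⟩) | hz)
        · exact ⟨⟨hzQ, hzΩ⟩, le_rfl, hab.le⟩
        · exact ⟨⟨hzQ, hzΩ⟩, hab.le, le_rfl⟩
        · obtain ⟨k, -, hk⟩ := Set.mem_iUnion₂.1 hz
          exact hAsub k hk
    · intro a c b hac hcb _ h1 h2
      have : {z : ℂ | z.re ∈ Set.Icc a b} = {z | z.re ∈ Set.Icc a c} ∪ {z | z.re ∈ Set.Icc c b} := by
        ext z
        exact Set.ext_iff.1 (Set.Icc_union_Icc_eq_Icc hac.le hcb.le).symm z.re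
      rw [this, Set.inter_union_distrib_left]
      exact h1.union h2
  obtain ⟨r, hr⟩ := hbdd.closure.subset_closedBall 0
  have h1 := (hcurve (-(|r| + 1)) (|r| + 1) (by linarith [abs_nonneg r])).union
    (IsArcUnion.biUnion D.finite_X fun x hx => D.isArcUnion_vertical_line hΩ hbdd hfr hx)
  convert h1 using 1
  ext z
  constructor
  · rintro ⟨hz | hz, hzΩ⟩
    · left
      have h2 := mem_closedBall_zero_iff.1 (hr hzΩ)
      have h3 := abs_le.1 ((Complex.abs_re_le_norm z).trans (h2.trans (le_abs_self r)))
      exact ⟨⟨hz, hzΩ⟩, by linarith [h3.1], by linarith [h3.2]⟩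
    · exact Or.inr (Set.mem_iUnion₂.2 ⟨z.re, hz, rfl, hzΩ⟩)
  · rintro (⟨⟨hz, hzΩ⟩, -⟩ | hz)
    · exact ⟨Or.inl hz, hzΩ⟩
    · obtain ⟨x, hx, rfl, hzΩ⟩ := Set.mem_iUnion₂.1 hz
      exact ⟨Or.inr hx, hzΩ⟩

/-- A bounded part of the complement of the skeleton is covered by finitely many cells. -/
theorem exists_finite_cells (D : IsCurveData Q P X B) {a b : ℝ} (hab : a < b) :
    ∃ 𝒟 : Set (Set ℂ), 𝒟.Finite ∧ (∀ d ∈ 𝒟, IsPreconnected d ∧ Disjoint d (skeleton Q X)) ∧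
      ∀ z : ℂ, z.re ∈ Set.Ioo a b → z ∉ skeleton Q X → ∃ d ∈ 𝒟, z ∈ d := by
  refine D.finite_X.interval_induction (p := fun a b =>
    ∃ 𝒟 : Set (Set ℂ), 𝒟.Finite ∧ (∀ d ∈ 𝒟, IsPreconnected d ∧ Disjoint d (skeleton Q X)) ∧
      ∀ z : ℂ, z.re ∈ Set.Ioo a b → z ∉ skeleton Q X → ∃ d ∈ 𝒟, z ∈ d) ?_ ?_ hab
  · intro a b hab hX
    classical
    obtain ⟨n, h, hc, hh⟩ := D.exists_graphs hX
    -- A cell is indexed by the set `A` of graphs lying below it; most of these cells may be empty.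
    let Y : Set (Fin n) → ℝ → Set ℝ := fun A x => ⋂ k, if k ∈ A then Set.Ioi (h k x) else
      Set.Iio (h k x)
    let cell : Set (Fin n) → Set ℂ := fun A => {z | z.re ∈ Set.Ioo a b ∧ z.im ∈ Y A z.re}
    have hYmem : ∀ A x y, y ∈ Y A x ↔ (∀ k ∈ A, h k x < y) ∧ ∀ k ∉ A, y < h k x := by
      intro A x y
      simp only [Y, Set.mem_iInter]
      constructor
      · intro hy
        exact ⟨fun k hk => by simpa [hk] using hy k, fun k hk => by simpa [hk] using hy k⟩
      · rintro ⟨h1, h2⟩ k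
        by_cases hk : k ∈ A
        · simpa [hk] using h1 k hk
        · simpa [hk] using h2 k hk
    refine ⟨Set.range cell, Set.finite_range _, ?_, fun z hz hzT => ?_⟩
    · rintro _ ⟨A, rfl⟩
      refine ⟨?_, Set.disjoint_left.2 ?_⟩
      · rcases (cell A).eq_empty_or_nonempty with he | ⟨z₁, hz₁⟩
        · rw [he]
          exact isPreconnected_empty
        -- Disjoint continuous graphs never change their order, so one point in the cell makes every
        -- fibre over the interval nonempty.
        have hord : ∀ k ∈ A, ∀ l ∉ A, ∀ x ∈ Set.Ioo a b, h k x < h l x := by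
          intro k hk l hl x hx
          have hkl : k ≠ l := fun h => hl (h ▸ hk)
          have h1 : h k z₁.re < h l z₁.re :=
            (((hYmem _ _ _).1 hz₁.2).1 k hk).trans (((hYmem _ _ _).1 hz₁.2).2 l hl)
          refine (isPreconnected_Ioo.iff_of_eventually (p := fun x => h k x < h l x)
            (fun x hx => ?_) hz₁.1 hx).1 h1
          have hne : h k x ≠ h l x := fun h => hkl ((hh x hx).1 h)
          rcases lt_or_gt_of_ne hne with hlt | hgt
          · filter_upwards [(hc k x hx).eventually_lt (hc l x hx) hlt] with x' hx'
            exact iff_of_true hx' hlt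
          · filter_upwards [(hc l x hx).eventually_lt (hc k x hx) hgt] with x' hx'
            exact iff_of_false (not_lt.2 hx'.le) (not_lt.2 hgt.le)
        refine isPreconnected_region Set.ordConnected_Ioo (fun x _ => ?_) fun x hx => ?_
        · refine convex_iInter fun k => ?_
          split_ifs
          · exact convex_Ioi _
          · exact convex_Iio _
        · obtain ⟨c, hc1, hc2⟩ := Order.exists_between_finsets
            ((Finset.univ.filter (· ∈ A)).image fun k => h k x)
            ((Finset.univ.filter (· ∉ A)).image fun k => h k x) (by
              intro u hu v hv
              obtain ⟨k, hk, rfl⟩ := Finset.mem_image.1 hu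
              obtain ⟨l, hl, rfl⟩ := Finset.mem_image.1 hv
              exact hord k (Finset.mem_filter.1 hk).2 l (Finset.mem_filter.1 hl).2 x hx)
          refine ⟨c, ?_⟩
          have hev : ∀ k, ∀ᶠ x' in 𝓝[Set.Ioo a b] x,
              (k ∈ A → h k x' < c) ∧ (k ∉ A → c < h k x') := fun k => by
            by_cases hk : k ∈ A
            · have : h k x < c := hc1 _ (Finset.mem_image.2 ⟨k, by simp [hk], rfl⟩)
              filter_upwards [(hc k x hx).eventually_lt_const this] with x' hx'
              simp [hk, hx']
            · have : c < h k x := hc2 _ (Finset.mem_image.2 ⟨k, by simp [hk], rfl⟩)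
              filter_upwards [(hc k x hx).eventually_const_lt this] with x' hx'
              simp [hk, hx']
          filter_upwards [eventually_all.2 hev] with x' hx'
          exact (hYmem _ _ _).2 ⟨fun k => (hx' k).1, fun k => (hx' k).2⟩
      · rintro z ⟨hz1, hz2⟩ (hz3 | hz3)
        · obtain ⟨k, hk⟩ := ((hh _ hz1).2 _).1 hz3
          by_cases hkA : k ∈ A
          · exact (((hYmem _ _ _).1 hz2).1 k hkA).ne hk
          · exact (((hYmem _ _ _).1 hz2).2 k hkA).ne' hk
        · exact hX _ hz1 hz3
    · refine ⟨_, ⟨{k | h k z.re < z.im}, rfl⟩, hz, (hYmem _ _ _).2 ⟨fun k hk => hk, fun k hk => ?_⟩⟩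
      refine lt_of_le_of_ne (not_lt.1 hk) fun heq => hzT (Or.inl ?_)
      exact ((hh _ hz).2 _).2 ⟨k, heq.symm⟩
  · rintro a c b hac hcb hcX ⟨𝒟₁, hf₁, hd₁, hc₁⟩ ⟨𝒟₂, hf₂, hd₂, hc₂⟩
    refine ⟨𝒟₁ ∪ 𝒟₂, hf₁.union hf₂, ?_, fun z hz hzT => ?_⟩
    · rintro d (hd | hd)
      · exact hd₁ d hd
      · exact hd₂ d hd
    · rcases lt_trichotomy z.re c with h1 | h1 | h1
      · obtain ⟨d, hd, hzd⟩ := hc₁ z ⟨hz.1, h1⟩ hzT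
        exact ⟨d, Or.inl hd, hzd⟩
      · exact absurd (Or.inr (show z.re ∈ X from h1 ▸ hcX)) hzT
      · obtain ⟨d, hd, hzd⟩ := hc₂ z ⟨h1, hz.2⟩ hzT
        exact ⟨d, Or.inr hd, hzd⟩

end IsCurveData

/-! ### The unbounded component of the complement -/

/-- Polar coordinates. It serves for the exterior of a large disc and for a punctured disc. -/
theorem isPreconnected_norm_sub_mem (c : ℂ) {I : Set ℝ} (hI : IsPreconnected I)
    (hI0 : I ⊆ Set.Ioi 0) : IsPreconnected {z : ℂ | ‖z - c‖ ∈ I} := by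
  have h1 : IsPreconnected (I ×ˢ Metric.sphere (0 : ℂ) 1) :=
    hI.prod (isPreconnected_sphere (by simp) 0 1)
  convert h1.image (fun p : ℝ × ℂ => c + (p.1 : ℂ) * p.2) (by fun_prop) using 1
  ext z
  constructor
  · intro hz
    have hz' : ‖z - c‖ ∈ I := hz
    have hne : (‖z - c‖ : ℂ) ≠ 0 := by exact_mod_cast (hI0 hz').ne'
    refine ⟨(‖z - c‖, (z - c) / ‖z - c‖), ⟨hz', ?_⟩, ?_⟩
    · rw [mem_sphere_zero_iff_norm, norm_div, Complex.norm_real, norm_norm,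
        div_self (hI0 hz').ne']
    · dsimp only
      rw [mul_div_cancel₀ _ hne]
      ring
  · rintro ⟨⟨t, u⟩, ⟨ht, hu⟩, rfl⟩
    have ht0 : 0 < t := hI0 ht
    rw [mem_sphere_zero_iff_norm] at hu
    change ‖c + (t : ℂ) * u - c‖ ∈ I
    rw [add_sub_cancel_left, norm_mul, hu, Complex.norm_real, mul_one, Real.norm_of_nonneg ht0.le]
    exact ht

section UnboundedComponent

variable {Ω : Set ℂ}

theorem subset_unboundedComponent {s : Set ℂ} (hs : IsPreconnected s) (hsΩ : s ⊆ (closure Ω)ᶜ)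
    (hbdd : ¬ Bornology.IsBounded s) : s ⊆ unboundedComponent Ω := fun _ hz =>
  ⟨hsΩ hz, fun h => hbdd (h.subset (hs.subset_connectedComponentIn hz hsΩ))⟩

theorem connectedComponentIn_subset_unboundedComponent {z : ℂ} (hz : z ∈ unboundedComponent Ω) :
    connectedComponentIn (closure Ω)ᶜ z ⊆ unboundedComponent Ω :=
  subset_unboundedComponent isPreconnected_connectedComponentIn
    (connectedComponentIn_subset _ _) hz.2

theorem isOpen_unboundedComponent : IsOpen (unboundedComponent Ω) :=
  isOpen_iff_mem_nhds.2 fun _ hz => mem_of_superset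
    ((isClosed_closure.isOpen_compl.connectedComponentIn).mem_nhds
      (mem_connectedComponentIn hz.1)) (connectedComponentIn_subset_unboundedComponent hz)

theorem disjoint_unboundedComponent (hΩ : IsOpen Ω) :
    Disjoint (closure (unboundedComponent Ω)) Ω :=
  (Set.disjoint_left.2 fun _ hz hz' => hz.1 (subset_closure hz')).closure_left hΩ

theorem frontier_unboundedComponent_subset (hΩ : IsOpen Ω) :
    frontier (unboundedComponent Ω) ⊆ frontier Ω := by
  intro z hz
  have hzC : z ∉ unboundedComponent Ω := fun h => hz.2 (isOpen_unboundedComponent.interior_eq.symm ▸ h)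
  refine ⟨?_, ?_⟩
  · by_contra hzΩ
    obtain ⟨w, hw, hwC⟩ := mem_closure_iff.1 hz.1 _
      (isClosed_closure.isOpen_compl.connectedComponentIn) (mem_connectedComponentIn hzΩ)
    refine hzC (connectedComponentIn_subset_unboundedComponent hwC ?_)
    rw [← connectedComponentIn_eq hw]
    exact mem_connectedComponentIn hzΩ
  · rw [hΩ.interior_eq]
    exact Set.disjoint_left.1 (disjoint_unboundedComponent hΩ) hz.1

/-- The exterior `A` of a large disc is connected, and an unbounded component cannot avoid it; so
there is only one. -/
theorem isConnected_unboundedComponent (hbdd : Bornology.IsBounded Ω) :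
    IsConnected (unboundedComponent Ω) := by
  obtain ⟨r, hr⟩ := hbdd.closure.subset_closedBall 0
  set A : Set ℂ := {z | ‖z - 0‖ ∈ Set.Ioi (max r 1)}
  have hA : IsPreconnected A := isPreconnected_norm_sub_mem 0 isPreconnected_Ioi
    fun x hx => Set.mem_Ioi.2 (one_pos.trans_le ((le_max_right r 1).trans (le_of_lt hx)))
  have hAΩ : A ⊆ (closure Ω)ᶜ := fun z hz hzΩ => by
    have h1 := mem_closedBall_zero_iff.1 (hr hzΩ)
    have h2 : max r 1 < ‖z - 0‖ := hz
    rw [sub_zero] at h2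
    exact absurd (h2.trans_le h1) (not_lt.2 (le_max_left _ _))
  have hmem : ∀ t : ℝ, 0 ≤ t → ((max r 1 + 1 + t : ℝ) : ℂ) ∈ A := fun t ht => by
    change max r 1 < ‖((max r 1 + 1 + t : ℝ) : ℂ) - 0‖
    rw [sub_zero, Complex.norm_real, Real.norm_eq_abs]
    exact lt_of_lt_of_le (by linarith) (le_abs_self _)
  have hAb : ¬ Bornology.IsBounded A := fun h => by
    obtain ⟨R, hR⟩ := h.subset_closedBall 0
    have := mem_closedBall_zero_iff.1 (hR (hmem |R| (abs_nonneg R)))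
    rw [Complex.norm_real, Real.norm_eq_abs] at this
    have h1 := (le_abs_self _).trans this
    have h2 := le_max_right r 1
    linarith [le_abs_self R]
  set a : ℂ := ((max r 1 + 1 + 0 : ℝ) : ℂ)
  have ha : a ∈ A := hmem 0 le_rfl
  have haC : a ∈ unboundedComponent Ω := subset_unboundedComponent hA hAΩ hAb ha
  have heq : unboundedComponent Ω = connectedComponentIn (closure Ω)ᶜ a := by
    refine Set.Subset.antisymm (fun z hz => ?_) (connectedComponentIn_subset_unboundedComponent haC)
    have : ∃ w ∈ connectedComponentIn (closure Ω)ᶜ z, w ∈ A := by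
      by_contra! hcon
      refine hz.2 ((Metric.isBounded_closedBall (x := (0 : ℂ)) (r := max r 1)).subset fun w hw => ?_)
      have h1 : ¬ max r 1 < ‖w - 0‖ := hcon w hw
      rw [sub_zero] at h1
      exact mem_closedBall_zero_iff.2 (not_lt.1 h1)
    obtain ⟨w, hw, hwA⟩ := this
    have h1 := hA.subset_connectedComponentIn ha hAΩ hwA
    rw [connectedComponentIn_eq h1, ← connectedComponentIn_eq hw]
    exact mem_connectedComponentIn hz.1
  rw [heq]
  exact isConnected_connectedComponentIn_iff.2 (hAΩ ha)

end UnboundedComponent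

/-! ### Regular boundary points -/

namespace IsCurveData

variable {Q P : ℂ → ℂ → Prop} {X : Set ℝ} {B : Set ℂ}

/-- The chart is `ζ ↦ (x₀ + ζ) + i ψ(x₀ + ζ)`, where `ψ` is the analytic graph function. As `ψ` is
real on the real axis, its derivative `c` is real and `1 + ic ≠ 0`. A point of the curve is the
image of a real parameter, and injectivity excludes any other. -/
theorem isRegularBoundaryPoint (D : IsCurveData Q P X B) {Ω : Set ℂ} {a : ℂ}
    (ha : a ∈ curveSet Q) (haX : a.re ∉ X)
    (hloc : ∀ᶠ z in 𝓝 a, (z ∈ frontier Ω ↔ z ∈ curveSet Q)) : IsRegularBoundaryPoint Ω a := by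
  obtain ⟨δ, ε, ψ, hδ, hε, hψ, hbox, hψ0, hx⟩ := D.exists_graph_box ha haX hloc
  set x₀ := a.re
  have hψa : AnalyticAt ℂ ψ x₀ := hψ _ (Metric.mem_ball_self hδ)
  set c := deriv ψ x₀
  have hc : c.im = 0 := by
    have h1 : HasDerivAt (fun x : ℝ => ψ x) c x₀ := hψa.differentiableAt.hasDerivAt.comp_ofReal
    have h2 : HasDerivAt (fun x : ℝ => (ψ x).im) c.im x₀ :=
      Complex.imCLM.hasFDerivAt.comp_hasDerivAt x₀ h1
    have h3 : HasDerivAt (fun x : ℝ => (ψ x).im) 0 x₀ := by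
      refine (hasDerivAt_const x₀ (0 : ℝ)).congr_of_eventuallyEq ?_
      filter_upwards [Metric.ball_mem_nhds x₀ hδ] with x hx'
      exact (hx x (by rwa [Metric.mem_ball, Real.dist_eq] at hx')).2.1
    exact h2.unique h3
  set φ : ℂ → ℂ := fun ζ => (x₀ + ζ) + Complex.I * ψ (x₀ + ζ)
  have hφan : ∀ ζ ∈ Metric.ball (0 : ℂ) δ, AnalyticAt ℂ φ ζ := fun ζ hζ => by
    have h1 : AnalyticAt ℂ (fun ζ : ℂ => (x₀ : ℂ) + ζ) ζ := by fun_prop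
    have h2 : AnalyticAt ℂ ψ ((x₀ : ℂ) + ζ) := hψ _ (by simpa using hζ)
    exact h1.add (analyticAt_const.mul (h2.comp h1))
  have hφ0 : φ 0 = a := by
    simp only [φ, add_zero, hψ0]
    rw [mul_comm]
    exact Complex.re_add_im a
  have hφd : HasStrictDerivAt φ (1 + Complex.I * c) 0 := by
    have h1 : HasDerivAt (fun ζ : ℂ => (x₀ : ℂ) + ζ) 1 0 := (hasDerivAt_id _).const_add _
    have h2 : HasDerivAt ψ c ((x₀ : ℂ) + 0) := by
      rw [add_zero]
      exact hψa.differentiableAt.hasDerivAt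
    have h3 : HasDerivAt φ (1 + Complex.I * (c * 1)) 0 :=
      h1.add ((h2.comp (0 : ℂ) h1).const_mul Complex.I)
    have h4 := (hφan 0 (Metric.mem_ball_self hδ)).hasStrictDerivAt
    rwa [h3.deriv, mul_one] at h4
  have hne : 1 + Complex.I * c ≠ 0 := fun h => by
    have := congrArg Complex.re h
    simp [hc] at this
  obtain ⟨s, hs, hinj⟩ : ∃ s ∈ 𝓝 (0 : ℂ), Set.InjOn φ s := by
    have h1 := hφd.hasStrictFDerivAt_equiv hne
    exact ⟨_, (h1.toOpenPartialHomeomorph φ).open_source.mem_nhds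
      h1.mem_toOpenPartialHomeomorph_source, (h1.toOpenPartialHomeomorph φ).injOn⟩
  obtain ⟨r₁, hr₁, hball₁⟩ := Metric.mem_nhds_iff.1 (inter_mem hs (Metric.ball_mem_nhds (0 : ℂ) hδ))
  have hnear : ∀ᶠ ζ in 𝓝 (0 : ℂ), |(φ ζ).re - a.re| < min r₁ δ ∧ |(φ ζ).im - a.im| < ε := by
    have hcont : ContinuousAt φ 0 := (hφan 0 (Metric.mem_ball_self hδ)).continuousAt
    refine hcont.eventually ((isOpen_box a.re a.im (min r₁ δ) ε).mem_nhds ?_)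
    rw [hφ0]
    simp [hr₁, hδ, hε]
  obtain ⟨r₂, hr₂, hball₂⟩ := Metric.eventually_nhds_iff_ball.1 hnear
  have hofReal : ∀ x : ℝ, |x| < δ → φ x = ⟨x₀ + x, (ψ ((x₀ + x : ℝ) : ℂ)).re⟩ := fun x hxδ => by
    have h1 := (hx (x₀ + x) (by simpa using hxδ)).2.1
    apply Complex.ext
    · simp only [φ]
      rw [← Complex.ofReal_add]
      simpa using h1
    · simp only [φ]
      rw [← Complex.ofReal_add]
      simp
  refine ⟨min r₁ r₂, φ, lt_min hr₁ hr₂, fun ζ hζ => hφan ζ ?_, hinj.mono fun ζ hζ => ?_, hφ0,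
    fun ζ hζ => ?_⟩
  · exact (hball₁ (Metric.ball_subset_ball (min_le_left _ _) hζ)).2
  · exact (hball₁ (Metric.ball_subset_ball (min_le_left _ _) hζ)).1
  · obtain ⟨h1, h2⟩ := hball₂ ζ (Metric.ball_subset_ball (min_le_right _ _) hζ)
    have h1δ := h1.trans_le (min_le_right _ _)
    have hζ₁ := hball₁ (Metric.ball_subset_ball (min_le_left _ _) hζ)
    have hV : φ ζ ∈ frontier Ω ↔ φ ζ ∈ curveSet Q := hbox (show φ ζ ∈ _ from ⟨h1δ, h2⟩)
    have hQ := (hx _ h1δ).2.2.2 _ h2.le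
    rw [hV]
    refine (show φ ζ ∈ curveSet Q ↔ _ from hQ).trans ⟨fun h => ?_, fun h => ?_⟩
    · set x := (φ ζ).re - x₀
      have h3 : φ x = φ ζ := by
        rw [hofReal x h1δ]
        have : x₀ + x = (φ ζ).re := by simp [x]
        rw [this, ← h]
      have hxs : (x : ℂ) ∈ s := (hball₁ (by
        rw [mem_ball_zero_iff, Complex.norm_real]
        exact h1.trans_le (min_le_left _ _))).1
      rw [← hinj hxs hζ₁.1 h3]
      simp
    · have hζr : ζ = (ζ.re : ℂ) := Complex.ext rfl (by simpa using h)
      have hζδ : |ζ.re| < δ := by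
        have := hζ₁.2
        rw [mem_ball_zero_iff, hζr, Complex.norm_real] at this
        exact this
      rw [hζr, hofReal _ hζδ]

end IsCurveData

/-! ### Enlarging a partial cut domain through a gate -/

/-- A partial system of cuts: `O` is the part of the cut domain reached from the exterior so far, and
`S` extends `conj z` analytically to it. -/
structure IsPartialCutDomain (Q P : ℂ → ℂ → Prop) (X : Set ℝ) (Ω O : Set ℂ) (S : ℂ → ℂ) :
    Prop where
  isOpen : IsOpen O
  isConnected : IsConnected O
  unboundedComponent_subset : unboundedComponent Ω ⊆ O
  inter_nonempty : (O ∩ Ω).Nonempty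
  subset_union : O ⊆ closure (unboundedComponent Ω) ∪ Ω
  isArcUnion : IsArcUnion (curveSet Q) ((skeleton Q X ∩ closure Ω) \ O)
  component_subset : ∀ z ∈ O, z ∈ Ω \ skeleton Q X →
    connectedComponentIn (Ω \ skeleton Q X) z ⊆ O
  analyticAt : ∀ z ∈ O, z ∈ Ω ∪ frontier (unboundedComponent Ω) → AnalyticAt ℂ S z
  root : ∀ z ∈ O, z ∈ Ω → P z (S z)
  eq_conj : ∀ z ∈ O, z ∈ frontier (unboundedComponent Ω) → S z = conj z
  disjoint_branchSet : Disjoint O (branchSet Ω)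

namespace IsCurveData

variable {Q P : ℂ → ℂ → Prop} {X : Set ℝ} {B : Set ℂ}

theorem subset_skeleton (D : IsCurveData Q P X B) : B ⊆ skeleton Q X := fun b hb =>
  Or.inr (D.re_mem b hb)

/-- A branch over a piece of a set missing the exceptional vertical lines extends to the set. -/
theorem exists_extension (D : IsCurveData Q P X B) {c N : Set ℂ} (hc : IsPreconnected c)
    (hcX : ∀ z ∈ c, z.re ∉ X) (hN : IsPreconnected N) (hNne : N.Nonempty) (hNc : N ⊆ c)
    {s : ℂ → ℂ} (hs : ContinuousOn s N) (hsP : ∀ z ∈ N, P z (s z)) :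
    ∃ σ : ℂ → ℂ, AnalyticOnNhd ℂ σ c ∧ (∀ z ∈ c, P z (σ z)) ∧ Set.EqOn σ s N := by
  obtain ⟨z₀, hz₀⟩ := hNne
  -- The set `c` need not be simply connected, but it lies in the vertical strip over `I`, which is
  -- convex and misses `B`.
  set I := connectedComponentIn Xᶜ z₀.re
  set U : Set ℂ := {z | z.re ∈ I}
  have hI : IsOpen I := D.finite_X.isClosed.isOpen_compl.connectedComponentIn
  have hIX : I ⊆ Xᶜ := connectedComponentIn_subset _ _
  have hU : IsOpen U := hI.preimage Complex.continuous_re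
  have hUc : Convex ℝ U :=
    (isPreconnected_connectedComponentIn.convex : Convex ℝ I).is_linear_preimage
      Complex.reLm.isLinear
  have hUb : ∀ z ∈ U, IsLocallyBranched P z := fun z hz =>
    D.branched_P z fun h => hIX hz (D.re_mem z h)
  have hcU : c ⊆ U := fun z hz =>
    (hc.image Complex.re Complex.continuous_re.continuousOn).subset_connectedComponentIn
      (Set.mem_image_of_mem _ (hNc hz₀)) (by rintro _ ⟨w, hw, rfl⟩; exact hcX w hw)
      (Set.mem_image_of_mem _ hz)
  obtain ⟨σ, hσ, hσ0, hσP⟩ := IsLocallyBranched.exists_analyticOnNhd hU hUc hUb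
    (hcU (hNc hz₀)) (hsP z₀ hz₀)
  refine ⟨σ, hσ.mono hcU, fun z hz => hσP z (hcU hz), ?_⟩
  exact IsLocallyBranched.eqOn_of_isPreconnected hN (fun z hz => hUb z (hcU (hNc hz)))
    (hσ.continuousOn.mono (hNc.trans hcU)) hs (fun z hz => hσP z (hcU (hNc hz))) hsP hz₀ hσ0

variable {Ω : Set ℂ}

theorem isOpen_sdiff_skeleton (D : IsCurveData Q P X B) (hΩ : IsOpen Ω) :
    IsOpen (Ω \ skeleton Q X) := hΩ.sdiff D.isClosed_skeleton

/-- Opening a gate inside `Ω` adds one more component of `Ω` minus the skeleton. -/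
theorem exists_partialCutDomain_insert (D : IsCurveData Q P X B) (hΩ : IsOpen Ω)
    (hbranch : branchSet Ω ⊆ B ∪ frontier Ω) {O : Set ℂ} {S : ℂ → ℂ}
    (hO : IsPartialCutDomain Q P X Ω O S) {N N₁ N₂ : Set ℂ}
    (hN : IsGate (curveSet Q) (skeleton Q X) N N₁ N₂) (hNΩ : N ⊆ Ω) (hNB : Disjoint N B)
    (hne : (N ∩ skeleton Q X).Nonempty) (h1 : N₁ ⊆ O) (h2 : Disjoint N₂ O) :
    ∃ O' S', IsPartialCutDomain Q P X Ω O' S' ∧ O ⊆ O' ∧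
      ∃ z ∈ N₂, connectedComponentIn (Ω \ skeleton Q X) z ⊆ O' := by
  classical
  set T := skeleton Q X
  have hNT : ∀ z, z ∈ N → z ∉ T → z ∈ N₁ ∨ z ∈ N₂ := fun z hz hzT => by
    have : z ∈ N \ T := ⟨hz, hzT⟩
    rwa [hN.sdiff_eq] at this
  have hN₁ : N₁ ⊆ N \ T := hN.sdiff_eq ▸ Set.subset_union_left
  have hN₂ : N₂ ⊆ N \ T := hN.sdiff_eq ▸ Set.subset_union_right
  obtain ⟨q, hqN, hqT⟩ := hne
  have hN₁ne : N₁.Nonempty := closure_nonempty_iff.1 ⟨q, hN.subset_closure_left ⟨hqN, hqT⟩⟩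
  have hN₂ne : N₂.Nonempty := closure_nonempty_iff.1 ⟨q, hN.subset_closure_right ⟨hqN, hqT⟩⟩
  obtain ⟨z₁, hz₁⟩ := hN₁ne
  obtain ⟨z₂, hz₂⟩ := hN₂ne
  have hN₂Ω : N₂ ⊆ Ω \ T := fun z hz => ⟨hNΩ (hN₂ hz).1, (hN₂ hz).2⟩
  set c := connectedComponentIn (Ω \ T) z₂
  have hcsub : c ⊆ Ω \ T := connectedComponentIn_subset _ _
  have hcopen : IsOpen c := (D.isOpen_sdiff_skeleton hΩ).connectedComponentIn
  have hN₂c : N₂ ⊆ c := hN.isPreconnected_right.subset_connectedComponentIn hz₂ hN₂Ω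
  -- `O` contains every component of `Ω \ T` that it meets, and the component `c` contains the
  -- unreached side `N₂`.
  have hcO : Disjoint c O := by
    rw [Set.disjoint_left]
    intro z hz hzO
    have h3 := hO.component_subset z hzO (hcsub hz)
    rw [← connectedComponentIn_eq hz] at h3
    exact Set.disjoint_left.1 h2 hz₂ (h3 (hN₂c hz₂))
  have hNTO : ∀ z ∈ N, z ∈ T → z ∉ O := fun z hzN hzT hzO => by
    obtain ⟨w, hwO, hwN⟩ := mem_closure_iff.1 (hN.subset_closure_right ⟨hzN, hzT⟩) O hO.isOpen hzO
    exact Set.disjoint_left.1 h2 hwN hwO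
  have hNb : ∀ z ∈ N, IsLocallyBranched P z := fun z hz =>
    D.branched_P z (Set.disjoint_left.1 hNB hz)
  obtain ⟨s, hs, hs0, hsP⟩ := IsLocallyBranched.exists_analyticOnNhd hN.isOpen hN.convex hNb
    (hN₁ hz₁).1 (hO.root z₁ (h1 hz₁) (hNΩ (hN₁ hz₁).1))
  have hsS : Set.EqOn s S N₁ :=
    IsLocallyBranched.eqOn_of_isPreconnected hN.isPreconnected_left
      (fun z hz => hNb z (hN₁ hz).1) (hs.continuousOn.mono fun z hz => (hN₁ hz).1)
      (fun z hz => (hO.analyticAt z (h1 hz) (Or.inl (hNΩ (hN₁ hz).1))).continuousAt.continuousWithinAt)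
      (fun z hz => hsP z (hN₁ hz).1) (fun z hz => hO.root z (h1 hz) (hNΩ (hN₁ hz).1)) hz₁ hs0
  obtain ⟨σ, hσ, hσP, hσs⟩ := D.exists_extension (isPreconnected_connectedComponentIn)
    (fun z hz hzX => (hcsub hz).2 (Or.inr hzX)) hN.isPreconnected_right ⟨z₂, hz₂⟩ hN₂c
    (hs.continuousOn.mono fun z hz => (hN₂ hz).1) (fun z hz => hsP z (hN₂ hz).1)
  -- Here `O ∩ N` lies in `N₁`, `c ∩ N` in `N₂`, and `c` misses `O`, so the three pieces agree on
  -- their overlaps.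
  set S' : ℂ → ℂ := fun z => if z ∈ O then S z else if z ∈ c then σ z else s z
  have hS'O : Set.EqOn S' S O := fun z hz => by simp [S', hz]
  have hS'c : Set.EqOn S' σ c := fun z hz => by
    simp [S', hz, Set.disjoint_left.1 hcO hz]
  have hS'N : Set.EqOn S' s N := fun z hz => by
    by_cases hzO : z ∈ O
    · have hzT : z ∉ T := fun h => hNTO z hz h hzO
      rcases hNT z hz hzT with h | h
      · rw [hS'O hzO, hsS h]
      · exact absurd hzO (Set.disjoint_left.1 h2 h)
    · by_cases hzc : z ∈ c
      · rcases hNT z hz (hcsub hzc).2 with h | h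
        · exact absurd (h1 h) hzO
        · rw [hS'c hzc, hσs h]
      · simp [S', hzO, hzc]
  have hCΩ := disjoint_unboundedComponent (Ω := Ω) hΩ
  have hfrΩ : ∀ z ∈ Ω, z ∉ frontier (unboundedComponent Ω) := fun z hz h =>
    Set.disjoint_left.1 hCΩ h.1 hz
  refine ⟨O ∪ N ∪ c, S', ?_, fun z hz => Or.inl (Or.inl hz), z₂, hz₂, Set.subset_union_right⟩
  constructor
  · exact (hO.isOpen.union hN.isOpen).union hcopen
  · refine IsConnected.union ⟨z₂, Or.inr (hN₂ hz₂).1, hN₂c hz₂⟩ ?_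
      ⟨⟨z₂, hN₂c hz₂⟩, isPreconnected_connectedComponentIn⟩
    exact IsConnected.union ⟨z₁, h1 hz₁, (hN₁ hz₁).1⟩ hO.isConnected
      ⟨⟨z₁, (hN₁ hz₁).1⟩, hN.convex.isPreconnected⟩
  · exact fun z hz => Or.inl (Or.inl (hO.unboundedComponent_subset hz))
  · exact hO.inter_nonempty.mono fun z hz => ⟨Or.inl (Or.inl hz.1), hz.2⟩
  · rintro z ((hz | hz) | hz)
    · exact hO.subset_union hz
    · exact Or.inr (hNΩ hz)
    · exact Or.inr (hcsub hz).1
  · have h3 := hN.isArcUnion_sdiff _ hO.isArcUnion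
    convert h3 using 1
    ext z
    constructor
    · rintro ⟨hz, hz'⟩
      exact ⟨⟨hz, fun h => hz' (Or.inl (Or.inl h))⟩, fun h => hz' (Or.inl (Or.inr h))⟩
    · rintro ⟨⟨hz, hzO⟩, hzN⟩
      refine ⟨hz, ?_⟩
      rintro ((h | h) | h)
      · exact hzO h
      · exact hzN h
      · exact (hcsub h).2 hz.1
  · rintro z hz hzΩ
    have hcase : z ∈ O ∨ z ∈ c := by
      rcases hz with (hz | hz) | hz
      · exact Or.inl hz
      · rcases hNT z hz hzΩ.2 with h | h
        · exact Or.inl (h1 h)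
        · exact Or.inr (hN₂c h)
      · exact Or.inr hz
    rcases hcase with h | h
    · exact fun w hw => Or.inl (Or.inl (hO.component_subset z h hzΩ hw))
    · rw [← connectedComponentIn_eq h]
      exact Set.subset_union_right
  · rintro z ((hz | hz) | hz) hz'
    · exact (hO.analyticAt z hz hz').congr
        (hS'O.symm.eventuallyEq_of_mem (hO.isOpen.mem_nhds hz))
    · exact (hs z hz).congr (hS'N.symm.eventuallyEq_of_mem (hN.isOpen.mem_nhds hz))
    · exact (hσ z hz).congr (hS'c.symm.eventuallyEq_of_mem (hcopen.mem_nhds hz))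
  · rintro z ((hz | hz) | hz) hz'
    · rw [hS'O hz]
      exact hO.root z hz hz'
    · rw [hS'N hz]
      exact hsP z hz
    · rw [hS'c hz]
      exact hσP z hz
  · rintro z ((hz | hz) | hz) hz'
    · rw [hS'O hz]
      exact hO.eq_conj z hz hz'
    · exact absurd hz' (hfrΩ z (hNΩ hz))
    · exact absurd hz' (hfrΩ z (hcsub hz).1)
  · rw [Set.disjoint_left]
    have hΩfr : ∀ z ∈ Ω, z ∉ frontier Ω := fun z hz h => h.2 (hΩ.interior_eq.symm ▸ hz)
    rintro z ((hz | hz) | hz) hz'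
    · exact Set.disjoint_left.1 hO.disjoint_branchSet hz hz'
    · rcases hbranch hz' with h | h
      · exact Set.disjoint_left.1 hNB hz h
      · exact hΩfr z (hNΩ hz) h
    · rcases hbranch hz' with h | h
      · exact (hcsub hz).2 (D.subset_skeleton h)
      · exact hΩfr z (hcsub hz).1 h

end IsCurveData

/-! ### The first gate, from the exterior -/

namespace IsCurveData

variable {Q P : ℂ → ℂ → Prop} {X : Set ℝ} {B : Set ℂ} {Ω : Set ℂ}

/-- A highest boundary point on a vertical line is reachable from the exterior. -/
theorem exists_mem_frontier_ray (D : IsCurveData Q P X B) (hΩ : IsOpen Ω) (hne : Ω.Nonempty)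
    (hbdd : Bornology.IsBounded Ω) : ∃ a ∈ frontier Ω, a.re ∉ X ∧
      ∀ t : ℝ, 0 < t → a + (t : ℂ) * Complex.I ∈ unboundedComponent Ω := by
  obtain ⟨z₀, hz₀, hz₀T⟩ := D.exists_mem_notMem_skeleton hΩ hne
  have hK : IsCompact (closure Ω ∩ {z | z.re = z₀.re}) :=
    hbdd.isCompact_closure.inter_right (isClosed_eq Complex.continuous_re continuous_const)
  obtain ⟨a, ⟨haΩ, har⟩, hmax⟩ := hK.exists_isMaxOn ⟨z₀, subset_closure hz₀, rfl⟩
    Complex.continuous_im.continuousOn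
  have hray : ∀ t : ℝ, 0 < t → a + (t : ℂ) * Complex.I ∈ unboundedComponent Ω := by
    have h1 : (fun t : ℝ => a + (t : ℂ) * Complex.I) '' Set.Ioi 0 ⊆ unboundedComponent Ω := by
      refine subset_unboundedComponent (isPreconnected_Ioi.image _ (by fun_prop)) ?_ ?_
      · rintro _ ⟨t, ht, rfl⟩ hmem
        have h2 := hmax (a := a + (t : ℂ) * Complex.I) ⟨hmem, by simpa using har⟩
        have h3 : (a + (t : ℂ) * Complex.I).im ≤ a.im := h2
        have ht' : 0 < t := ht
        simp at h3
        linarith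
      · intro hb
        obtain ⟨r, hr⟩ := hb.subset_closedBall 0
        have h2 := mem_closedBall_zero_iff.1 (hr ⟨|a.im| + |r| + 1, Set.mem_Ioi.2 (by positivity), rfl⟩)
        have h3 := (Complex.abs_im_le_norm _).trans h2
        have h4 := (le_abs_self _).trans h3
        simp at h4
        linarith [le_abs_self r, neg_abs_le a.im]
    exact fun t ht => h1 ⟨t, ht, rfl⟩
  have haC : a ∈ closure (unboundedComponent Ω) :=
    mem_closure_of_forall_eps (v := Complex.I)
      (by filter_upwards [self_mem_nhdsWithin] with t ht using hray t ht)
  refine ⟨a, ⟨haΩ, fun h => ?_⟩, fun h => hz₀T (Or.inr ?_), hray⟩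
  · rw [hΩ.interior_eq] at h
    exact Set.disjoint_left.1 (disjoint_unboundedComponent hΩ) haC h
  · have har' : a.re = z₀.re := har
    rw [har'] at h
    exact h

/-- The first gate, from the exterior into `Ω`. -/
theorem exists_exterior_gate (D : IsCurveData Q P X B) (hΩ : IsOpen Ω)
    (hfr : frontier Ω ⊆ skeleton Q X) {a : ℂ} (ha : a ∈ frontier Ω) (haX : a.re ∉ X)
    (hray : ∀ t : ℝ, 0 < t → a + (t : ℂ) * Complex.I ∈ unboundedComponent Ω)
    {V : Set ℂ} (hV : V ∈ 𝓝 a) :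
    ∃ N N₁ N₂, a ∈ N ∧ N ⊆ V ∧ IsGate (curveSet Q) (skeleton Q X) N N₁ N₂ ∧
      N₁ ⊆ unboundedComponent Ω ∧ N₂ ⊆ Ω := by
  obtain ⟨N, M₁, M₂, haN, hNV, hM⟩ := D.exists_gate (hfr ha) (fun h => haX h.2) hV
  have hcont : Continuous fun t : ℝ => a + (t : ℂ) * Complex.I := by fun_prop
  obtain ⟨t, ht0, htN, htT⟩ : ∃ t : ℝ, 0 < t ∧ a + (t : ℂ) * Complex.I ∈ N ∧
      a + (t : ℂ) * Complex.I ∉ skeleton Q X := by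
    have h1 : {t : ℝ | a + (t : ℂ) * Complex.I ∈ N} ∈ 𝓝 (0 : ℝ) :=
      (hM.isOpen.preimage hcont).mem_nhds (by simpa using haN)
    obtain ⟨ε, hε, hball⟩ := Metric.mem_nhds_iff.1 h1
    have hfin : {t : ℝ | a + (t : ℂ) * Complex.I ∈ skeleton Q X}.Finite := by
      refine Set.Finite.subset ((D.finite_fiber a.re).preimage
        (f := fun t : ℝ => a + (t : ℂ) * Complex.I) (fun x _ y _ h => ?_)) fun t ht => ?_
      · simpa using h
      · rcases ht with ht | ht
        · exact ⟨ht, by simp⟩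
        · exact absurd (by simpa using ht) haX
    obtain ⟨t, ht, htT⟩ := ((Set.Ioo_infinite hε).sdiff hfin).nonempty
    refine ⟨t, ht.1, hball ?_, htT⟩
    rw [Metric.mem_ball, Real.dist_eq, sub_zero, abs_of_pos ht.1]
    exact ht.2
  obtain ⟨N₁, N₂, hN, hz₁⟩ : ∃ N₁ N₂, IsGate (curveSet Q) (skeleton Q X) N N₁ N₂ ∧
      a + (t : ℂ) * Complex.I ∈ N₁ := by
    have : a + (t : ℂ) * Complex.I ∈ N \ skeleton Q X := ⟨htN, htT⟩
    rw [hM.sdiff_eq] at this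
    rcases this with h | h
    · exact ⟨M₁, M₂, hM, h⟩
    · exact ⟨M₂, M₁, hM.symm, h⟩
  have hN₁ : N₁ ⊆ N \ skeleton Q X := hN.sdiff_eq ▸ Set.subset_union_left
  have hN₂ : N₂ ⊆ N \ skeleton Q X := hN.sdiff_eq ▸ Set.subset_union_right
  have hzC := hray t ht0
  have hN₁C : N₁ ⊆ unboundedComponent Ω := by
    rcases hN.isPreconnected_left.subset_or_subset_compl_closure hΩ
      (Set.disjoint_left.2 fun z hz hz' => (hN₁ hz).2 (hfr hz')) with h | h
    · exact absurd (subset_closure (h hz₁)) hzC.1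
    · exact (hN.isPreconnected_left.subset_connectedComponentIn hz₁ h).trans
        (connectedComponentIn_subset_unboundedComponent hzC)
  refine ⟨N, N₁, N₂, haN, hNV, hN, hN₁C, ?_⟩
  obtain ⟨z, hz, hzT⟩ := D.exists_mem_notMem_skeleton (hN.isOpen.inter hΩ)
    (mem_closure_iff.1 ha.1 N hN.isOpen haN)
  have hz' : z ∈ N \ skeleton Q X := ⟨hz.1, hzT⟩
  rw [hN.sdiff_eq] at hz'
  rcases hz' with h | h
  · exact absurd (subset_closure hz.2) (hN₁C h).1
  · rcases hN.isPreconnected_right.subset_or_subset_compl_closure hΩ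
      (Set.disjoint_left.2 fun z hz hz' => (hN₂ hz).2 (hfr hz')) with h' | h'
    · exact h'
    · exact absurd (subset_closure hz.2) (h' h)

/-- Near a point of the curve, a branch of `P` agrees with `conj z` on the curve. -/
theorem exists_schwarz (D : IsCurveData Q P X B) {a : ℂ} (ha : a ∈ curveSet Q) (haX : a.re ∉ X) :
    ∃ s : ℂ → ℂ, ∃ V ∈ 𝓝 a, AnalyticOnNhd ℂ s V ∧ ∀ z ∈ V, z.re ∉ X ∧ P z (s z) ∧
      (z ∈ curveSet Q → s z = conj z) := by
  obtain ⟨s, hs, -, hsP, hsu⟩ := (D.branched_P a fun h => haX (D.re_mem a h)).exists_branch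
    (D.schwarz a haX ha)
  have h1 : ∀ᶠ z : ℂ in 𝓝 a, z.re ∉ X := Complex.continuous_re.continuousAt.eventually
    (D.finite_X.isClosed.isOpen_compl.mem_nhds haX)
  have h2 : Tendsto (fun z : ℂ => (z, conj z)) (𝓝 a) (𝓝 (a, conj a)) :=
    (continuous_id.prodMk Complex.continuous_conj).continuousAt
  have h3 := h2.eventually hsu
  refine ⟨s, _, hs.eventually_analyticAt.and (h1.and (hsP.and h3)), fun z hz => hz.1,
    fun z hz => ⟨hz.2.1, hz.2.2.1, fun hzQ => ?_⟩⟩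
  exact (hz.2.2.2 (D.schwarz z hz.2.1 hzQ)).symm

/-- The initial domain is `C`, one gate at a boundary point, and the component of `Ω \ T` behind it.
The sides of the gate lie in `C` and in `Ω`, so its wall lies in `∂C` and consists of regular
points; there `S` is the branch of `P` equal to `conj z` on the curve. -/
theorem exists_partialCutDomain (D : IsCurveData Q P X B) (hΩ : IsOpen Ω) (hne : Ω.Nonempty)
    (hbdd : Bornology.IsBounded Ω) (hfr : frontier Ω ⊆ skeleton Q X)
    (hbranch : branchSet Ω ⊆ B ∪ {b | b ∈ frontier Ω ∧ ¬ IsRegularBoundaryPoint Ω b}) :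
    ∃ O S, IsPartialCutDomain Q P X Ω O S := by
  classical
  obtain ⟨a, ha, haX, hray⟩ := D.exists_mem_frontier_ray hΩ hne hbdd
  have haQ : a ∈ curveSet Q := (hfr ha).resolve_right haX
  obtain ⟨s, V, hV, hs, hsV⟩ := D.exists_schwarz haQ haX
  obtain ⟨N, N₁, N₂, haN, hNV, hN, hN₁C, hN₂Ω⟩ := D.exists_exterior_gate hΩ hfr ha haX hray hV
  set T := skeleton Q X
  set C := unboundedComponent Ω
  have hNT : ∀ z, z ∈ N → z ∉ T → z ∈ N₁ ∨ z ∈ N₂ := fun z hz hzT => by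
    have : z ∈ N \ T := ⟨hz, hzT⟩
    rwa [hN.sdiff_eq] at this
  have hN₁ : N₁ ⊆ N \ T := hN.sdiff_eq ▸ Set.subset_union_left
  have hN₂ : N₂ ⊆ N \ T := hN.sdiff_eq ▸ Set.subset_union_right
  obtain ⟨z₁, hz₁⟩ : N₁.Nonempty :=
    closure_nonempty_iff.1 ⟨a, hN.subset_closure_left ⟨haN, hfr ha⟩⟩
  obtain ⟨z₂, hz₂⟩ : N₂.Nonempty :=
    closure_nonempty_iff.1 ⟨a, hN.subset_closure_right ⟨haN, hfr ha⟩⟩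
  have hCΩ := disjoint_unboundedComponent (Ω := Ω) hΩ
  have hCΩ' : ∀ z ∈ C, z ∉ Ω := fun z hz hz' => hz.1 (subset_closure hz')
  have hNfr : ∀ z ∈ N, z ∈ T → z ∈ frontier C := fun z hz hzT =>
    ⟨closure_mono hN₁C (hN.subset_closure_left ⟨hz, hzT⟩), fun h =>
      (interior_subset h).1 (closure_mono hN₂Ω (hN.subset_closure_right ⟨hz, hzT⟩))⟩
  have hfrT : ∀ z ∈ frontier C, z ∈ T := fun z hz =>
    hfr (frontier_unboundedComponent_subset hΩ hz)
  have hCfr : ∀ z ∈ C, z ∉ frontier C := fun z hz h =>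
    h.2 (isOpen_unboundedComponent.interior_eq.symm ▸ hz)
  have hfrΩ : ∀ z ∈ Ω, z ∉ frontier C := fun z hz h => Set.disjoint_left.1 hCΩ h.1 hz
  have hN₂Ω' : N₂ ⊆ Ω \ T := fun z hz => ⟨hN₂Ω hz, (hN₂ hz).2⟩
  set c := connectedComponentIn (Ω \ T) z₂
  have hcsub : c ⊆ Ω \ T := connectedComponentIn_subset _ _
  have hcopen : IsOpen c := (D.isOpen_sdiff_skeleton hΩ).connectedComponentIn
  have hN₂c : N₂ ⊆ c := hN.isPreconnected_right.subset_connectedComponentIn hz₂ hN₂Ω'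
  obtain ⟨σ, hσ, hσP, hσs⟩ := D.exists_extension (isPreconnected_connectedComponentIn)
    (fun z hz hzX => (hcsub hz).2 (Or.inr hzX)) hN.isPreconnected_right ⟨z₂, hz₂⟩ hN₂c
    (hs.continuousOn.mono fun z hz => hNV (hN₂ hz).1) (fun z hz => (hsV z (hNV (hN₂ hz).1)).2.1)
  set S : ℂ → ℂ := fun z => if z ∈ c then σ z else s z
  have hSc : Set.EqOn S σ c := fun z hz => by simp [S, hz]
  have hSN : Set.EqOn S s N := fun z hz => by
    by_cases hzc : z ∈ c
    · rcases hNT z hz (hcsub hzc).2 with h | h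
      · exact absurd (hcsub hzc).1 (hCΩ' z (hN₁C h))
      · rw [hSc hzc, hσs h]
    · simp [S, hzc]
  refine ⟨C ∪ N ∪ c, S, ?_⟩
  constructor
  · exact (isOpen_unboundedComponent.union hN.isOpen).union hcopen
  · refine IsConnected.union ⟨z₂, Or.inr (hN₂ hz₂).1, hN₂c hz₂⟩ ?_
      ⟨⟨z₂, hN₂c hz₂⟩, isPreconnected_connectedComponentIn⟩
    exact IsConnected.union ⟨z₁, hN₁C hz₁, (hN₁ hz₁).1⟩ (isConnected_unboundedComponent hbdd)
      ⟨⟨z₁, (hN₁ hz₁).1⟩, hN.convex.isPreconnected⟩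
  · exact fun z hz => Or.inl (Or.inl hz)
  · exact ⟨z₂, Or.inr (hN₂c hz₂), hN₂Ω hz₂⟩
  · rintro z ((hz | hz) | hz)
    · exact Or.inl (subset_closure hz)
    · by_cases hzT : z ∈ T
      · exact Or.inl (hNfr z hz hzT).1
      · rcases hNT z hz hzT with h | h
        · exact Or.inl (subset_closure (hN₁C h))
        · exact Or.inr (hN₂Ω h)
    · exact Or.inr (hcsub hz).1
  · have h3 := hN.isArcUnion_sdiff _ (D.isArcUnion_skeleton_inter_closure hΩ hbdd hfr)
    convert h3 using 1
    ext z
    constructor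
    · rintro ⟨hz, hz'⟩
      exact ⟨hz, fun h => hz' (Or.inl (Or.inr h))⟩
    · rintro ⟨hz, hzN⟩
      refine ⟨hz, ?_⟩
      rintro ((h | h) | h)
      · exact h.1 hz.2
      · exact hzN h
      · exact (hcsub h).2 hz.1
  · rintro z hz hzΩ
    have h : z ∈ c := by
      rcases hz with (hz | hz) | hz
      · exact absurd hzΩ.1 (hCΩ' z hz)
      · rcases hNT z hz hzΩ.2 with h | h
        · exact absurd hzΩ.1 (hCΩ' z (hN₁C h))
        · exact hN₂c h
      · exact hz
    rw [← connectedComponentIn_eq h]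
    exact Set.subset_union_right
  · rintro z ((hz | hz) | hz) hz'
    · exact absurd hz' (by rintro (h | h); exacts [hCΩ' z hz h, hCfr z hz h])
    · exact (hs z (hNV hz)).congr (hSN.symm.eventuallyEq_of_mem (hN.isOpen.mem_nhds hz))
    · exact (hσ z hz).congr (hSc.symm.eventuallyEq_of_mem (hcopen.mem_nhds hz))
  · rintro z ((hz | hz) | hz) hz'
    · exact absurd hz' (hCΩ' z hz)
    · rw [hSN hz]
      exact (hsV z (hNV hz)).2.1
    · rw [hSc hz]
      exact hσP z hz
  · rintro z ((hz | hz) | hz) hz'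
    · exact absurd hz' (hCfr z hz)
    · rw [hSN hz]
      exact (hsV z (hNV hz)).2.2 ((hfrT z hz').resolve_right (hsV z (hNV hz)).1)
    · exact absurd hz' (hfrΩ z (hcsub hz).1)
  · rw [Set.disjoint_left]
    rintro z ((hz | hz) | hz) hz'
    · exact hz.1 (by rcases hz' with h | h; exacts [h.1, h.1.1])
    · rcases hbranch hz' with h | ⟨h, h'⟩
      · exact (hsV z (hNV hz)).1 (D.re_mem z h)
      · refine h' (D.isRegularBoundaryPoint ((hfr h).resolve_right (hsV z (hNV hz)).1)
          (hsV z (hNV hz)).1 ?_)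
        filter_upwards [hN.isOpen.mem_nhds hz] with w hw
        exact ⟨fun h => (hfr h).resolve_right (hsV w (hNV hw)).1, fun h =>
          frontier_unboundedComponent_subset hΩ (hNfr w hw (Or.inl h))⟩
    · rcases hbranch hz' with h | ⟨h, h'⟩
      · exact (hcsub hz).2 (D.subset_skeleton h)
      · exact (hcsub hz).2 (hfr h)

end IsCurveData

/-! ### Reaching all of `Ω` off the skeleton -/

namespace IsCurveData

variable {Q P : ℂ → ℂ → Prop} {X : Set ℝ} {B : Set ℂ} {Ω : Set ℂ}

/-- The skeleton has empty interior, so the closures of `W` and `W'` cover `U`, and connectedness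
makes them meet in `U`. -/
theorem exists_mem_closure_inter (D : IsCurveData Q P X B) {U W W' : Set ℂ} (hU : IsOpen U)
    (hUc : IsPreconnected U) (hcov : ∀ z ∈ U, z ∉ skeleton Q X → z ∈ W ∨ z ∈ W')
    (hW : (U ∩ W).Nonempty) (hW' : (U ∩ W').Nonempty) :
    ∃ q ∈ U, q ∈ closure W ∧ q ∈ closure W' := by
  refine isPreconnected_closed_iff.1 hUc _ _ isClosed_closure isClosed_closure (fun z hz => ?_)
    (hW.mono (Set.inter_subset_inter_right _ subset_closure))
    (hW'.mono (Set.inter_subset_inter_right _ subset_closure))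
  rw [← closure_union, mem_closure_iff]
  intro G hG hzG
  obtain ⟨w, hw, hwT⟩ := D.exists_mem_notMem_skeleton (hG.inter hU) ⟨z, hzG, hz⟩
  exact ⟨w, hw.1, hcov w hw.2 hwT⟩

/-- As long as part of `Ω` is not reached, there is a gate to it. -/
theorem exists_interior_gate (D : IsCurveData Q P X B) (hΩ : IsOpen Ω) (hconn : IsConnected Ω)
    {O : Set ℂ} {S : ℂ → ℂ} (hO : IsPartialCutDomain Q P X Ω O S)
    (hnot : ¬ Ω \ skeleton Q X ⊆ O) :
    ∃ N N₁ N₂, IsGate (curveSet Q) (skeleton Q X) N N₁ N₂ ∧ N ⊆ Ω ∧ Disjoint N B ∧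
      (N ∩ skeleton Q X).Nonempty ∧ N₁ ⊆ O ∧ Disjoint N₂ O := by
  set T := skeleton Q X
  have hΩT : IsOpen (Ω \ T) := D.isOpen_sdiff_skeleton hΩ
  set W := O ∩ (Ω \ T)
  set W' := (Ω \ T) \ O
  have hWo : IsOpen W := hO.isOpen.inter hΩT
  have hW'o : IsOpen W' := by
    refine isOpen_iff_mem_nhds.2 fun z hz => mem_of_superset
      (hΩT.connectedComponentIn.mem_nhds (mem_connectedComponentIn hz.1)) fun w hw => ?_
    have hw' := connectedComponentIn_subset _ _ hw
    refine ⟨hw', fun hwO => hz.2 (hO.component_subset w hwO hw' ?_)⟩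
    rw [← connectedComponentIn_eq hw]
    exact mem_connectedComponentIn hz.1
  have hWne : W.Nonempty := by
    obtain ⟨z, hz, hzT⟩ := D.exists_mem_notMem_skeleton (hO.isOpen.inter hΩ) hO.inter_nonempty
    exact ⟨z, hz.1, hz.2, hzT⟩
  have hW'ne : W'.Nonempty := by
    obtain ⟨z, hz, hz'⟩ := Set.not_subset.1 hnot
    exact ⟨z, hz, hz'⟩
  have hcov : ∀ z ∈ Ω, z ∉ T → z ∈ W ∨ z ∈ W' := fun z hz hzT => by
    by_cases hzO : z ∈ O
    · exact Or.inl ⟨hzO, hz, hzT⟩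
    · exact Or.inr ⟨⟨hz, hzT⟩, hzO⟩
  have hdisj : Disjoint W W' := Set.disjoint_left.2 fun z hz hz' => hz'.2 hz.1
  have hT : ∀ q ∈ Ω, q ∈ closure W → q ∈ closure W' → q ∈ T := fun q hq h1 h2 => by
    by_contra hqT
    rcases hcov q hq hqT with h | h
    · exact Set.disjoint_left.1 (hdisj.closure_right hWo) h h2
    · exact Set.disjoint_left.1 (hdisj.closure_left hW'o) h1 h
  obtain ⟨q, hq, hqW, hqW'⟩ := D.exists_mem_closure_inter hΩ hconn.isPreconnected hcov
    (hWne.mono fun z hz => ⟨hz.2.1, hz⟩) (hW'ne.mono fun z hz => ⟨hz.1.1, hz⟩)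
  have hqT := hT q hq hqW hqW'
  set F : Set ℂ := {z | z ∈ curveSet Q ∧ z.re ∈ X} ∪ B
  have hF : F.Finite := by
    refine Set.Finite.union ((D.finite_X.biUnion fun x _ => D.finite_fiber x).subset ?_) D.finite_B
    rintro z ⟨hz, hzX⟩
    exact Set.mem_biUnion hzX ⟨hz, rfl⟩
  obtain ⟨r, hr, hball⟩ := Metric.mem_nhds_iff.1 (inter_mem (hΩ.mem_nhds hq)
    ((hF.subset (Set.sdiff_subset (t := {q}))).isClosed.isOpen_compl.mem_nhds
      (show q ∉ F \ {q} from fun h => h.2 rfl)))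
  -- The contact point `q` may be exceptional. A punctured disc about it is still connected and free
  -- of exceptional points, so the same argument there gives a contact point `p` where a gate
  -- exists.
  set U : Set ℂ := {z | ‖z - q‖ ∈ Set.Ioo 0 r}
  have hUo : IsOpen U := isOpen_Ioo.preimage (by fun_prop : Continuous fun z : ℂ => ‖z - q‖)
  have hUball : U ⊆ Metric.ball q r := fun z hz => by
    rw [Metric.mem_ball, dist_eq_norm]
    exact hz.2
  have hmeet : ∀ {M : Set ℂ}, Disjoint M T → q ∈ closure M → (U ∩ M).Nonempty := by
    intro M hM hqM
    obtain ⟨z, hz, hzM⟩ := mem_closure_iff.1 hqM _ Metric.isOpen_ball (Metric.mem_ball_self hr)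
    refine ⟨z, ⟨norm_pos_iff.2 (sub_ne_zero.2 ?_), by rwa [Metric.mem_ball, dist_eq_norm] at hz⟩,
      hzM⟩
    rintro rfl
    exact Set.disjoint_left.1 hM hzM hqT
  obtain ⟨p, hpU, hpW, hpW'⟩ := D.exists_mem_closure_inter hUo
    (isPreconnected_norm_sub_mem q isPreconnected_Ioo fun x hx => hx.1)
    (fun z hz => hcov z (hball (hUball hz)).1)
    (hmeet (Set.disjoint_left.2 fun z hz => hz.2.2) hqW)
    (hmeet (Set.disjoint_left.2 fun z hz => hz.1.2) hqW')
  have hpΩ : p ∈ Ω := (hball (hUball hpU)).1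
  have hpT := hT p hpΩ hpW hpW'
  have hpF : p ∉ F := fun h => (hball (hUball hpU)).2 ⟨h, fun hpq => by
    have h1 : 0 < ‖p - q‖ := hpU.1
    rw [Set.mem_singleton_iff.1 hpq, sub_self, norm_zero] at h1
    exact lt_irrefl _ h1⟩
  obtain ⟨N, M₁, M₂, hpN, hNV, hM⟩ := D.exists_gate hpT (fun h => hpF (Or.inl h))
    (inter_mem (hΩ.mem_nhds hpΩ) (D.finite_B.isClosed.isOpen_compl.mem_nhds
      (show p ∉ B from fun h => hpF (Or.inr h))))
  obtain ⟨z, hzN, hzW⟩ := mem_closure_iff.1 hpW N hM.isOpen hpN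
  obtain ⟨z', hzN', hzW'⟩ := mem_closure_iff.1 hpW' N hM.isOpen hpN
  obtain ⟨N₁, N₂, hN, hz₁⟩ : ∃ N₁ N₂, IsGate (curveSet Q) T N N₁ N₂ ∧ z ∈ N₁ := by
    have : z ∈ N \ T := ⟨hzN, hzW.2.2⟩
    rw [hM.sdiff_eq] at this
    rcases this with h | h
    · exact ⟨M₁, M₂, hM, h⟩
    · exact ⟨M₂, M₁, hM.symm, h⟩
  have hN₁ : N₁ ⊆ Ω \ T := fun w hw => by
    have : w ∈ N \ T := hN.sdiff_eq ▸ Or.inl hw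
    exact ⟨(hNV this.1).1, this.2⟩
  have hN₂ : N₂ ⊆ Ω \ T := fun w hw => by
    have : w ∈ N \ T := hN.sdiff_eq ▸ Or.inr hw
    exact ⟨(hNV this.1).1, this.2⟩
  have hN₁O : N₁ ⊆ O := (hN.isPreconnected_left.subset_connectedComponentIn hz₁ hN₁).trans
    (hO.component_subset z hzW.1 hzW.2)
  have hz₂ : z' ∈ N₂ := by
    have : z' ∈ N \ T := ⟨hzN', hzW'.1.2⟩
    rw [hN.sdiff_eq] at this
    exact this.resolve_left fun h => hzW'.2 (hN₁O h)
  refine ⟨N, N₁, N₂, hN, fun w hw => (hNV hw).1,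
    Set.disjoint_left.2 fun w hw hwB => (hNV hw).2 hwB, ⟨p, hpN, hpT⟩, hN₁O,
    Set.disjoint_left.2 fun w hw hwO => hzW'.2 ?_⟩
  exact hO.component_subset w hwO (hN₂ hw)
    (hN.isPreconnected_right.subset_connectedComponentIn hw hN₂ hz₂)

/-- Opening gates one after the other, everything off the skeleton is reached. -/
theorem exists_complete_partialCutDomain (D : IsCurveData Q P X B) (hΩ : IsOpen Ω)
    (hconn : IsConnected Ω) (hbdd : Bornology.IsBounded Ω) (hfr : frontier Ω ⊆ skeleton Q X)
    (hbranch : branchSet Ω ⊆ B ∪ {b | b ∈ frontier Ω ∧ ¬ IsRegularBoundaryPoint Ω b}) :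
    ∃ O S, IsPartialCutDomain Q P X Ω O S ∧ Ω \ skeleton Q X ⊆ O := by
  obtain ⟨r, hr⟩ := hbdd.subset_closedBall 0
  obtain ⟨𝒟, h𝒟, hcell, hcov⟩ := D.exists_finite_cells
    (show -(|r| + 1) < |r| + 1 by linarith [abs_nonneg r])
  have hcovΩ : ∀ z ∈ Ω \ skeleton Q X, ∃ d ∈ 𝒟, z ∈ d := fun z hz => by
    refine hcov z ?_ hz.2
    rw [Set.mem_Ioo, ← abs_lt]
    have h1 := (Complex.abs_re_le_norm z).trans (mem_closedBall_zero_iff.1 (hr hz.1))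
    linarith [le_abs_self r]
  -- Induction on the number of cells whose part in `Ω` is not yet contained in `O`; each new gate
  -- absorbs at least one.
  suffices ∀ (n : ℕ) (O : Set ℂ) (S : ℂ → ℂ), IsPartialCutDomain Q P X Ω O S →
      {d ∈ 𝒟 | ¬ d ∩ Ω ⊆ O}.ncard ≤ n →
      ∃ O S, IsPartialCutDomain Q P X Ω O S ∧ Ω \ skeleton Q X ⊆ O by
    obtain ⟨O, S, hO⟩ := D.exists_partialCutDomain hΩ hconn.nonempty hbdd hfr hbranch
    exact this _ O S hO le_rfl
  intro n
  induction n with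
  | zero =>
    intro O S hO hn
    refine ⟨O, S, hO, fun z hz => ?_⟩
    obtain ⟨d, hd, hzd⟩ := hcovΩ z hz
    have h1 : {d ∈ 𝒟 | ¬ d ∩ Ω ⊆ O} = ∅ :=
      (Set.ncard_eq_zero (h𝒟.subset (Set.sep_subset _ _))).1 (Nat.le_zero.1 hn)
    by_contra hzO
    exact Set.eq_empty_iff_forall_notMem.1 h1 d ⟨hd, fun h => hzO (h ⟨hzd, hz.1⟩)⟩
  | succ n ih =>
    intro O S hO hn
    by_cases hnot : Ω \ skeleton Q X ⊆ O
    · exact ⟨O, S, hO, hnot⟩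
    obtain ⟨N, N₁, N₂, hN, hNΩ, hNB, hne, h1, h2⟩ := D.exists_interior_gate hΩ hconn hO hnot
    obtain ⟨O', S', hO', hOO', z, hz, hzO'⟩ := D.exists_partialCutDomain_insert hΩ
      (hbranch.trans (Set.union_subset_union_right _ fun _ h => h.1)) hO hN hNΩ hNB hne h1 h2
    have hzT : z ∈ Ω \ skeleton Q X := by
      have : z ∈ N \ skeleton Q X := hN.sdiff_eq ▸ Or.inr hz
      exact ⟨hNΩ this.1, this.2⟩
    obtain ⟨d, hd, hzd⟩ := hcovΩ z hzT
    have hdT : ∀ w ∈ d, w ∉ skeleton Q X := fun w hw => Set.disjoint_left.1 (hcell d hd).2 hw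
    have hdΩ : d ⊆ Ω := by
      rcases (hcell d hd).1.subset_or_subset_compl_closure hΩ
        ((hcell d hd).2.mono_right hfr) with h | h
      · exact h
      · exact absurd (subset_closure hzT.1) (h hzd)
    have hdΩT : d ⊆ Ω \ skeleton Q X := fun w hw => ⟨hdΩ hw, hdT w hw⟩
    have hdO' : d ⊆ O' :=
      ((hcell d hd).1.subset_connectedComponentIn hzd hdΩT).trans hzO'
    refine ih O' S' hO' (Nat.lt_succ_iff.1 (lt_of_lt_of_le ?_ hn))
    have hfin : {d ∈ 𝒟 | ¬ d ∩ Ω ⊆ O}.Finite := h𝒟.subset (Set.sep_subset _ _)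
    have hdmem : d ∈ {d ∈ 𝒟 | ¬ d ∩ Ω ⊆ O} :=
      ⟨hd, fun h => Set.disjoint_left.1 h2 hz (h ⟨hzd, hzT.1⟩)⟩
    refine Set.ncard_lt_ncard ((Set.ssubset_iff_of_subset ?_).2 ⟨d, hdmem, fun h => ?_⟩) hfin
    · exact fun e he => ⟨he.1, fun h => he.2 (h.trans hOO')⟩
    · exact h.2 (Set.inter_subset_left.trans hdO')

/-- `E` is the part of `T ∩ closure Ω` not reopened. All of `Ω \ T` is reached and `∂C ⊆ T`, so the
cut domain of `E` is exactly `O`. -/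
theorem exists_isCutSystem (D : IsCurveData Q P X B) (hΩ : IsOpen Ω)
    (hconn : IsConnected Ω) (hbdd : Bornology.IsBounded Ω) (hfr : frontier Ω ⊆ skeleton Q X)
    (hbranch : branchSet Ω ⊆ B ∪ {b | b ∈ frontier Ω ∧ ¬ IsRegularBoundaryPoint Ω b}) :
    ∃ E, IsCutSystem Ω E ∧ branchSet Ω ⊆ E := by
  obtain ⟨O, S, hO, hcov⟩ := D.exists_complete_partialCutDomain hΩ hconn hbdd hfr hbranch
  set T := skeleton Q X
  set E := (T ∩ closure Ω) \ O
  have hfrC := frontier_unboundedComponent_subset (Ω := Ω) hΩ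
  have hmem : ∀ z, z ∈ Ω ∪ frontier (unboundedComponent Ω) → z ∉ E → z ∈ O := by
    intro z hz hzE
    by_contra hzO
    rcases hz with hz | hz
    · exact hzO (hcov ⟨hz, fun h => hzE ⟨⟨h, subset_closure hz⟩, hzO⟩⟩)
    · exact hzE ⟨⟨hfr (hfrC hz), (hfrC hz).1⟩, hzO⟩
  have hcut : cutDomain Ω E = O := by
    ext z
    constructor
    · rintro ⟨hz | hz, hzE⟩
      · by_cases hzC : z ∈ unboundedComponent Ω
        · exact hO.unboundedComponent_subset hzC
        · exact hmem z (Or.inr ⟨hz, fun h => hzC (interior_subset h)⟩) hzE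
      · exact hmem z (Or.inl hz) hzE
    · exact fun hz => ⟨hO.subset_union hz, fun h => h.2 hz⟩
  refine ⟨E, ⟨hO.isArcUnion.exists_curves, ?_, fun z hz => hz.1.2, ?_, ?_, S, ?_, ?_⟩, ?_⟩
  · by_contra hne
    obtain ⟨z, hz, hzT⟩ := D.exists_mem_notMem_skeleton isOpen_interior
      (Set.nonempty_iff_ne_empty.2 hne)
    exact hzT (interior_subset hz).1.1
  · rw [hcut]
    exact hO.isOpen
  · rw [hcut]
    exact hO.isConnected
  · exact fun z hz => hO.analyticAt z (hmem z hz.1 hz.2) hz.1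
  · exact fun z hz => hO.eq_conj z (hmem z (Or.inr hz.1) hz.2) hz.1
  · intro z hz
    refine ⟨⟨?_, ?_⟩, fun h => Set.disjoint_left.1 hO.disjoint_branchSet h hz⟩
    · rcases hbranch hz with h | h
      · exact D.subset_skeleton h
      · exact hfr h.1
    · rcases hz with h | h
      exacts [h.1, h.1.1]

end IsCurveData

theorem HasRealAlgebraicBoundary.exists_isCutSystem {Ω : Set ℂ} (hΩ : IsOpen Ω)
    (hconn : IsConnected Ω) (hbdd : Bornology.IsBounded Ω) (halg : HasRealAlgebraicBoundary Ω) :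
    ∃ E, IsCutSystem Ω E ∧ branchSet Ω ⊆ E := by
  obtain ⟨Q, P, X, B, D, hP, hQ⟩ := halg.exists_isCurveData
  refine D.exists_isCutSystem hΩ hconn hbdd (fun z hz => ?_) ?_
  · by_cases hzX : z.re ∈ X
    · exact Or.inr hzX
    · exact Or.inl (hQ z hz hzX)
  · rintro b (⟨-, a, S, hS, hb⟩ | hb)
    · exact Or.inl (mem_of_isSingularPointOf D.branched_P hP hS hb)
    · exact Or.inr hb

/-! ### The boundary is a null set -/

namespace IsCurveData

variable {Q P : ℂ → ℂ → Prop} {X : Set ℝ} {B : Set ℂ}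

/-- Fubini: all vertical sections except those over `X` are finite. -/
theorem volume_skeleton (D : IsCurveData Q P X B) : volume (skeleton Q X) = 0 := by
  have h := (Complex.volume_preserving_equiv_real_prod.symm).measure_preimage
    (D.isClosed_skeleton.measurableSet.nullMeasurableSet)
  rw [← h, Measure.volume_eq_prod, Measure.measure_prod_null
    (D.isClosed_skeleton.measurableSet.preimage (MeasurableEquiv.measurable _))]
  have hX : ∀ᵐ x : ℝ, x ∉ X := measure_eq_zero_iff_ae_notMem.1 (D.finite_X.measure_zero volume)
  filter_upwards [hX] with x hx
  refine Set.Finite.measure_zero ((D.finite_Q x).subset fun y hy => ?_) volume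
  have hy' : (⟨x, y⟩ : ℂ) ∈ skeleton Q X := hy
  exact hy'.resolve_right hx

end IsCurveData

theorem HasRealAlgebraicBoundary.volume_frontier {Ω : Set ℂ} (h : HasRealAlgebraicBoundary Ω) :
    volume (frontier Ω) = 0 := by
  obtain ⟨Q, P, X, B, D, -, hQ⟩ := h.exists_isCurveData
  refine measure_mono_null (fun z hz => ?_) D.volume_skeleton
  by_cases hzX : z.re ∈ X
  · exact Or.inr hzX
  · exact Or.inl (hQ z hz hzX)

/-! ### Lipschitz extension by zero and integration of derivatives -/

section Lipschitz

variable {E F : Type*} [NormedAddCommGroup E] [NormedSpace ℝ E] [NormedAddCommGroup F]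

/-- Extension by zero of a Lipschitz function that vanishes on the boundary. -/
theorem LipschitzOnWith.indicator_of_frontier {U Ω : Set E} {h : E → F} {L : NNReal}
    (hU : Convex ℝ U) (hΩ : IsOpen Ω) (hh : LipschitzOnWith L h (U ∩ closure Ω))
    (h0 : ∀ z ∈ U ∩ frontier Ω, h z = 0) : LipschitzOnWith L (Ω.indicator h) U := by
  have key : ∀ x ∈ U, ∀ y ∈ U, x ∈ Ω → y ∉ Ω → ‖h x‖ ≤ L * dist x y := by
    intro x hx y hy hxΩ hyΩ
    obtain ⟨w, hw, hwf⟩ : ∃ w ∈ segment ℝ x y, w ∈ frontier Ω := by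
      by_contra! hcon
      rcases (convex_segment x y).isPreconnected.subset_or_subset_compl_closure hΩ
        (Set.disjoint_left.2 hcon) with h' | h'
      · exact hyΩ (h' (right_mem_segment ℝ x y))
      · exact h' (left_mem_segment ℝ x y) (subset_closure hxΩ)
    have hwU := hU.segment_subset hx hy hw
    have h1 := hh.dist_le_mul x ⟨hx, subset_closure hxΩ⟩ w ⟨hwU, hwf.1⟩
    rw [h0 w ⟨hwU, hwf⟩, dist_zero_right] at h1
    refine h1.trans (mul_le_mul_of_nonneg_left ?_ L.2)
    have := dist_add_dist_of_mem_segment hw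
    linarith [dist_nonneg (x := w) (y := y)]
  refine LipschitzOnWith.of_dist_le_mul fun x hx y hy => ?_
  by_cases hxΩ : x ∈ Ω <;> by_cases hyΩ : y ∈ Ω
  · rw [Set.indicator_of_mem hxΩ, Set.indicator_of_mem hyΩ]
    exact hh.dist_le_mul x ⟨hx, subset_closure hxΩ⟩ y ⟨hy, subset_closure hyΩ⟩
  · rw [Set.indicator_of_mem hxΩ, Set.indicator_of_notMem hyΩ, dist_zero_right]
    exact key x hx y hy hxΩ hyΩ
  · rw [Set.indicator_of_notMem hxΩ, Set.indicator_of_mem hyΩ, dist_zero_left, dist_comm]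
    exact key y hy x hx hyΩ hxΩ
  · rw [Set.indicator_of_notMem hxΩ, Set.indicator_of_notMem hyΩ, dist_self]
    positivity

theorem LocallyLipschitz.exists_lipschitzWith_of_bounded_support [ProperSpace E] {H : E → F}
    (hH : LocallyLipschitz H) (hb : Bornology.IsBounded (Function.support H)) :
    ∃ L, LipschitzWith L H := by
  obtain ⟨r, hr⟩ := hb.subset_ball 0
  obtain ⟨L, hL⟩ := (hH.locallyLipschitzOn (s := Metric.closedBall 0 r)).exists_lipschitzOnWith_of_compact
    (isCompact_closedBall 0 r)
  have h0 : ∀ z ∉ Metric.ball (0 : E) r, H z = 0 := fun z hz => by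
    by_contra h
    exact hz (hr h)
  refine ⟨L, ?_⟩
  have h1 := LipschitzOnWith.indicator_of_frontier (U := Set.univ) (Ω := Metric.ball 0 r)
    convex_univ Metric.isOpen_ball
    (hL.mono (Set.inter_subset_right.trans Metric.closure_ball_subset_closedBall))
    fun z hz => h0 z fun h => hz.2.2 (by rwa [Metric.isOpen_ball.interior_eq])
  rw [lipschitzOnWith_univ] at h1
  convert h1 using 1
  ext z
  by_cases hz : z ∈ Metric.ball (0 : E) r
  · rw [Set.indicator_of_mem hz]
  · rw [Set.indicator_of_notMem hz, h0 z hz]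

/-- The integral of a derivative of a compactly supported Lipschitz function vanishes. -/
theorem LipschitzWith.integral_fderiv_apply_eq_zero {H : ℂ → ℂ} {L : NNReal}
    (hH : LipschitzWith L H) (hb : HasCompactSupport H) (v : ℂ) :
    Integrable (fun z => fderiv ℝ H z v) ∧ ∫ z, fderiv ℝ H z v = 0 := by
  have hintg : Integrable (fun z => fderiv ℝ H z v) := by
    have hsupp : Function.support (fun z => fderiv ℝ H z v) ⊆ tsupport H := fun z hz =>
      support_fderiv_subset ℝ fun h => hz (by simp [h])
    rw [← integrableOn_iff_integrable_of_support_subset hsupp]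
    refine Measure.integrableOn_of_bounded (M := L * ‖v‖) hb.measure_lt_top.ne
      (measurable_fderiv_apply_const ℝ H v).aestronglyMeasurable (ae_of_all _ fun z => ?_)
    exact (ContinuousLinearMap.le_opNorm _ _).trans
      (mul_le_mul_of_nonneg_right (norm_fderiv_le_of_lipschitz ℝ hH) (norm_nonneg v))
  refine ⟨hintg, ?_⟩
  have key : ∀ ℓ : ℂ →L[ℝ] ℝ, ℓ (∫ z, fderiv ℝ H z v) = 0 := fun ℓ => by
    rw [← ℓ.integral_comp_comm hintg]
    have hℓ : LipschitzWith (‖ℓ‖₊ * L) (ℓ ∘ H) := ℓ.lipschitz.comp hH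
    -- Integration by parts against the constant `1`; Rademacher's theorem then identifies line
    -- derivatives with `fderiv` almost everywhere.
    have h1 := (LipschitzWith.const (1 : ℝ)).integral_lineDeriv_mul_eq (μ := (volume : Measure ℂ))
      hℓ (hb.comp_left ℓ.map_zero) (-v)
    have h2 : ∀ x : ℂ, lineDeriv ℝ (fun _ : ℂ => (1 : ℝ)) x (-v) = 0 := fun x => by
      simp [lineDeriv]
    simp only [h2, zero_mul, integral_zero, neg_neg, mul_one] at h1
    rw [h1]
    refine integral_congr_ae ?_
    filter_upwards [hH.ae_differentiableAt (μ := (volume : Measure ℂ))] with z hz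
    rw [(ℓ.differentiableAt.comp z hz).lineDeriv_eq_fderiv,
      (ℓ.hasFDerivAt.comp z hz.hasFDerivAt).fderiv]
    rfl
  exact Complex.ext (key Complex.reCLM) (key Complex.imCLM)

end Lipschitz

/-! ### The operator `∂/∂z̄` -/

/-- The Cauchy–Riemann operator `∂/∂z̄`. -/
noncomputable def dbar (g : ℂ → ℂ) (z : ℂ) : ℂ :=
  (fderiv ℝ g z 1 + Complex.I * fderiv ℝ g z Complex.I) / 2

section Dbar

variable {f g : ℂ → ℂ} {z : ℂ}

theorem Filter.EventuallyEq.dbar_eq (h : f =ᶠ[𝓝 z] g) : dbar f z = dbar g z := by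
  simp only [dbar, h.fderiv_eq]

theorem dbar_mul (hf : DifferentiableAt ℝ f z) (hg : DifferentiableAt ℝ g z) :
    dbar (fun z => f z * g z) z = f z * dbar g z + dbar f z * g z := by
  simp only [dbar, fderiv_fun_mul hf hg, add_apply,
    smul_apply, smul_eq_mul]
  ring

theorem dbar_sub (hf : DifferentiableAt ℝ f z) (hg : DifferentiableAt ℝ g z) :
    dbar (fun z => f z - g z) z = dbar f z - dbar g z := by
  simp only [dbar, fderiv_fun_sub hf hg, sub_apply]
  ring

theorem dbar_add (hf : DifferentiableAt ℝ f z) (hg : DifferentiableAt ℝ g z) :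
    dbar (f + g) z = dbar f z + dbar g z := by
  simp only [dbar, fderiv_add hf hg, add_apply]
  ring

theorem dbar_const_smul (hf : DifferentiableAt ℝ f z) (c : ℂ) :
    dbar (c • f) z = c * dbar f z := by
  simp only [dbar, fderiv_const_smul hf, smul_apply, smul_eq_mul]
  ring

theorem AnalyticAt.dbar_eq_zero (hf : AnalyticAt ℂ f z) : dbar f z = 0 := by
  have h := hf.differentiableAt.hasDerivAt.complexToReal_fderiv.fderiv
  simp only [dbar, h, smul_apply, one_apply_eq_self, smul_eq_mul]
  linear_combination (deriv f z / 2) * Complex.I_mul_I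

theorem dbar_conj : dbar (fun z => conj z) z = 1 := by
  have h : fderiv ℝ (fun z : ℂ => conj z) z = (Complex.conjCLE : ℂ →L[ℝ] ℂ) :=
    Complex.conjCLE.hasFDerivAt.fderiv
  simp [dbar, h]

theorem differentiableAt_conj : DifferentiableAt ℝ (fun z : ℂ => conj z) z :=
  Complex.conjCLE.differentiableAt

theorem ContDiff.continuous_dbar (hg : ContDiff ℝ 1 g) : Continuous (dbar g) := by
  have h := hg.continuous_fderiv one_ne_zero
  unfold dbar
  fun_prop

end Dbar

/-! ### The functional attached to a Schwarz function -/

/-- The data of the Schwarz function of `Ω` off a compact set `K`. -/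
structure IsSchwarzOff (Ω K : Set ℂ) (S : ℂ → ℂ) : Prop where
  isOpen : IsOpen Ω
  isBounded : Bornology.IsBounded Ω
  volume_frontier : volume (frontier Ω) = 0
  isCompact : IsCompact K
  analyticOnNhd : AnalyticOnNhd ℂ S (closure Ω \ K)
  eq_conj : ∀ z ∈ frontier Ω \ K, S z = conj z

/-- The integrand whose integral over `Ω` depends only on the germ of `g` along `K`. -/
noncomputable def schwarzIntegrand (S g : ℂ → ℂ) (z : ℂ) : ℂ :=
  g z + (conj z - S z) * dbar g z

namespace IsSchwarzOff

variable {Ω K : Set ℂ} {S g : ℂ → ℂ}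

/-- Near `K` the factor `g` vanishes; at boundary points off `K` the factor `conj z - S` vanishes
along `∂Ω`, so extension by zero keeps the Lipschitz bound. -/
theorem locallyLipschitz (h : IsSchwarzOff Ω K S) (hg : ContDiff ℝ 1 g) (hgK : g =ᶠ[𝓝ˢ K] 0) :
    LocallyLipschitz (Ω.indicator fun z => (conj z - S z) * g z) := by
  intro z
  have hzero : (∀ᶠ w in 𝓝 z, Ω.indicator (fun z => (conj z - S z) * g z) w = 0) →
      ∃ L, ∃ t ∈ 𝓝 z, LipschitzOnWith L (Ω.indicator fun z => (conj z - S z) * g z) t := by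
    intro h0
    refine ⟨0, _, h0, LipschitzOnWith.of_dist_le_mul fun x hx y hy => ?_⟩
    have hx' : Ω.indicator (fun z => (conj z - S z) * g z) x = 0 := hx
    have hy' : Ω.indicator (fun z => (conj z - S z) * g z) y = 0 := hy
    rw [hx', hy', dist_self]
    positivity
  by_cases hzK : z ∈ K
  · refine hzero ?_
    filter_upwards [hgK.filter_mono (nhds_le_nhdsSet hzK)] with w hw
    simp [hw]
  by_cases hzΩ : z ∈ closure Ω
  · have hS : ContDiffAt ℝ 1 S z :=
      ((h.analyticOnNhd z ⟨hzΩ, hzK⟩).contDiffAt (n := 1)).restrict_scalars ℝ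
    have hC : ContDiffAt ℝ 1 (fun z : ℂ => (conj z - S z) * g z) z :=
      ((Complex.conjCLE.contDiff.contDiffAt).sub hS).mul hg.contDiffAt
    obtain ⟨L, t, ht, hL⟩ := hC.exists_lipschitzOnWith
    obtain ⟨r, hr, hball⟩ := Metric.mem_nhds_iff.1
      (inter_mem ht (h.isCompact.isClosed.isOpen_compl.mem_nhds hzK))
    refine ⟨L, Metric.ball z r, Metric.ball_mem_nhds z hr,
      LipschitzOnWith.indicator_of_frontier (convex_ball z r) h.isOpen
        (hL.mono fun w hw => (hball hw.1).1) fun w hw => ?_⟩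
    rw [h.eq_conj w ⟨hw.2, (hball hw.1).2⟩, sub_self, zero_mul]
  · refine hzero ?_
    filter_upwards [isClosed_closure.isOpen_compl.mem_nhds hzΩ] with w hw
    exact Set.indicator_of_notMem (fun h => hw (subset_closure h)) _

/-- The product rule with `∂ conj z/∂z̄ = 1` and `∂S/∂z̄ = 0`; this is where the form of
`schwarzIntegrand` comes from. -/
theorem dbar_indicator (h : IsSchwarzOff Ω K S) (hg : ContDiff ℝ 1 g) (hgK : g =ᶠ[𝓝ˢ K] 0)
    {z : ℂ} (hz : z ∉ frontier Ω) :
    dbar (Ω.indicator fun z => (conj z - S z) * g z) z =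
      Ω.indicator (schwarzIntegrand S g) z := by
  have hdz : dbar (0 : ℂ → ℂ) z = 0 := (analyticAt_const (v := (0 : ℂ))).dbar_eq_zero
  by_cases hzΩ : z ∈ Ω
  · rw [Set.indicator_of_mem hzΩ, schwarzIntegrand]
    by_cases hzK : z ∈ K
    · have h0 := hgK.filter_mono (nhds_le_nhdsSet hzK)
      have h1 : (Ω.indicator fun z => (conj z - S z) * g z) =ᶠ[𝓝 z] 0 := by
        filter_upwards [h0] with w hw
        simp [hw]
      rw [h1.dbar_eq, h0.dbar_eq, hdz, h0.eq_of_nhds]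
      simp
    · have h1 : (Ω.indicator fun z => (conj z - S z) * g z) =ᶠ[𝓝 z]
          fun z => (conj z - S z) * g z := by
        filter_upwards [h.isOpen.mem_nhds hzΩ] with w hw
        exact Set.indicator_of_mem hw _
      have hS := h.analyticOnNhd z ⟨subset_closure hzΩ, hzK⟩
      have hS' : DifferentiableAt ℝ S z := hS.differentiableAt.restrictScalars ℝ
      rw [h1.dbar_eq, dbar_mul (differentiableAt_conj.fun_sub hS')
        (hg.contDiffAt.differentiableAt one_ne_zero), dbar_sub differentiableAt_conj hS',
        hS.dbar_eq_zero, dbar_conj]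
      ring
  · rw [Set.indicator_of_notMem hzΩ]
    have hzc : z ∉ closure Ω := fun hc => hz ⟨hc, fun hi => hzΩ (interior_subset hi)⟩
    have h1 : (Ω.indicator fun z => (conj z - S z) * g z) =ᶠ[𝓝 z] 0 := by
      filter_upwards [isClosed_closure.isOpen_compl.mem_nhds hzc] with w hw
      exact Set.indicator_of_notMem (fun h => hw (subset_closure h)) _
    rw [h1.dbar_eq, hdz]

/-- The integral depends only on the germ of `g` along `K`. -/
theorem integral_eq_zero (h : IsSchwarzOff Ω K S) (hg : ContDiff ℝ 1 g) (hgK : g =ᶠ[𝓝ˢ K] 0) :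
    ∫ z in Ω, schwarzIntegrand S g z = 0 := by
  set H := Ω.indicator fun z => (conj z - S z) * g z
  have hsupp : Function.support H ⊆ Ω := Set.support_indicator_subset
  obtain ⟨L, hL⟩ := (h.locallyLipschitz hg hgK).exists_lipschitzWith_of_bounded_support
    (h.isBounded.subset hsupp)
  have hcomp : HasCompactSupport H := h.isBounded.isCompact_closure.of_isClosed_subset
    (isClosed_tsupport H) (closure_mono hsupp)
  obtain ⟨hi1, h1⟩ := hL.integral_fderiv_apply_eq_zero hcomp 1
  obtain ⟨hi2, h2⟩ := hL.integral_fderiv_apply_eq_zero hcomp Complex.I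
  have h3 : ∫ z, dbar H z = 0 := by
    simp only [dbar]
    rw [integral_div, integral_add hi1 (hi2.const_mul _), h1, integral_const_mul, h2]
    simp
  rw [← integral_indicator h.isOpen.measurableSet, ← h3]
  refine integral_congr_ae ?_
  filter_upwards [measure_eq_zero_iff_ae_notMem.1 h.volume_frontier] with z hz
  exact (h.dbar_indicator hg hgK hz).symm

/-- `S` is uncontrolled near `K`, but it is multiplied by `dbar g`, which vanishes there; the
integrand is thus continuous on `closure Ω`. -/
theorem integrableOn (h : IsSchwarzOff Ω K S) (hg : ContDiff ℝ 1 g)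
    (hgK : ∀ᶠ z in 𝓝ˢ K, dbar g z = 0) : IntegrableOn (schwarzIntegrand S g) Ω := by
  refine (ContinuousOn.integrableOn_compact h.isBounded.isCompact_closure
    fun z hz => ContinuousAt.continuousWithinAt ?_).mono_set subset_closure
  by_cases hzK : z ∈ K
  · refine hg.continuous.continuousAt.congr ?_
    filter_upwards [hgK.filter_mono (nhds_le_nhdsSet hzK)] with w hw
    simp [schwarzIntegrand, hw]
  · exact hg.continuous.continuousAt.add ((Complex.continuous_conj.continuousAt.sub
      (h.analyticOnNhd z ⟨hz, hzK⟩).continuousAt).mul hg.continuous_dbar.continuousAt)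

end IsSchwarzOff

theorem IsCompact.exists_cutoff {K V : Set ℂ} (hK : IsCompact K) (hV : IsOpen V) (hKV : K ⊆ V) :
    ∃ ψ : ℂ → ℂ, ContDiff ℝ 1 ψ ∧ IsCompact (tsupport ψ) ∧ tsupport ψ ⊆ V ∧ ψ =ᶠ[𝓝ˢ K] 1 := by
  obtain ⟨t, ht, hKt, htV⟩ := exists_compact_between hK hV hKV
  obtain ⟨f, hf1, hf0, -⟩ := exists_contMDiffMap_one_nhds_of_subset_interior (n := 1)
    (modelWithCornersSelf ℝ ℂ) hK.isClosed hKt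
  have hsupp : tsupport (fun z => (f z : ℂ)) ⊆ t := by
    refine closure_minimal (fun z hz => ?_) ht.isClosed
    by_contra hzt
    exact hz (by simp [hf0 z hzt])
  refine ⟨fun z => (f z : ℂ), ?_, ht.of_isClosed_subset (isClosed_tsupport _) hsupp,
    hsupp.trans htV, ?_⟩
  · exact Complex.ofRealCLM.contDiff.comp f.contMDiff.contDiff
  · filter_upwards [hf1] with z hz
    simp [hz]

section Cutoff

variable {K V : Set ℂ} {ψ f g : ℂ → ℂ}

theorem ContDiff.mul_of_tsupport_subset (hψ : ContDiff ℝ 1 ψ) (hV : tsupport ψ ⊆ V)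
    (hf : AnalyticOnNhd ℂ f V) : ContDiff ℝ 1 (fun z => ψ z * f z) := by
  refine contDiff_iff_contDiffAt.2 fun z => ?_
  by_cases hz : z ∈ tsupport ψ
  · exact hψ.contDiffAt.mul (((hf z (hV hz)).contDiffAt (n := 1)).restrict_scalars ℝ)
  · refine (contDiffAt_const (c := (0 : ℂ))).congr_of_eventuallyEq ?_
    filter_upwards [notMem_tsupport_iff_eventuallyEq.1 hz] with w hw
    simp [hw]

theorem AnalyticOnNhd.exists_contDiff_eventuallyEq (hK : IsCompact K) (hf : AnalyticOnNhd ℂ f K) :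
    ∃ g : ℂ → ℂ, ContDiff ℝ 1 g ∧ g =ᶠ[𝓝ˢ K] f := by
  obtain ⟨ψ, hψ, -, hψV, hψ1⟩ := hK.exists_cutoff (isOpen_analyticAt ℂ f) hf
  refine ⟨fun z => ψ z * f z, hψ.mul_of_tsupport_subset hψV fun z hz => hz, ?_⟩
  filter_upwards [hψ1] with z hz
  simp [hz]

theorem AnalyticOnNhd.eventually_dbar_eq_zero (hf : AnalyticOnNhd ℂ f K) (hg : g =ᶠ[𝓝ˢ K] f) :
    ∀ᶠ z in 𝓝ˢ K, dbar g z = 0 := by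
  refine eventually_nhdsSet_iff_forall.2 fun z hz => ?_
  filter_upwards [(hg.filter_mono (nhds_le_nhdsSet hz)).eventuallyEq_nhds,
    (hf z hz).eventually_analyticAt] with w hw1 hw2
  rw [hw1.dbar_eq, hw2.dbar_eq_zero]

end Cutoff

namespace IsSchwarzOff

variable {Ω K : Set ℂ} {S f g : ℂ → ℂ}

theorem integral_add (h : IsSchwarzOff Ω K S) (hf : ContDiff ℝ 1 f) (hg : ContDiff ℝ 1 g)
    (hfK : ∀ᶠ z in 𝓝ˢ K, dbar f z = 0) (hgK : ∀ᶠ z in 𝓝ˢ K, dbar g z = 0) :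
    ∫ z in Ω, schwarzIntegrand S (f + g) z =
      (∫ z in Ω, schwarzIntegrand S f z) + ∫ z in Ω, schwarzIntegrand S g z := by
  rw [← MeasureTheory.integral_add (h.integrableOn hf hfK) (h.integrableOn hg hgK)]
  congr 1
  ext z
  simp only [schwarzIntegrand, Pi.add_apply,
    dbar_add (hf.contDiffAt.differentiableAt one_ne_zero)
      (hg.contDiffAt.differentiableAt one_ne_zero)]
  ring

theorem integral_const_smul (hf : ContDiff ℝ 1 f) (c : ℂ) :
    ∫ z in Ω, schwarzIntegrand S (c • f) z = c * ∫ z in Ω, schwarzIntegrand S f z := by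
  rw [← integral_const_mul]
  congr 1
  ext z
  simp only [schwarzIntegrand, Pi.smul_apply, smul_eq_mul,
    dbar_const_smul (hf.contDiffAt.differentiableAt one_ne_zero)]
  ring

theorem integral_congr (h : IsSchwarzOff Ω K S) (hf : ContDiff ℝ 1 f) (hg : ContDiff ℝ 1 g)
    (hgK : ∀ᶠ z in 𝓝ˢ K, dbar g z = 0) (hfg : f =ᶠ[𝓝ˢ K] g) :
    ∫ z in Ω, schwarzIntegrand S f z = ∫ z in Ω, schwarzIntegrand S g z := by
  have h0 : f - g =ᶠ[𝓝ˢ K] 0 := by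
    filter_upwards [hfg] with z hz
    simp [hz]
  have hd : ∀ᶠ z in 𝓝ˢ K, dbar (f - g) z = 0 :=
    (analyticOnNhd_const (v := (0 : ℂ))).eventually_dbar_eq_zero h0
  have hsub : ContDiff ℝ 1 (f - g) := hf.sub hg
  have h1 := h.integral_add hsub hg hd hgK
  rw [h.integral_eq_zero hsub h0, sub_add_cancel, zero_add] at h1
  exact h1

/-- Since `f` is holomorphic on the support of `ψ`, the integrand of `ψ f` is `f` times that of `ψ`,
and the constant depends on `ψ` only. -/
theorem norm_integral_le (h : IsSchwarzOff Ω K S) {ψ : ℂ → ℂ} (hψ : ContDiff ℝ 1 ψ)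
    (hψK : ψ =ᶠ[𝓝ˢ K] 1) (hf : AnalyticOnNhd ℂ f (tsupport ψ)) {M : ℝ} (hM : 0 ≤ M)
    (hfM : ∀ z ∈ tsupport ψ, ‖f z‖ ≤ M) :
    ‖∫ z in Ω, schwarzIntegrand S (fun z => ψ z * f z) z‖ ≤
      (∫ z in Ω, ‖schwarzIntegrand S ψ z‖) * M := by
  have hintg : IntegrableOn (schwarzIntegrand S ψ) Ω := h.integrableOn hψ
    ((analyticOnNhd_const (v := (1 : ℂ))).eventually_dbar_eq_zero hψK)
  rw [← integral_mul_const]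
  refine norm_integral_le_of_norm_le (hintg.norm.mul_const M) (ae_of_all _ fun z => ?_)
  by_cases hz : z ∈ tsupport ψ
  · have h1 : schwarzIntegrand S (fun z => ψ z * f z) z = schwarzIntegrand S ψ z * f z := by
      simp only [schwarzIntegrand]
      rw [dbar_mul (hψ.contDiffAt.differentiableAt one_ne_zero)
        ((hf z hz).differentiableAt.restrictScalars ℝ), (hf z hz).dbar_eq_zero]
      ring
    rw [h1, norm_mul]
    exact mul_le_mul_of_nonneg_left (hfM z hz) (norm_nonneg _)
  · have h0 : (fun z => ψ z * f z) =ᶠ[𝓝 z] fun _ => 0 := by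
      filter_upwards [notMem_tsupport_iff_eventuallyEq.1 hz] with w hw
      simp [hw]
    have h1 : schwarzIntegrand S (fun z => ψ z * f z) z = 0 := by
      rw [schwarzIntegrand, h0.dbar_eq, analyticAt_const.dbar_eq_zero, mul_zero, add_zero]
      exact h0.eq_of_nhds
    rw [h1, norm_zero]
    positivity

/-- The functional represented by the integral, on germs along any compact set containing `K`. -/
theorem exists_analyticFunctional (h : IsSchwarzOff Ω K S) {K₁ : Set ℂ} (hK₁ : IsCompact K₁)
    (hK : K ⊆ K₁) :
    ∃ u : AnalyticFunctional K₁, ∀ (f : ℂ → ℂ) (hf : AnalyticOnNhd ℂ f K₁) (g : ℂ → ℂ),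
      ContDiff ℝ 1 g → g =ᶠ[𝓝ˢ K₁] f →
      u.toLinearMap (analyticGerm f hf) = ∫ z in Ω, schwarzIntegrand S g z := by
  have hmono : 𝓝ˢ K ≤ 𝓝ˢ K₁ := nhdsSet_mono hK
  have hrep : ∀ φ : analyticGerms K₁, ∃ g : ℂ → ℂ, ContDiff ℝ 1 g ∧
      (∀ᶠ z in 𝓝ˢ K, dbar g z = 0) ∧ φ.1 = (g : Germ (𝓝ˢ K₁) ℂ) := by
    rintro ⟨_, f, hf, rfl⟩
    obtain ⟨g, hg, hgf⟩ := hf.exists_contDiff_eventuallyEq hK₁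
    exact ⟨g, hg, (hf.eventually_dbar_eq_zero hgf).filter_mono hmono, Germ.coe_eq.2 hgf.symm⟩
  -- Each germ gets a global `C¹` representative; by `integral_congr` the value does not depend on
  -- the choice, which also gives linearity.
  choose G hG hGd hGeq using hrep
  have hval : ∀ (φ : analyticGerms K₁) (g : ℂ → ℂ), ContDiff ℝ 1 g →
      φ.1 = (g : Germ (𝓝ˢ K₁) ℂ) →
      ∫ z in Ω, schwarzIntegrand S (G φ) z = ∫ z in Ω, schwarzIntegrand S g z := by
    intro φ g hg hφ
    have h1 : g =ᶠ[𝓝ˢ K₁] G φ := Germ.coe_eq.1 (hφ.symm.trans (hGeq φ))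
    exact (h.integral_congr hg (hG φ) (hGd φ) (h1.filter_mono hmono)).symm
  let u : analyticGerms K₁ →ₗ[ℂ] ℂ :=
    { toFun := fun φ => ∫ z in Ω, schwarzIntegrand S (G φ) z
      map_add' := fun φ χ => by
        rw [← h.integral_add (hG φ) (hG χ) (hGd φ) (hGd χ)]
        refine hval _ _ ((hG φ).add (hG χ)) ?_
        rw [Submodule.coe_add, hGeq φ, hGeq χ]
        rfl
      map_smul' := fun c φ => by
        rw [RingHom.id_apply, smul_eq_mul, ← integral_const_smul (hG φ)]
        refine hval _ _ ((hG φ).const_smul c) ?_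
        rw [Submodule.coe_smul, hGeq φ]
        rfl }
  have hu : ∀ (f : ℂ → ℂ) (hf : AnalyticOnNhd ℂ f K₁) (g : ℂ → ℂ), ContDiff ℝ 1 g →
      g =ᶠ[𝓝ˢ K₁] f → u (analyticGerm f hf) = ∫ z in Ω, schwarzIntegrand S g z :=
    fun f hf g hg hgf => hval _ g hg (Germ.coe_eq.2 hgf.symm)
  refine ⟨⟨u, fun V hV hKV => ?_⟩, hu⟩
  obtain ⟨ψ, hψ, hψc, hψV, hψ1⟩ := hK₁.exists_cutoff hV hKV
  refine ⟨tsupport ψ, hψc, hψV, ∫ z in Ω, ‖schwarzIntegrand S ψ z‖, fun f hf M hM hfM => ?_⟩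
  rw [hu f (hf.mono hKV) (fun z => ψ z * f z) (hψ.mul_of_tsupport_subset hψV hf) (by
    filter_upwards [hψ1] with z hz
    simp [hz])]
  exact h.norm_integral_le hψ (hψ1.filter_mono hmono) (hf.mono hψV) hM hfM

/-- The area integral is an analytic functional carried by `K`. -/
theorem exists_carriedBy (h : IsSchwarzOff Ω K S) (hK : K ⊆ closure Ω) :
    ∃ u : AnalyticFunctional (closure Ω), u.CarriedBy K ∧
      ∀ (f : ℂ → ℂ) (hf : AnalyticOnNhd ℂ f (closure Ω)),
        ∫ z in Ω, f z = u.toLinearMap (analyticGerm f hf) := by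
  have hΩc := h.isBounded.isCompact_closure
  obtain ⟨u, hu⟩ := h.exists_analyticFunctional hΩc hK
  obtain ⟨v, hv⟩ := h.exists_analyticFunctional h.isCompact subset_rfl
  refine ⟨u, ⟨hK, v, fun f hf => ?_⟩, fun f hf => ?_⟩ <;>
    obtain ⟨g, hg, hgf⟩ := hf.exists_contDiff_eventuallyEq hΩc
  -- The same `g` represents `f` along `closure Ω` and along `K`, so both functionals are given by
  -- the same integral.
  · rw [hu f hf g hg hgf, hv f (hf.mono hK) g hg (hgf.filter_mono (nhdsSet_mono hK))]
  · rw [hu f hf g hg hgf]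
    refine setIntegral_congr_fun h.isOpen.measurableSet fun z hz => ?_
    have h1 := (hgf.and (hf.eventually_dbar_eq_zero hgf)).self_of_nhdsSet z (subset_closure hz)
    simp [schwarzIntegrand, h1.1, h1.2]

end IsSchwarzOff

/-! ### The cut domain and its boundary -/

section CutDomain

variable {Ω E : Set ℂ}

/-- The boundary of the cut domain consists of the cuts and the interior boundaries. -/
theorem IsCutSystem.frontier_cutDomain (hΩ : IsOpen Ω) (hE : IsCutSystem Ω E) :
    frontier (cutDomain Ω E) = E ∪ (frontier Ω \ closure (unboundedComponent Ω)) := by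
  -- `E` has empty interior, so removing it from the open set formed by `Ω` and the unbounded
  -- component does not change the closure.
  have hcl : closure (cutDomain Ω E) = closure (unboundedComponent Ω) ∪ closure Ω := by
    refine Set.Subset.antisymm ?_ ?_
    · refine closure_minimal (fun z hz => hz.1.imp_right fun h => _root_.subset_closure h)
        (isClosed_closure.union isClosed_closure)
    · rw [← closure_union]
      refine closure_minimal (((interior_eq_empty_iff_dense_compl.1 hE.thin).open_subset_closure_inter
        (isOpen_unboundedComponent.union hΩ)).trans (closure_mono fun z hz => ?_)) isClosed_closure
      exact ⟨hz.1.imp_left fun h => _root_.subset_closure h, hz.2⟩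
  rw [hE.isOpen_cutDomain.frontier_eq, hcl, hΩ.frontier_eq]
  ext z
  have := @hE.subset_closure z
  simp only [cutDomain, Set.mem_sdiff, Set.mem_union]
  tauto

/-- Removing `∂Ω'_E` from `∂Ω` discards the interior boundaries and the cuts and leaves only points
of `∂C \ E`, where `S = conj z`. -/
theorem IsCutSystem.exists_isSchwarzOff (hΩ : IsOpen Ω) (hbdd : Bornology.IsBounded Ω)
    (hvol : volume (frontier Ω) = 0) (hE : IsCutSystem Ω E) :
    ∃ S, IsSchwarzOff Ω (frontier (cutDomain Ω E)) S := by
  obtain ⟨S, hS, hS0⟩ := hE.extends_conj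
  have hfr := hE.frontier_cutDomain hΩ
  have hsub : frontier (cutDomain Ω E) ⊆ closure Ω := by
    rw [hfr]
    exact Set.union_subset hE.subset_closure fun z hz => hz.1.1
  have hmem : ∀ z ∈ frontier Ω, z ∉ frontier (cutDomain Ω E) →
      z ∈ frontier (unboundedComponent Ω) \ E := by
    intro z hz hz'
    rw [hfr] at hz'
    have hzC : z ∈ closure (unboundedComponent Ω) := by
      by_contra h
      exact hz' (Or.inr ⟨hz, h⟩)
    exact ⟨⟨hzC, fun h => (interior_subset h).1 hz.1⟩, fun h => hz' (Or.inl h)⟩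
  refine ⟨S, hΩ, hbdd, hvol, hbdd.isCompact_closure.of_isClosed_subset isClosed_frontier hsub,
    fun z hz => hS z ?_, fun z hz => hS0 z (hmem z hz.1 hz.2)⟩
  by_cases hzΩ : z ∈ Ω
  · refine ⟨Or.inl hzΩ, fun h => hz.2 ?_⟩
    rw [hfr]
    exact Or.inl h
  · have h1 := hmem z ⟨hz.1, fun h => hzΩ (interior_subset h)⟩ hz.2
    exact ⟨Or.inr h1.1, h1.2⟩

end CutDomain

theorem corollary4p2 (Ω : Set ℂ) (hopen : IsOpen Ω) (hconn : IsConnected Ω)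
    (hbdd : Bornology.IsBounded Ω) (halg : HasRealAlgebraicBoundary Ω) :
    (∃ E : Set ℂ, IsCutSystem Ω E ∧ branchSet Ω ⊆ E) ∧
    ∀ E : Set ℂ, IsCutSystem Ω E →
      frontier (cutDomain Ω E) = E ∪ (frontier Ω \ closure (unboundedComponent Ω)) ∧
      ∃ u : AnalyticFunctional (closure Ω),
        u.CarriedBy (frontier (cutDomain Ω E)) ∧
        ∀ (f : ℂ → ℂ) (hf : AnalyticOnNhd ℂ f (closure Ω)),
          ∫ z in Ω, f z = u.toLinearMap (analyticGerm f hf) := by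
  refine ⟨halg.exists_isCutSystem hopen hconn hbdd, fun E hE => ?_⟩
  obtain ⟨S, hS⟩ := hE.exists_isSchwarzOff hopen hbdd halg.volume_frontier
  refine ⟨hE.frontier_cutDomain hopen, hS.exists_carriedBy ?_⟩
  rw [hE.frontier_cutDomain hopen]
  exact Set.union_subset hE.subset_closure fun z hz => hz.1.1
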